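/- Let $n\ge 2$, let $\eta=\mathrm{diag}(1,1,-1,\dots,-1)$ be indexed by $-1,0,1,\dots,n$, let $\mathcal G_n=\mathfrak{so}(2,n)$ with its basis $M_{ab}$ $(-1\le a<b\le n)$, $M_{ab}=-M_{ba}$, $[M_{ab},M_{cd}]=\eta_{ad}M_{bc}+\eta_{bc}M_{ad}-\eta_{ac}M_{bd}-\eta_{bd}M_{ac}$, and let $\tilde C_n$ be the universal covering group of $SO_0(2,n)$. Let $U$ be a $C_n$-massless representation of $\tilde C_n$ on a complex Hilbert space $\mathcal H$: a nontrivial highest weight, (strongly continuous) unitary, irreducible representation whose restriction to the connected subgroup with Lie algebra $\mathcal P_n=\langle M_{-1,\alpha}+M_{\alpha,n},\ M_{\alpha\beta}:0\le\alpha,\beta\le n-1\rangle$ (the covering of the $n$-Poincaré group) is irreducible. For $X\in\mathcal G_n$ let $U(X)$ denote the generator of $t\mapsto U(\exp tX)$. For $0<\rho\le 1$ let $\mathbf S_\rho$ be the linear operator on $\mathcal G_n$ with $\mathbf S_\rho M_{\alpha\beta}=M_{\alpha\beta}$ and $\mathbf S_\rho M_{-1,\alpha}=\sqrt\rho\,M_{-1,\alpha}$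 $(0\le\alpha,\beta\le n)$, and let $[x,y]_\rho=\mathbf S_\rho^{-1}[\mathbf S_\rho x,\mathbf S_\rho y]$. Let $(\mathbf Z_\rho)_{0<\rho\le1}$ be any family of closed injective operators of $\mathcal H$ with $\mathbf Z_1=1$ and $\mathbf Z_\rho^{-1}U(M_{\alpha\beta})\mathbf Z_\rho=U(M_{\alpha\beta})$ (as unbounded operators) for $0\le\alpha,\beta\le n$, and put $U_\rho(x)=\mathbf Z_\rho^{-1}\,U(\mathbf S_\rho x)\,\mathbf Z_\rho$. Let $T_{n+1}=\mathbb R^{1,n}$, let $\tilde L_{n+1}\subset\tilde C_n$ be the connected subgroup with Lie algebra $\langle M_{\alpha\beta}:0\le\alpha,\beta\le n\rangle$, which covers $L_{n+1}=SO_0(1,n)$, and let $\tilde P_{n+1}=\tilde L_{n+1}\ltimes T_{n+1}$, in whose Lie algebra $M_{-1,\alpha}$ is identified with the generator of the translations along the basis vector $e_\alpha$. Then: 1. $\rho$ is the curvature: for $a,b,c\in\mathbb R^{1,n}$, writing $M_{-1}(a)=\sum_\alpha a^\alpha M_{-1,\alpha}$, the curvature tensor $R(x,y)z=-[[x,y]_\rho,z]_\rho$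 of the homogeneous space $S_{n+1}/L_{n+1}$ satisfies $R(M_{-1}(a),M_{-1}(b))M_{-1}(c)=\rho\,M_{-1}\bigl(\eta(b,c)a-\eta(a,c)b\bigr)$. 2. As $\rho\to0^+$, $[x,y]_\rho$ converges to the bracket of the Poincaré algebra $\mathcal P_{n+1}=\mathfrak{so}(1,n)\ltimes\mathbb R^{1,n}$, for all $x,y$. 3. The space of smooth vectors of $U$ is dense in $\mathcal H$, and for every smooth vector $v$ and every $a\in\mathbb R^{1,n}$, $U_\rho(M_{-1}(a))v$ is defined for all $0<\rho\le1$ and tends to $0$ as $\rho\to0^+$. 4. There is exactly one strongly continuous unitary representation $W$ of $\tilde P_{n+1}$ on $\mathcal H$ (the contracted representation) such that for every smooth vector $v$ of $U$, and every $x$ in $\langle M_{\alpha\beta}:0\le\alpha,\beta\le n\rangle$ or of the form $x=M_{-1}(a)$, $U_\rho(x)v$ is defined for all $0<\rho\le1$ and converges, as $\rho\to0^+$, to $\frac{d}{dt}\big|_{t=0}W(\exp tx)v$; and this $W$ is trivial on $T_{n+1}$. -/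

import Mathlib

noncomputable section

namespace ConfMassless

open Filter Topology
open scoped Matrix ContDiff

attribute [local instance 100] LieRing.ofAssociativeRing

/-! ### The group `SO₀(2,n)` and its Lie algebra

The indices `-1, 0, 1, …, n` of the pseudo-orthonormal basis are represented by
`0, 1, 2, …, n + 1 : Fin (n + 2)`. -/

/-- The diagonal entries of `η`: `1` for the indices `-1, 0` and `-1` for the indices `1, …, n`. -/
def metric (n : ℕ) (a : Fin (n + 2)) : ℝ := if (a : ℕ) < 2 then 1 else -1

/-- The matrix `η = diag(1, 1, -1, …, -1)`. -/
def eta (n : ℕ) : Matrix (Fin (n + 2)) (Fin (n + 2)) ℝ := Matrix.diagonal (metric n)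

/-- The group `O(2,n)`, with the topology of a subgroup of the general linear group. -/
def indefO (n : ℕ) : Subgroup (GL (Fin (n + 2)) ℝ) where
  carrier := {A | (A.val)ᵀ * eta n * A.val = eta n}
  one_mem' := by simp
  mul_mem' := by
    intro A B hA hB
    simp only [Set.mem_ofPred_eq, Units.val_mul, Matrix.transpose_mul] at *
    calc _ = (B.val)ᵀ * ((A.val)ᵀ * eta n * A.val) * B.val := by simp only [Matrix.mul_assoc]
      _ = _ := by rw [hA, hB]
  inv_mem' := by
    intro A hA
    simp only [Set.mem_ofPred_eq] at *
    have h1 : A.val * (A⁻¹).val = 1 := A.mul_inv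
    have h2 : ((A⁻¹).val)ᵀ * (A.val)ᵀ = 1 := by
      rw [← Matrix.transpose_mul, h1, Matrix.transpose_one]
    calc _ = ((A⁻¹).val)ᵀ * ((A.val)ᵀ * eta n * A.val) * (A⁻¹).val := by rw [hA]
      _ = (((A⁻¹).val)ᵀ * (A.val)ᵀ) * eta n * (A.val * (A⁻¹).val) := by
          simp only [Matrix.mul_assoc]
      _ = _ := by rw [h1, h2]; simp

/-- `SO₀(2,n)`, the identity component of `O(2,n)`. -/
abbrev SO0 (n : ℕ) : Subgroup (indefO n) := Subgroup.connectedComponentOfOne (indefO n)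

/-- The matrix of an element of `SO₀(2,n)`. -/
def mat {n : ℕ} (g : SO0 n) : Matrix (Fin (n + 2)) (Fin (n + 2)) ℝ :=
  ((g : indefO n) : GL (Fin (n + 2)) ℝ).val

/-- The Lie algebra `𝒢_n = so(2,n)`. -/
abbrev so (n : ℕ) : LieSubalgebra ℝ (Matrix (Fin (n + 2)) (Fin (n + 2)) ℝ) :=
  skewAdjointMatricesLieSubalgebra (eta n)

theorem mem_so_iff {n : ℕ} (A : Matrix (Fin (n + 2)) (Fin (n + 2)) ℝ) :
    A ∈ so n ↔ Aᵀ * eta n = eta n * (-A) := by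
  rw [mem_skewAdjointMatricesLieSubalgebra, mem_skewAdjointMatricesSubmodule]
  rfl

theorem mem_so_iff_entries {n : ℕ} (A : Matrix (Fin (n + 2)) (Fin (n + 2)) ℝ) :
    A ∈ so n ↔ ∀ c d, A d c * metric n d = -(metric n c * A c d) := by
  rw [mem_so_iff, ← Matrix.ext_iff]
  simp [eta, Matrix.mul_diagonal, Matrix.diagonal_mul]

/-- The generators `M_{ab} = e_a ⊗ e_b^♭ - e_b ⊗ e_a^♭`. They satisfy `M_{ab} = -M_{ba}` and
`[M_{ab}, M_{cd}] = η_{ad} M_{bc} + η_{bc} M_{ad} - η_{ac} M_{bd} - η_{bd} M_{ac}`. -/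
def M {n : ℕ} (a b : Fin (n + 2)) : so n :=
  ⟨Matrix.single a b (metric n b) - Matrix.single b a (metric n a), by
    rw [mem_so_iff_entries]
    intro c d
    simp only [Matrix.sub_apply, Matrix.single_apply]
    by_cases h1 : a = c <;> by_cases h2 : a = d <;> by_cases h3 : b = c <;>
      by_cases h4 : b = d <;> simp [h1, h2, h3, h4] <;> (try subst_vars) <;> simp_all [mul_comm]⟩

theorem exp_mem_indefO {n : ℕ} (X : so n) (t : ℝ) :
    (NormedSpace.exp (t • (X : Matrix (Fin (n + 2)) (Fin (n + 2)) ℝ)))ᵀ * eta n *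
      NormedSpace.exp (t • (X : Matrix (Fin (n + 2)) (Fin (n + 2)) ℝ)) = eta n := by
  have hη : eta n * eta n = 1 := by
    rw [eta, Matrix.diagonal_mul_diagonal, ← Matrix.diagonal_one]
    congr 1
    funext a
    simp only [metric]
    split_ifs <;> norm_num
  have hu : IsUnit (eta n) := IsUnit.of_mul_eq_one _ hη
  have hinv : (eta n)⁻¹ = eta n := Matrix.inv_eq_right_inv hη
  have hX := (mem_so_iff _).1 X.2
  have hc : (t • (X : Matrix (Fin (n + 2)) (Fin (n + 2)) ℝ))ᵀ
      = eta n * (-(t • (X : Matrix (Fin (n + 2)) (Fin (n + 2)) ℝ))) * (eta n)⁻¹ := by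
    rw [hinv, Matrix.transpose_smul, ← smul_neg, Matrix.mul_smul, ← hX, Matrix.smul_mul,
      Matrix.mul_assoc, hη, Matrix.mul_one]
  rw [← Matrix.exp_transpose, hc, Matrix.exp_conj _ _ hu, hinv, Matrix.mul_assoc,
    Matrix.mul_assoc, ← Matrix.mul_assoc (eta n) (eta n), hη, Matrix.one_mul, Matrix.mul_assoc,
    ← Matrix.exp_add_of_commute _ _ (Commute.neg_left (Commute.refl (t • X.1)))]
  simp

/-- `exp(tX)` as an element of `O(2,n)`. -/
def expO {n : ℕ} (X : so n) (t : ℝ) : indefO n :=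
  ⟨{ val := NormedSpace.exp (t • (X : Matrix (Fin (n + 2)) (Fin (n + 2)) ℝ))
     inv := NormedSpace.exp (-(t • (X : Matrix (Fin (n + 2)) (Fin (n + 2)) ℝ)))
     val_inv := by
      rw [← Matrix.exp_add_of_commute _ _ (Commute.neg_right (Commute.refl (t • X.1)))]; simp
     inv_val := by
      rw [← Matrix.exp_add_of_commute _ _ (Commute.neg_left (Commute.refl (t • X.1)))]; simp },
   exp_mem_indefO X t⟩

theorem continuous_matrix_exp {m : ℕ} :
    Continuous (NormedSpace.exp : Matrix (Fin m) (Fin m) ℝ → Matrix (Fin m) (Fin m) ℝ) := by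
  open scoped Matrix.Norms.Operator in
  exact NormedSpace.exp_continuous

theorem continuous_expO {n : ℕ} (X : so n) : Continuous (expO X) := by
  refine Continuous.subtype_mk (Units.continuous_iff.2 ⟨?_, ?_⟩) _
  · exact continuous_matrix_exp.comp (continuous_id.smul continuous_const)
  · exact continuous_matrix_exp.comp (continuous_id.smul continuous_const).neg

theorem expO_zero {n : ℕ} (X : so n) : expO X 0 = 1 := by
  apply Subtype.ext
  apply Units.ext
  simp [expO]

theorem expO_mem {n : ℕ} (X : so n) (t : ℝ) : expO X t ∈ SO0 n := by
  have h : IsPreconnected (Set.range (expO X)) := isPreconnected_range (continuous_expO X)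
  exact h.subset_connectedComponent ⟨0, expO_zero X⟩ ⟨t, rfl⟩

/-- The one-parameter subgroup `t ↦ exp(tX)` of `SO₀(2,n)`. -/
def expSO {n : ℕ} (X : so n) : C(ℝ, SO0 n) :=
  ⟨fun t => ⟨expO X t, expO_mem X t⟩, (continuous_expO X).subtype_mk _⟩

/-! ### The universal covering group

A universal covering group of `SO₀(2,n)` is a simply connected topological group `G` with a
homomorphism `p : G →* SO0 n` that is a covering map. -/

section Cover

variable {n : ℕ} {G : Type*} [Group G] [TopologicalSpace G] {p : G →* SO0 n}

theorem exists_oneParam (hp : IsCoveringMap p) (X : so n) :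
    ∃ γ : C(ℝ, G), γ 0 = 1 ∧ ∀ t, p (γ t) = expSO X t := by
  obtain ⟨γ, ⟨h0, h1⟩, -⟩ := hp.existsUnique_continuousMap_lifts (expSO X) (a₀ := (0 : ℝ))
    (e₀ := (1 : G)) (by
      rw [map_one]
      exact (Subtype.ext (expO_zero X)).symm)
  exact ⟨γ, h0, fun t => congrFun h1 t⟩

/-- The one-parameter subgroup `t ↦ exp(tX)` of the covering group: the unique continuous lift
of `t ↦ exp(tX) ∈ SO₀(2,n)` that starts at `1`. -/
def oneParam (hp : IsCoveringMap p) (X : so n) : C(ℝ, G) := (exists_oneParam hp X).choose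

/-- The connected Lie subgroup of the covering group with Lie algebra `𝔥`: the subgroup generated
by the one-parameter subgroups with generators in `𝔥`. -/
def analyticSubgroup (hp : IsCoveringMap p) (𝔥 : Submodule ℝ (so n)) : Subgroup G :=
  Subgroup.closure {g | ∃ X ∈ 𝔥, ∃ t : ℝ, oneParam hp X t = g}

theorem oneParam_mem (hp : IsCoveringMap p) {𝔥 : Submodule ℝ (so n)} {X : so n} (hX : X ∈ 𝔥)
    (t : ℝ) : oneParam hp X t ∈ analyticSubgroup hp 𝔥 :=
  Subgroup.subset_closure ⟨X, hX, t, rfl⟩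

end Cover

/-- The Poincaré algebra `𝒫_n = 𝓛_n + 𝒯_n ⊆ 𝒢_n`, spanned by the `M_{-1,α} + M_{α,n}` and the
`M_{αβ}` with `0 ≤ α, β ≤ n - 1`. -/
def poincareAlg (n : ℕ) : Submodule ℝ (so n) :=
  Submodule.span ℝ
    ({X | ∃ α : Fin n, X = M 0 α.succ.castSucc + M α.succ.castSucc (Fin.last (n + 1))} ∪
      {X | ∃ α β : Fin n, X = M α.succ.castSucc β.succ.castSucc})

/-- The Lorentz algebra `𝓛_{n+1} ⊆ 𝒢_n`, spanned by the `M_{αβ}` with `0 ≤ α, β ≤ n`. -/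
def lorentzAlg (n : ℕ) : Submodule ℝ (so n) :=
  Submodule.span ℝ {X | ∃ α β : Fin (n + 1), X = M α.succ β.succ}

/-! ### Unitary representations -/

/-- A strongly continuous unitary representation of `G` on the Hilbert space `H`. -/
structure UnitaryRep (G : Type*) [Group G] [TopologicalSpace G] (H : Type*)
    [NormedAddCommGroup H] [InnerProductSpace ℂ H] [CompleteSpace H] where
  toHom : G →* unitary (H →L[ℂ] H)
  continuous_orbit : ∀ v : H, Continuous fun g : G => (toHom g : H →L[ℂ] H) v

section Rep

variable {n : ℕ} {G : Type*} [Group G] [TopologicalSpace G] {p : G →* SO0 n}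
  {H : Type*} [NormedAddCommGroup H] [InnerProductSpace ℂ H] [CompleteSpace H]

/-- The operator `U(g)`. -/
def UnitaryRep.op (U : UnitaryRep G H) (g : G) : H →L[ℂ] H := (U.toHom g : H →L[ℂ] H)

/-- The restriction of `U` to the subgroup `S` is irreducible. -/
def UnitaryRep.IsIrreducibleOn (U : UnitaryRep G H) (S : Subgroup G) : Prop :=
  Nontrivial H ∧ ∀ K : Submodule ℂ H, IsClosed (K : Set H) →
    (∀ g ∈ S, ∀ v ∈ K, U.op g v ∈ K) → K = ⊥ ∨ K = ⊤

/-- The operator `U(X) = dU(X)` for `X ∈ 𝒢_n`: the generator of `t ↦ U(exp(tX))`, defined on all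
vectors at which this one-parameter group is differentiable. -/
def dU (hp : IsCoveringMap p) (U : UnitaryRep G H) (X : so n) : H →ₗ.[ℂ] H where
  domain :=
    { carrier := {v | DifferentiableAt ℝ (fun t : ℝ => U.op (oneParam hp X t) v) 0}
      add_mem' := fun {v w} hv hw => by
        simp only [Set.mem_ofPred_eq, map_add] at *
        exact hv.fun_add hw
      zero_mem' := by simp
      smul_mem' := fun c v hv => by
        simp only [Set.mem_ofPred_eq, map_smul] at *
        exact hv.fun_const_smul c }
  toFun :=
    { toFun := fun v => deriv (fun t : ℝ => U.op (oneParam hp X t) (v : H)) 0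
      map_add' := fun v w => by
        simp only [Submodule.coe_add, map_add]
        exact deriv_fun_add v.2 w.2
      map_smul' := fun c v => by
        simp only [Submodule.coe_smul, map_smul, RingHom.id_apply]
        exact deriv_fun_const_smul c v.2 }

/-- The space of smooth vectors: the orbit map `g ↦ U(g) v` is smooth near `1`, hence everywhere,
read in the chart given by the exponential map, `𝒢_n` being parametrized linearly by the
coefficients of the `M_{ab}`. -/
def smoothVectors (hp : IsCoveringMap p) (U : UnitaryRep G H) : Submodule ℂ H where
  carrier := {v | ContDiffAt ℝ ∞ (fun c : Fin (n + 2) → Fin (n + 2) → ℝ =>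
    U.op (oneParam hp (∑ a, ∑ b, c a b • M a b) 1) v) 0}
  add_mem' := fun {v w} hv hw => by
    simp only [Set.mem_ofPred_eq, map_add] at *
    exact hv.add hw
  zero_mem' := by
    simp only [Set.mem_ofPred_eq, map_zero]
    exact contDiffAt_const
  smul_mem' := fun c v hv => by
    simp only [Set.mem_ofPred_eq, map_smul] at *
    exact hv.const_smul c

/-- The isotropic vectors `e_{2j} + σ i e_{2j+1}` of `ℂ^{n+2}` (in the numbering `0, …, n + 1`);
for `n` odd and `2j = n + 1` this is the last basis vector. With `f_j^± = isoVec n j (±1)`, the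
bivectors `f_j^+ ∧ f_k^±` (`j < k`) and, for `n` odd, `f_j^+ ∧ e_{n+1}` are root vectors for the
positive roots `e_j ± e_k` and `e_j`. -/
def isoVec (n j : ℕ) (σ : ℂ) (a : Fin (n + 2)) : ℂ :=
  if (a : ℕ) = 2 * j then 1 else if (a : ℕ) = 2 * j + 1 then σ * Complex.I else 0

/-- The action on a smooth vector `v` of the element `f ∧ g = ∑ f_a g_b M_{ab}` of the
complexification of `𝒢_n`. -/
def wedgeAct (hp : IsCoveringMap p) (U : UnitaryRep G H) (f g : Fin (n + 2) → ℂ) (v : H) : H :=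
  ∑ a, ∑ b, (f a * g b) • deriv (fun t : ℝ => U.op (oneParam hp (M a b) t) v) 0

/-- `v` is a highest weight vector: a nonzero smooth vector, an eigenvector of the Cartan
subalgebra spanned by `M_{-1,0}, M_{1,2}, M_{3,4}, …`, and annihilated by all positive
root vectors. -/
structure IsHighestWeightVector (hp : IsCoveringMap p) (U : UnitaryRep G H) (v : H) : Prop where
  smooth : v ∈ smoothVectors hp U
  ne_zero : v ≠ 0
  weight : ∀ (j : ℕ) (hj : 2 * j + 1 < n + 2), ∃ c : ℂ,
    deriv (fun t : ℝ =>
      U.op (oneParam hp (M (n := n) ⟨2 * j, by omega⟩ ⟨2 * j + 1, hj⟩) t) v) 0 = c • v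
  annihilated : ∀ j k : ℕ, j < k → 2 * k < n + 2 → ∀ σ : ℂ, σ = 1 ∨ σ = -1 →
    wedgeAct hp U (isoVec n j 1) (isoVec n k σ) v = 0

/-- `U` is a highest weight representation: it is generated by a highest weight vector. -/
def IsHighestWeight (hp : IsCoveringMap p) (U : UnitaryRep G H) : Prop :=
  ∃ v, IsHighestWeightVector hp U v ∧
    Dense (Submodule.span ℂ (Set.range fun g : G => U.op g v) : Set H)

/-- `U` is `C_n`-massless: a nontrivial highest weight unitary representation that is irreducible
and remains irreducible on the (covering of the) Poincaré group `P_n`. -/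
structure IsCnMassless (hp : IsCoveringMap p) (U : UnitaryRep G H) : Prop where
  nontrivial : ∃ g, U.op g ≠ 1
  highestWeight : IsHighestWeight hp U
  irreducible : U.IsIrreducibleOn ⊤
  irreducible_poincare : U.IsIrreducibleOn (analyticSubgroup hp (poincareAlg n))

end Rep

/-! ### The contraction of the Lie algebra -/

/-- The linear operator on the vector space of `𝒢_n` with `M_{αβ} ↦ M_{αβ}` and
`M_{-1,α} ↦ s M_{-1,α}` for `0 ≤ α, β ≤ n`. -/
def rescale {n : ℕ} (s : ℝ) : so n →ₗ[ℝ] so n where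
  toFun X := ⟨Matrix.of fun c d => (if c = 0 ∨ d = 0 then s else 1) * X.1 c d, by
    have hX := (mem_so_iff_entries _).1 X.2
    rw [mem_so_iff_entries]
    intro c d
    simp only [Matrix.of_apply, or_comm (a := d = 0)]
    linear_combination (if c = 0 ∨ d = 0 then s else 1) * hX c d⟩
  map_add' X Y := by
    apply Subtype.ext
    ext c d
    simp [mul_add]
  map_smul' r X := by
    apply Subtype.ext
    ext c d
    simp [mul_left_comm]

/-- The contraction operator `S_ρ`. -/
def S {n : ℕ} (ρ : ℝ) : so n →ₗ[ℝ] so n := rescale (Real.sqrt ρ)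

/-- The bracket `[X,Y]_ρ = S_ρ⁻¹ [S_ρ X, S_ρ Y]` of `𝒢_n^ρ`. -/
def bracketρ {n : ℕ} (ρ : ℝ) (X Y : so n) : so n := rescale (Real.sqrt ρ)⁻¹ ⁅S ρ X, S ρ Y⁆

/-- The component in `𝓛_{n+1} = so(1,n)` of `X = A + ∑ a_α M_{-1,α}`, as an
`(n+1) × (n+1)` matrix. -/
def linPart {n : ℕ} (X : so n) : Matrix (Fin (n + 1)) (Fin (n + 1)) ℝ :=
  X.1.submatrix Fin.succ Fin.succ

/-- The coefficients `a_α` of the `M_{-1,α}` in `X`. -/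
def transPart {n : ℕ} (X : so n) : Fin (n + 1) → ℝ := fun α => -(X.1 α.succ 0)

/-- The element `∑ a_α M_{-1,α}`. -/
def translGen {n : ℕ} (a : Fin (n + 1) → ℝ) : so n := ∑ α : Fin (n + 1), a α • M 0 α.succ

/-- The Minkowski form `η_{αβ} a^α b^β`, `0 ≤ α, β ≤ n`, on `ℝ^{1,n}`. -/
def minkowski {n : ℕ} (a b : Fin (n + 1) → ℝ) : ℝ := ∑ α, metric n α.succ * a α * b α

/-! ### The covering of the Poincaré group `P_{n+1} = L_{n+1} ⋉ T_{n+1}` -/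

section Poincare

variable {n : ℕ} {G : Type*} [Group G] [TopologicalSpace G] {p : G →* SO0 n}

/-- The covering `L̃_{n+1}` of the Lorentz group `L_{n+1} = SO₀(1,n)`: the connected Lie subgroup
of the covering of `SO₀(2,n)` with Lie algebra `𝓛_{n+1}`. -/
abbrev LorentzCover (hp : IsCoveringMap p) : Subgroup G := analyticSubgroup hp (lorentzAlg n)

theorem lorentzAlg_col {X : so n} (hX : X ∈ lorentzAlg n) (c : Fin (n + 2)) : X.1 c 0 = 0 := by
  induction hX using Submodule.span_induction with
  | mem X hX =>
    obtain ⟨α, β, rfl⟩ := hX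
    simp [M]
  | zero => simp
  | add X Y _ _ hX hY => simp [hX, hY]
  | smul r X _ hX => simp [hX]

theorem exp_mulVec_eq {m : ℕ} (A : Matrix (Fin m) (Fin m) ℝ) (v : Fin m → ℝ)
    (h : A *ᵥ v = 0) : NormedSpace.exp A *ᵥ v = v := by
  open scoped Matrix.Norms.Operator in
  have hs := NormedSpace.exp_series_hasSum_exp' (𝕂 := ℝ) A
  have hc : Continuous fun B : Matrix (Fin m) (Fin m) ℝ => B *ᵥ v :=
    continuous_id.matrix_mulVec continuous_const
  have h1 := hs.map (Matrix.mulVecBilin ℝ ℝ |>.flip v) (by exact hc)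
  have h2 : HasSum (⇑((Matrix.mulVecBilin ℝ ℝ).flip v) ∘
      fun k : ℕ => ((Nat.factorial k : ℝ))⁻¹ • A ^ k) v := by
    convert! hasSum_ite_eq 0 v using 1
    funext k
    rcases k with _ | k
    · simp
    · simp only [Function.comp_apply, LinearMap.flip_apply, Matrix.mulVecBilin_apply, pow_succ,
        Matrix.smul_mulVec, ← Matrix.mulVec_mulVec, h]
      simp
  exact h1.unique h2

theorem lorentz_col (hp : IsCoveringMap p) {g : G} (hg : g ∈ LorentzCover hp) :
    mat (p g) *ᵥ Pi.single 0 1 = Pi.single 0 1 := by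
  induction hg using Subgroup.closure_induction with
  | mem g hg =>
    obtain ⟨X, hX, t, rfl⟩ := hg
    rw [oneParam, (exists_oneParam hp X).choose_spec.2 t]
    apply exp_mulVec_eq
    ext c
    simp [lorentzAlg_col hX]
  | one =>
    have h1 : mat (p 1) = 1 := by simp [mat]
    rw [h1, Matrix.one_mulVec]
  | mul g h _ _ ihg ihh =>
    have : mat (p (g * h)) = mat (p g) * mat (p h) := by simp [mat]
    rw [this, ← Matrix.mulVec_mulVec, ihh, ihg]
  | inv g _ ih =>
    have h1 : mat (p g⁻¹) * mat (p g) = 1 := by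
      have : mat (p (g⁻¹ * g)) = mat (p g⁻¹) * mat (p g) := by
        rw [map_mul]; rfl
      rw [← this, inv_mul_cancel, map_one]; rfl
    calc _ = mat (p g⁻¹) *ᵥ (mat (p g) *ᵥ Pi.single 0 1) := by rw [ih]
      _ = _ := by rw [Matrix.mulVec_mulVec, h1, Matrix.one_mulVec]

/-- The matrix of `g ∈ L̃_{n+1}` acting on `ℝ^{1,n}`, the span of `e_0, …, e_n`. -/
def lorentzMat (hp : IsCoveringMap p) :
    LorentzCover hp →* Matrix (Fin (n + 1)) (Fin (n + 1)) ℝ where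
  toFun g := (mat (p g)).submatrix Fin.succ Fin.succ
  map_one' := by
    have : mat (p ((1 : LorentzCover hp) : G)) = 1 := by simp [mat]
    rw [this]
    exact Matrix.submatrix_one _ (Fin.succ_injective _)
  map_mul' g h := by
    have hm : mat (p ((g * h : LorentzCover hp) : G)) = mat (p g) * mat (p h) := by simp [mat]
    have hz : ∀ α : Fin (n + 1), mat (p g) α.succ 0 = 0 := fun α => by
      have := congrFun (lorentz_col hp g.2) α.succ
      simpa using this
    rw [hm]
    ext α β
    simp [Matrix.mul_apply, Fin.sum_univ_succ (n := n + 1), hz]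

/-- The action of `L̃_{n+1}` on the translation group `T_{n+1} = ℝ^{1,n}`. -/
def lorentzAct (hp : IsCoveringMap p) :
    LorentzCover hp →* MulAut (Multiplicative (Fin (n + 1) → ℝ)) where
  toFun g := AddEquiv.toMultiplicative
    { toFun := fun a => lorentzMat hp g *ᵥ a
      invFun := fun a => lorentzMat hp g⁻¹ *ᵥ a
      left_inv := fun a => by simp [Matrix.mulVec_mulVec, ← map_mul]
      right_inv := fun a => by simp [Matrix.mulVec_mulVec, ← map_mul]
      map_add' := fun a b => Matrix.mulVec_add _ _ _ }
  map_one' := by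
    ext a : 1
    apply Multiplicative.toAdd.injective
    simp
  map_mul' g h := by
    ext a : 1
    apply Multiplicative.toAdd.injective
    simp [Matrix.mulVec_mulVec]

/-- The covering `P̃_{n+1} = T_{n+1} ⋊ L̃_{n+1}` of the Poincaré group. -/
abbrev PoincareCover (hp : IsCoveringMap p) : Type _ :=
  Multiplicative (Fin (n + 1) → ℝ) ⋊[lorentzAct hp] (LorentzCover hp)

/-- The product topology on `P̃_{n+1}`. -/
instance poincareTopology (hp : IsCoveringMap p) : TopologicalSpace (PoincareCover hp) :=
  TopologicalSpace.induced (fun x => (Multiplicative.toAdd x.left, x.right)) inferInstance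

/-- The translation by `a`, as an element of `P̃_{n+1}`. -/
def transl (hp : IsCoveringMap p) (a : Fin (n + 1) → ℝ) : PoincareCover hp :=
  SemidirectProduct.inl (Multiplicative.ofAdd a)

/-- An element of `L̃_{n+1}`, as an element of `P̃_{n+1}`. -/
def lorentzIncl (hp : IsCoveringMap p) (g : LorentzCover hp) : PoincareCover hp :=
  SemidirectProduct.inr g

end Poincare

/-! ### The contraction of representations -/

section Contraction

variable {n : ℕ} {G : Type*} [Group G] [TopologicalSpace G] {p : G →* SO0 n}
  {H : Type*} [NormedAddCommGroup H] [InnerProductSpace ℂ H] [CompleteSpace H]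

/-- The graph of the (possibly unbounded) operator `Z⁻¹ ∘ A ∘ Z` with its natural domain. -/
def conjGraph (Z A : H →ₗ.[ℂ] H) : Set (H × H) :=
  {x | ∃ v w : H, (x.1, v) ∈ Z.graph ∧ (v, w) ∈ A.graph ∧ (x.2, w) ∈ Z.graph}

/-- A family `(Z_ρ)`, `0 < ρ ≤ 1`, of closed invertible operators of `H` with `Z_1 = 1` and
`Z_ρ⁻¹ U(M_{αβ}) Z_ρ = U(M_{αβ})` for `0 ≤ α, β ≤ n`. Invertibility is only used in the weak
sense that `Z_ρ` is injective, and no continuity in `ρ` is required. -/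
structure IsContractionFamily (hp : IsCoveringMap p) (U : UnitaryRep G H)
    (Z : ℝ → H →ₗ.[ℂ] H) : Prop where
  closed : ∀ ρ ∈ Set.Ioc (0 : ℝ) 1, (Z ρ).IsClosed
  injective : ∀ ρ ∈ Set.Ioc (0 : ℝ) 1, Function.Injective (Z ρ)
  one : ∀ v : H, (v, v) ∈ (Z 1).graph
  commutes : ∀ ρ ∈ Set.Ioc (0 : ℝ) 1, ∀ α β : Fin (n + 1),
    conjGraph (Z ρ) (dU hp U (M α.succ β.succ)) = ((dU hp U (M α.succ β.succ)).graph : Set (H × H))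

/-- The graph of the operator `U_ρ(X) = Z_ρ⁻¹ ∘ U(S_ρ X) ∘ Z_ρ`. -/
def Uρ (hp : IsCoveringMap p) (U : UnitaryRep G H) (Z : ℝ → H →ₗ.[ℂ] H) (ρ : ℝ) (X : so n) :
    Set (H × H) :=
  conjGraph (Z ρ) (dU hp U (S ρ X))

/-- On the vector `v` the operators `U_ρ(X)`, `0 < ρ ≤ 1`, are all defined and
`U_ρ(X) v → w` as `ρ → 0`. -/
def TendsToAt (hp : IsCoveringMap p) (U : UnitaryRep G H) (Z : ℝ → H →ₗ.[ℂ] H) (X : so n)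
    (v w : H) : Prop :=
  ∃ u : ℝ → H, (∀ ρ ∈ Set.Ioc (0 : ℝ) 1, (v, u ρ) ∈ Uρ hp U Z ρ X) ∧
    Tendsto u (𝓝[>] 0) (𝓝 w)

/-- `W` is the contracted representation: a unitary representation of `P̃_{n+1}` whose
differential is, on the smooth vectors of `U`, the limit of the `U_ρ` as `ρ → 0`, where
`M_{αβ}` corresponds to the Lorentz generators of the Poincaré group and `M_{-1,α}` to the
translations. -/
structure IsContraction (hp : IsCoveringMap p) (U : UnitaryRep G H) (Z : ℝ → H →ₗ.[ℂ] H)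
    (W : UnitaryRep (PoincareCover hp) H) : Prop where
  lorentz : ∀ v ∈ smoothVectors hp U, ∀ (X : so n) (hX : X ∈ lorentzAlg n), ∃ w : H,
    TendsToAt hp U Z X v w ∧
    HasDerivAt (fun t : ℝ => W.op (lorentzIncl hp ⟨oneParam hp X t, oneParam_mem hp hX t⟩) v) w 0
  translation : ∀ v ∈ smoothVectors hp U, ∀ a : Fin (n + 1) → ℝ, ∃ w : H,
    TendsToAt hp U Z (translGen a) v w ∧
    HasDerivAt (fun t : ℝ => W.op (transl hp (t • a)) v) w 0

end Contraction

end ConfMassless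

end

open ConfMassless Filter Topology
open scoped Matrix

noncomputable section

namespace ConfMassless

open Filter Topology
open scoped Matrix ContDiff

attribute [local instance 100] LieRing.ofAssociativeRing

/-! ### The Lie algebra `so(2,n)` -/

section LieAlgebra

variable {n : ℕ}

/-! Everything rests on one fact: a bounded operator commuting with `so(1,n)` is a scalar, so `U`
stays irreducible on the Lorentz covering group. Each Z_ρ is such an operator. Since M_{αα} = 0, the
commutation hypothesis with α = β makes Z_ρ everywhere defined; being closed, it is bounded, and it
commutes with the Lorentz generators. Hence Z_ρ is a nonzero scalar
(`IsContractionFamily.exists_smul`) and U_ρ(X) = U(S_ρ X). On smooth vectors this is independent of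
ρ for Lorentz X and is √ρ U(X) → 0 for X = M_{-1}(a). The only possible limit is therefore U on the
Lorentz part and the trivial representation on translations; density of the smooth vectors gives
uniqueness.

Irreducibility on the Lorentz group (`exists_smul_of_lorentzAlg_le_commutant`) is proved as follows.
Put T_{ac} = ∑_b η_{bb} U(M_{ab}) U(M_{bc}) and N = U(M_{-1,0}). Contracting T twice with the null
vector fixed by the Poincaré algebra gives a symmetric operator commuting with that algebra, hence a
scalar by Schur's lemma for unbounded symmetric operators (`schur_symmetric`). The generator
M_{-1,n} multiplies it by 2, so it vanishes. Brackets with N then yield T_{-1,-1} = T_{00} = c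
(`quadTensor_relations`, `exists_quadTensor_eq_smul_one`), and the second equality reads N² = ∑_i
U(M_{0,i})² - c. So whatever commutes with `so(1,n)` commutes with N².

To pass from N² to N, the weights of N/i must have one sign. The element exp(2πM_{-1,0}) acts by a
scalar, so the weights lie in l + ℤ. The quadratic relations compute ∑_i ‖L_i v‖² for the ladder
operators L_i on a weight vector v. With the highest weight vector this gives l ≤ 0 and shows that
raising kills the whole weight space of l. The projection onto the weights ≤ l then commutes with
`so(2,n)`, so no weight exceeds l (`WeightData.eq_zero_of_pos`). Distinct nonpositive weights have
distinct squares, so an operator commuting with N² commutes with N, and `so(1,n)` together with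
M_{-1,0} generates `so(2,n)`.

Unbounded operators are handled on `smoothCore`, the vectors to which the Lie algebra can be applied
repeatedly. It and `smoothVectors` are both dense because both contain the Gårding vectors. The two
spaces are never compared; the highest weight vector, known only to be in the second, is paired with
vectors of the first. -/

theorem metric_mul_self (a : Fin (n + 2)) : metric n a * metric n a = 1 := by
  simp only [metric]; split_ifs <;> norm_num

theorem metric_zero : metric n 0 = 1 := by simp [metric]

theorem metric_one : metric n 1 = 1 := by simp [metric]

theorem metric_of_two_le {a : Fin (n + 2)} (h : 2 ≤ (a : ℕ)) : metric n a = -1 := by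
  simp [metric, not_lt.2 h]

theorem eta_apply (a b : Fin (n + 2)) : eta n a b = if a = b then metric n a else 0 := by
  simp [eta, Matrix.diagonal_apply]

theorem eta_ne {a b : Fin (n + 2)} (h : a ≠ b) : eta n a b = 0 := by simp [eta_apply, h]

theorem eta_self (a : Fin (n + 2)) : eta n a a = metric n a := by simp [eta_apply]

theorem eta_comm (a b : Fin (n + 2)) : eta n a b = eta n b a := by
  by_cases h : a = b
  · rw [h]
  · rw [eta_ne h, eta_ne (Ne.symm h)]

theorem M_apply (a b c d : Fin (n + 2)) :
    (M a b : so n).1 c d = (if a = c then eta n b d else 0) - (if b = c then eta n a d else 0) := by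
  simp only [M, Matrix.sub_apply, Matrix.single_apply, eta_apply, ite_and]

theorem M_swap (a b : Fin (n + 2)) : (M b a : so n) = -M a b := by
  apply Subtype.ext
  simp [M]

theorem M_self (a : Fin (n + 2)) : (M a a : so n) = 0 := by
  apply Subtype.ext
  simp [M]

theorem so_coe_add (X Y : so n) : (X + Y).1 = X.1 + Y.1 := rfl

theorem so_coe_sub (X Y : so n) : (X - Y).1 = X.1 - Y.1 := rfl

theorem so_coe_smul (r : ℝ) (X : so n) : (r • X).1 = r • X.1 := rfl

theorem so_coe_sum {ι : Type*} (s : Finset ι) (f : ι → so n) :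
    (∑ a ∈ s, f a).1 = ∑ a ∈ s, (f a).1 := map_sum (so n).toSubmodule.subtype f s

theorem coe_bracket (X Y : so n) : (⁅X, Y⁆ : so n).1 = X.1 * Y.1 - Y.1 * X.1 := rfl

theorem M_bracket (a b c d : Fin (n + 2)) :
    ⁅(M a b : so n), M c d⁆ = eta n a d • M b c + eta n b c • M a d - eta n a c • M b d
      - eta n b d • M a c := by
  apply Subtype.ext
  ext i j
  rw [coe_bracket]
  simp only [Matrix.sub_apply, Matrix.mul_apply, M_apply, so_coe_sub,
    so_coe_add, so_coe_smul, Matrix.add_apply, Matrix.smul_apply,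
    smul_eq_mul, mul_sub, sub_mul, Finset.sum_sub_distrib, mul_ite, ite_mul, zero_mul,
    mul_zero, Finset.sum_ite_eq, Finset.mem_univ, if_true]
  have e1 := eta_comm b c
  have e2 := eta_comm a c
  have e3 := eta_comm b d
  have e4 := eta_comm a d
  by_cases h1 : a = i <;> by_cases h2 : b = i <;> by_cases h3 : c = i <;> by_cases h4 : d = i <;>
    simp [h1, h2, h3, h4] <;> simp_all <;> ring

/-- The coordinates of an element of `so(2,n)` with respect to the `M_{ab}`. -/
def coef : so n →ₗ[ℝ] (Fin (n + 2) → Fin (n + 2) → ℝ) where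
  -- `ofCoef` sums over all ordered pairs, so every generator is counted twice, whence the 1/2;
  -- `metric n b` undoes the factor `metric n b` in the `(a, b)` entry of `M a b`.
  toFun X a b := metric n b * X.1 a b / 2
  map_add' X Y := by ext a b; simp [mul_add, add_div]
  map_smul' r X := by ext a b; simp; ring

/-- The element of `so(2,n)` with the given coordinates. -/
def ofCoef : (Fin (n + 2) → Fin (n + 2) → ℝ) →ₗ[ℝ] so n where
  toFun c := ∑ a, ∑ b, c a b • M a b
  map_add' c d := by simp [add_smul, Finset.sum_add_distrib]
  map_smul' r c := by simp [mul_smul, Finset.smul_sum]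

theorem ofCoef_apply (c : Fin (n + 2) → Fin (n + 2) → ℝ) :
    (ofCoef c : so n) = ∑ a, ∑ b, c a b • M a b := rfl

theorem coe_ofCoef (c : Fin (n + 2) → Fin (n + 2) → ℝ) (i j : Fin (n + 2)) :
    (ofCoef c : so n).1 i j = metric n j * (c i j - c j i) := by
  rw [ofCoef_apply]
  simp only [so_coe_sum, Matrix.sum_apply, so_coe_smul, Matrix.smul_apply, M_apply, smul_eq_mul,
    mul_sub, Finset.sum_sub_distrib, mul_ite, mul_zero, eta_apply]
  simp
  ring

theorem ofCoef_coef (X : so n) : ofCoef (coef X) = X := by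
  apply Subtype.ext
  ext i j
  have h := (mem_so_iff_entries _).1 X.2 i j
  rw [coe_ofCoef]
  simp only [coef, LinearMap.coe_mk, AddHom.coe_mk]
  have h1 := metric_mul_self i
  have h2 := metric_mul_self j
  linear_combination (X.1 i j / 2) * h2 - (metric n i / 2) * h + (X.1 i j / 2) * h1

theorem eq_sum_coef (X : so n) : X = ∑ a, ∑ b, coef X a b • M a b := by
  rw [← ofCoef_apply, ofCoef_coef]

end LieAlgebra

/-! ### The contracted brackets -/

section Bracket

variable {n : ℕ}

theorem so_zero_zero (X : so n) : X.1 0 0 = 0 := by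
  have h := (mem_so_iff_entries _).1 X.2 0 0
  rw [metric_zero] at h
  linarith

theorem so_zero_succ (X : so n) (α : Fin (n + 1)) :
    X.1 0 α.succ = transPart X α * metric n α.succ := by
  have h := (mem_so_iff_entries _).1 X.2 0 α.succ
  rw [metric_zero] at h
  simp only [transPart]
  linarith

theorem so_ext {X Y : so n} (hl : linPart X = linPart Y) (ht : transPart X = transPart Y) :
    X = Y := by
  apply Subtype.ext
  ext c d
  refine Fin.cases ?_ (fun α => ?_) c <;> refine Fin.cases ?_ (fun β => ?_) d
  · rw [so_zero_zero, so_zero_zero]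
  · rw [so_zero_succ, so_zero_succ, ht]
  · exact neg_injective (congrFun ht α)
  · exact congrFun (congrFun hl α) β

/-- Each term of this component has exactly one translation factor, hence one √ρ, which S_ρ⁻¹
removes: no dependence on ρ is left. -/
theorem transPart_bracketρ {ρ : ℝ} (hρ : 0 < ρ) (X Y : so n) :
    transPart (bracketρ ρ X Y) = linPart X *ᵥ transPart Y - linPart Y *ᵥ transPart X := by
  have hs : Real.sqrt ρ ≠ 0 := (Real.sqrt_pos.2 hρ).ne'
  ext α
  simp only [transPart, bracketρ, rescale, S, LinearMap.coe_mk, AddHom.coe_mk, coe_bracket,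
    Matrix.of_apply, or_true, if_true, Matrix.sub_apply, Matrix.mul_apply, Pi.sub_apply,
    Fin.sum_univ_succ (n := n + 1), true_or, Fin.succ_ne_zero, or_self, if_false, so_zero_zero,
    Matrix.mulVec, dotProduct, linPart, Matrix.submatrix_apply, mul_zero, zero_add, one_mul,
    mul_neg, Finset.sum_neg_distrib]
  simp only [mul_left_comm _ (Real.sqrt ρ), ← Finset.mul_sum, ← mul_sub]
  rw [mul_inv_cancel_left₀ hs]
  ring

/-- S_ρ⁻¹ does not touch this component, and the product of two translation parts carries (√ρ)² = ρ.
This term is the only trace of ρ in the bracket: it is the curvature, and it disappears in the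
limit. -/
theorem linPart_bracketρ {ρ : ℝ} (hρ : 0 < ρ) (X Y : so n) :
    linPart (bracketρ ρ X Y) = linPart X * linPart Y - linPart Y * linPart X
      - ρ • Matrix.of fun α β => (transPart X α * transPart Y β - transPart Y α * transPart X β) *
        metric n β.succ := by
  ext α β
  have hs : Real.sqrt ρ * Real.sqrt ρ = ρ := Real.mul_self_sqrt hρ.le
  have hX : X.1 α.succ 0 = - transPart X α := by simp [transPart]
  have hY : Y.1 α.succ 0 = - transPart Y α := by simp [transPart]
  simp only [linPart, bracketρ, rescale, S, LinearMap.coe_mk, AddHom.coe_mk, coe_bracket,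
    Matrix.of_apply, or_true, if_true, Matrix.sub_apply, Matrix.mul_apply, Matrix.smul_apply,
    Fin.sum_univ_succ (n := n + 1), true_or, Fin.succ_ne_zero, or_self, if_false, so_zero_succ,
    Matrix.submatrix_apply, one_mul, hX, hY, smul_eq_mul]
  linear_combination (-(transPart X α * (transPart Y β * metric n β.succ)) +
    (transPart Y α * (transPart X β * metric n β.succ))) * hs

theorem linPart_translGen (a : Fin (n + 1) → ℝ) : linPart (translGen a : so n) = 0 := by
  ext α β
  simp [linPart, translGen, Matrix.sum_apply, M_apply, eta_apply,
    (Fin.succ_ne_zero _).symm]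

theorem transPart_translGen (a : Fin (n + 1) → ℝ) : transPart (translGen a : so n) = a := by
  ext α
  simp [transPart, translGen, Matrix.sum_apply, M_apply, eta_apply,
    (Fin.succ_ne_zero _).symm, metric_zero]

/-- Two translations bracket to ρ times a Lorentz matrix, which acts on the third translation by the
formula free of ρ. -/
theorem curvature_bracketρ {ρ : ℝ} (hρ : 0 < ρ) (a b c : Fin (n + 1) → ℝ) :
    -bracketρ ρ (bracketρ ρ (translGen a) (translGen b)) (translGen c) =
      (ρ • translGen (minkowski b c • a - minkowski a c • b) : so n) := by
  have hn : ∀ X : so n, linPart (-X) = -linPart X ∧ transPart (-X) = -transPart X := fun X =>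
    ⟨rfl, rfl⟩
  have hm : ∀ (r : ℝ) (X : so n), linPart (r • X) = r • linPart X ∧
      transPart (r • X) = r • transPart X := fun r X =>
    ⟨rfl, by ext α; simp [transPart]⟩
  apply so_ext
  · rw [(hn _).1, (hm _ _).1, linPart_bracketρ hρ, linPart_translGen, linPart_translGen,
      transPart_bracketρ hρ, linPart_translGen, linPart_translGen]
    ext α β
    simp
  · rw [(hn _).2, (hm _ _).2, transPart_bracketρ hρ, linPart_bracketρ hρ, linPart_translGen,
      linPart_translGen, linPart_translGen, transPart_translGen, transPart_translGen,
      transPart_translGen, transPart_translGen]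
    ext α
    simp only [Pi.neg_apply, Pi.sub_apply, Pi.smul_apply, Matrix.mulVec, dotProduct,
      Matrix.zero_apply, mul_zero, zero_mul, sub_zero, zero_sub, Matrix.neg_apply,
      Matrix.smul_apply, Matrix.of_apply, smul_eq_mul, Finset.sum_const_zero,
      minkowski]
    rw [← Finset.sum_neg_distrib, Finset.sum_mul, Finset.sum_mul, ← Finset.sum_sub_distrib,
      Finset.mul_sum]
    exact Finset.sum_congr rfl fun β _ => by ring

theorem tendsto_linPart_bracketρ (X Y : so n) :
    Tendsto (fun ρ : ℝ => linPart (bracketρ ρ X Y)) (𝓝[>] 0)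
      (𝓝 (linPart X * linPart Y - linPart Y * linPart X)) := by
  set C : Matrix (Fin (n + 1)) (Fin (n + 1)) ℝ := Matrix.of fun α β =>
    (transPart X α * transPart Y β - transPart Y α * transPart X β) * metric n β.succ
  have hc : Continuous fun ρ : ℝ => linPart X * linPart Y - linPart Y * linPart X - ρ • C :=
    continuous_const.sub (continuous_id.smul continuous_const)
  have h := (hc.tendsto 0).mono_left (nhdsWithin_le_nhds (s := Set.Ioi 0))
  rw [zero_smul, sub_zero] at h
  refine h.congr' ?_
  filter_upwards [self_mem_nhdsWithin] with ρ hρ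
  exact (linPart_bracketρ hρ X Y).symm

theorem tendsto_transPart_bracketρ (X Y : so n) :
    Tendsto (fun ρ : ℝ => transPart (bracketρ ρ X Y)) (𝓝[>] 0)
      (𝓝 (linPart X *ᵥ transPart Y - linPart Y *ᵥ transPart X)) := by
  refine tendsto_const_nhds.congr' ?_
  filter_upwards [self_mem_nhdsWithin] with ρ hρ
  exact (transPart_bracketρ hρ X Y).symm

theorem S_of_mem_lorentzAlg (ρ : ℝ) {X : so n} (hX : X ∈ lorentzAlg n) : S ρ X = X := by
  have h0 := lorentzAlg_col hX
  apply so_ext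
  · ext α β
    simp [linPart, S, rescale]
  · ext α
    simp [transPart, S, rescale, h0]

theorem S_translGen (ρ : ℝ) (a : Fin (n + 1) → ℝ) :
    S ρ (translGen a) = (Real.sqrt ρ • translGen a : so n) := by
  have h0 := fun α β => congrFun (congrFun (linPart_translGen (n := n) a) α) β
  simp only [linPart, Matrix.submatrix_apply] at h0
  apply so_ext
  · ext α β
    simp [linPart, S, rescale, h0]
  · ext α
    simp [transPart, S, rescale]

end Bracket

/-! ### Exponentials -/

section Exp

variable {𝔸 : Type*} [NormedRing 𝔸] [NormedAlgebra ℝ 𝔸] [CompleteSpace 𝔸]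

theorem exp_smul_mul_exp_smul_neg (A : 𝔸) (t : ℝ) :
    NormedSpace.exp (t • A) * NormedSpace.exp (t • (-A)) = 1 := by
  let _ : NormedAlgebra ℚ 𝔸 := NormedAlgebra.restrictScalars ℚ ℝ 𝔸
  rw [← NormedSpace.exp_add_of_commute (by
    rw [smul_neg]; exact Commute.neg_right (Commute.refl _))]
  simp

/-- Rodrigues' formula: the right-hand side R satisfies R' = A R and R(0) = 1, so exp(-tA) R(t) is
constant. -/
theorem exp_smul_of_cube_eq_neg {A : 𝔸} (hA : A * (A * A) = -A) (t : ℝ) :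
    NormedSpace.exp (t • A) = 1 + Real.sin t • A + (1 - Real.cos t) • (A * A) := by
  set R : ℝ → 𝔸 := fun s =>
    1 + Real.sin s • A + (1 - Real.cos s) • (A * A) with hR
  have hRd : ∀ s, HasDerivAt R (A * R s) s := by
    intro s
    have h := (((Real.hasDerivAt_sin s).smul_const A).const_add 1).add
      (((Real.hasDerivAt_cos s).const_sub 1).smul_const (A * A))
    refine HasDerivAt.congr_deriv h ?_
    simp only [hR, mul_add, mul_one, mul_smul_comm, hA]
    module
  have hd : ∀ s, HasDerivAt (fun s : ℝ => NormedSpace.exp (s • (-A)) * R s) 0 s := by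
    intro s
    have h := (hasDerivAt_exp_smul_const (𝕂 := ℝ) (-A) s).mul (hRd s)
    refine HasDerivAt.congr_deriv h ?_
    simp [mul_assoc]
  have hconst := is_const_of_deriv_eq_zero (fun s => (hd s).differentiableAt)
    (fun s => (hd s).deriv) t 0
  have h1 : NormedSpace.exp (t • (-A)) * R t = 1 := by
    rw [hconst]; simp [hR]
  calc NormedSpace.exp (t • A) = NormedSpace.exp (t • A) * (NormedSpace.exp (t • (-A)) * R t) := by
        rw [h1, mul_one]
    _ = R t := by rw [← mul_assoc, exp_smul_mul_exp_smul_neg, one_mul]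

theorem hasDerivAt_exp_conj (A B : 𝔸) :
    HasDerivAt (fun t : ℝ => NormedSpace.exp (t • A) * B * NormedSpace.exp (t • (-A)))
      (A * B - B * A) 0 := by
  have h := ((hasDerivAt_exp_smul_const (𝕂 := ℝ) A 0).mul_const B).mul
    (hasDerivAt_exp_smul_const (𝕂 := ℝ) (-A) 0)
  refine HasDerivAt.congr_deriv h ?_
  simp [sub_eq_add_neg]

end Exp

section Rotation

open scoped Matrix.Norms.Operator

/-- `M 0 1` rotates the plane of the two positive directions, so its cube is its negative and
Rodrigues' formula shows the period. -/
theorem expSO_two_pi {n : ℕ} : expSO (M 0 1 : so n) (2 * Real.pi) = 1 := by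
  have h01 : (0 : Fin (n + 2)) ≠ 1 := by simp
  apply Subtype.ext
  apply Subtype.ext
  apply Units.ext
  change NormedSpace.exp ((2 * Real.pi) • (M 0 1 : so n).1) = 1
  have hM : (M 0 1 : so n).1 = Matrix.single 0 1 1 - Matrix.single 1 0 1 := by
    simp [M, metric_zero, metric_one]
  refine (exp_smul_of_cube_eq_neg ?_ (2 * Real.pi)).trans ?_
  · rw [hM]
    simp [mul_sub, sub_mul, Matrix.single_mul_single_of_ne, h01, h01.symm]
    abel
  · simp

end Rotation

/-! ### One-parameter subgroups of the covering group -/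

set_option linter.unusedSectionVars false

section OneParam

variable {n : ℕ} {G : Type*} [Group G] [TopologicalSpace G] {p : G →* SO0 n}

theorem mat_mul (g h : SO0 n) : mat (g * h) = mat g * mat h := rfl

theorem mat_one : mat (1 : SO0 n) = 1 := rfl

theorem mat_injective : Function.Injective (mat (n := n)) := fun _ _ h =>
  Subtype.ext (Subtype.ext (Units.ext h))

theorem mat_mul_mat_inv (g : SO0 n) : mat g * mat g⁻¹ = 1 := by
  rw [← mat_mul, mul_inv_cancel, mat_one]

theorem mat_expSO (X : so n) (t : ℝ) : mat (expSO X t) = NormedSpace.exp (t • X.1) := rfl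

theorem continuous_mat : Continuous (mat (n := n)) :=
  Units.continuous_val.comp (continuous_subtype_val.comp continuous_subtype_val)

theorem mat_mem (g : SO0 n) : (mat g)ᵀ * eta n * mat g = eta n := g.1.2

theorem expSO_add (X : so n) (s t : ℝ) : expSO X (s + t) = expSO X s * expSO X t := by
  apply mat_injective
  rw [mat_mul, mat_expSO, mat_expSO, mat_expSO, add_smul]
  exact Matrix.exp_add_of_commute _ _ (((Commute.refl X.1).smul_left s).smul_right t)

theorem p_oneParam (hp : IsCoveringMap p) (X : so n) (t : ℝ) :
    p (oneParam hp X t) = expSO X t := (exists_oneParam hp X).choose_spec.2 t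

theorem oneParam_zero (hp : IsCoveringMap p) (X : so n) : oneParam hp X 0 = 1 :=
  (exists_oneParam hp X).choose_spec.1

theorem mat_oneParam (hp : IsCoveringMap p) (X : so n) (t : ℝ) :
    mat (p (oneParam hp X t)) = NormedSpace.exp (t • X.1) := by
  rw [p_oneParam, mat_expSO]

/-- Lifts from the connected line are unique. Through this, identities between one-parameter
subgroups of the covering group reduce to identities between matrix exponentials. -/
theorem eq_oneParam (hp : IsCoveringMap p) {X : so n} {γ : ℝ → G} (hγ : Continuous γ)
    (h0 : γ 0 = 1) (h : ∀ t, p (γ t) = expSO X t) (t : ℝ) : γ t = oneParam hp X t := by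
  refine congrFun (hp.eq_of_comp_eq hγ (oneParam hp X).continuous ?_ 0 ?_) t
  · funext s
    rw [Function.comp_apply, Function.comp_apply, h, p_oneParam]
  · rw [h0, oneParam_zero]

theorem oneParam_smul (hp : IsCoveringMap p) (r : ℝ) (X : so n) (t : ℝ) :
    oneParam hp (r • X) t = oneParam hp X (r * t) := by
  refine (eq_oneParam hp (γ := fun t => oneParam hp X (r * t)) (by fun_prop) ?_ ?_ t).symm
  · rw [mul_zero, oneParam_zero]
  · intro s
    rw [p_oneParam]
    apply mat_injective
    rw [mat_expSO, mat_expSO, so_coe_smul, smul_smul, mul_comm]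

theorem oneParam_zero_left (hp : IsCoveringMap p) (t : ℝ) : oneParam hp (0 : so n) t = 1 := by
  rw [← zero_smul ℝ (0 : so n), oneParam_smul, zero_mul, oneParam_zero]

/-- The adjoint action of the covering group on its Lie algebra. -/
def Ad (p : G →* SO0 n) (g : G) : so n →ₗ[ℝ] so n where
  toFun X := ⟨mat (p g) * X.1 * mat (p g⁻¹), by
    have hX := (mem_so_iff _).1 X.2
    have hA := mat_mem (p g)
    have h1 : mat (p g) * mat (p g⁻¹) = 1 := by rw [map_inv]; exact mat_mul_mat_inv _
    set A := mat (p g)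
    set B := mat (p g⁻¹)
    have h2 : Bᵀ * Aᵀ = 1 := by rw [← Matrix.transpose_mul, h1, Matrix.transpose_one]
    have hAB : Aᵀ * eta n = eta n * B := by
      calc Aᵀ * eta n = Aᵀ * eta n * (A * B) := by rw [h1, mul_one]
        _ = Aᵀ * eta n * A * B := by simp only [mul_assoc]
        _ = eta n * B := by rw [hA]
    have hBA : Bᵀ * eta n = eta n * A := by
      calc Bᵀ * eta n = Bᵀ * (Aᵀ * eta n * A) := by rw [hA]
        _ = Bᵀ * Aᵀ * eta n * A := by simp only [mul_assoc]
        _ = eta n * A := by rw [h2, one_mul]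
    rw [mem_so_iff]
    calc (A * X.1 * B)ᵀ * eta n = Bᵀ * (X.1ᵀ * (Aᵀ * eta n)) := by
          simp only [Matrix.transpose_mul, mul_assoc]
      _ = Bᵀ * (X.1ᵀ * eta n) * B := by rw [hAB]; simp only [mul_assoc]
      _ = Bᵀ * eta n * (-X.1) * B := by rw [hX]; simp only [mul_assoc]
      _ = eta n * (-(A * X.1 * B)) := by rw [hBA]; simp [mul_assoc]⟩
  map_add' X Y := by
    apply Subtype.ext
    simp [mul_add, add_mul]
  map_smul' r X := by
    apply Subtype.ext
    simp

theorem coe_Ad (g : G) (X : so n) : (Ad p g X).1 = mat (p g) * X.1 * mat (p g⁻¹) := rfl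

theorem continuous_coef_Ad [IsTopologicalGroup G] (hp : IsCoveringMap p) (X : so n)
    (a b : Fin (n + 2)) : Continuous fun g : G => coef (Ad p g X) a b := by
  have h1 : Continuous fun g : G => mat (p g) := continuous_mat.comp hp.continuous
  have h2 : Continuous fun g : G => mat (p g⁻¹) := h1.comp continuous_inv
  have h3 : Continuous fun g : G => (mat (p g) * X.1 * mat (p g⁻¹)) a b :=
    ((h1.matrix_mul continuous_const).matrix_mul h2).matrix_elem a b
  exact (h3.const_mul (metric n b)).div_const 2

section Group

variable [IsTopologicalGroup G]

theorem oneParam_add (hp : IsCoveringMap p) (X : so n) (s t : ℝ) :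
    oneParam hp X (s + t) = oneParam hp X s * oneParam hp X t := by
  have h := eq_oneParam hp (X := X) (γ := fun t => (oneParam hp X s)⁻¹ * oneParam hp X (s + t))
    (by fun_prop) (by simp) (fun t => by
      rw [map_mul, map_inv, p_oneParam, p_oneParam, expSO_add, inv_mul_cancel_left]) t
  rw [← h, mul_inv_cancel_left]

theorem oneParam_neg (hp : IsCoveringMap p) (X : so n) (t : ℝ) :
    oneParam hp X (-t) = (oneParam hp X t)⁻¹ := by
  rw [eq_inv_iff_mul_eq_one, ← oneParam_add, neg_add_cancel, oneParam_zero]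

theorem oneParam_Ad (hp : IsCoveringMap p) (g : G) (X : so n) (t : ℝ) :
    oneParam hp (Ad p g X) t = g * oneParam hp X t * g⁻¹ := by
  refine (eq_oneParam hp (γ := fun t => g * oneParam hp X t * g⁻¹) (by fun_prop) ?_ ?_ t).symm
  · simp [oneParam_zero]
  · intro s
    rw [map_mul, map_mul, p_oneParam]
    apply mat_injective
    have h1 : mat (p g) * mat (p g⁻¹) = 1 := by rw [map_inv]; exact mat_mul_mat_inv _
    have hu : IsUnit (mat (p g)) := IsUnit.of_mul_eq_one _ h1
    have hi : (mat (p g))⁻¹ = mat (p g⁻¹) := Matrix.inv_eq_right_inv h1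
    rw [mat_mul, mat_mul, mat_expSO, mat_expSO, coe_Ad, ← hi, ← Matrix.exp_conj _ _ hu]
    congr 1
    simp

theorem hasDerivAt_coef_Ad (hp : IsCoveringMap p) (X Y : so n) (a b : Fin (n + 2)) :
    HasDerivAt (fun t : ℝ => coef (Ad p (oneParam hp X t) Y) a b) (coef ⁅X, Y⁆ a b) 0 := by
  have h : HasDerivAt (fun t : ℝ => (Ad p (oneParam hp X t) Y).1 a b) (⁅X, Y⁆.1 a b) 0 := by
    have hm : HasDerivAt (fun t : ℝ => (Ad p (oneParam hp X t) Y).1) (⁅X, Y⁆.1) 0 := by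
      open scoped Matrix.Norms.Operator in
      have h := hasDerivAt_exp_conj X.1 Y.1
      refine HasDerivAt.congr_of_eventuallyEq h (Eventually.of_forall fun t => ?_)
      simp only [coe_Ad, ← oneParam_neg hp, mat_oneParam, neg_smul, smul_neg]
      rfl
    have h1 := hasDerivAt_pi.1 (hasDerivAt_pi.1 hm a) b
    exact h1
  exact (h.const_mul (metric n b)).div_const 2

/-- The element lies over 1, and its conjugates along `oneParam hp X` form a path in the discrete
fibre over 1, which is constant. Upstairs the element need not be 1, which is why weights are only
congruent modulo ℤ and need not be integers. -/
theorem commute_oneParam_two_pi (hp : IsCoveringMap p) (X : so n) (t : ℝ) :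
    Commute (oneParam hp (M 0 1) (2 * Real.pi)) (oneParam hp X t) := by
  set z := oneParam hp (M 0 1) (2 * Real.pi)
  have hz : p z = 1 := by rw [p_oneParam, expSO_two_pi]
  have h := congrFun (hp.eq_of_comp_eq (A := ℝ)
    (g₁ := fun s => oneParam hp X s * z * (oneParam hp X s)⁻¹) (g₂ := fun _ => z)
    (by fun_prop) continuous_const (by funext s; simp [hz]) 0 (by simp [oneParam_zero])) t
  exact (mul_inv_eq_iff_eq_mul.1 h).symm

end Group

theorem continuous_expSO_ofCoef :
    Continuous fun c : Fin (n + 2) → Fin (n + 2) → ℝ => expSO (ofCoef c) 1 := by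
  have hc : Continuous fun c : Fin (n + 2) → Fin (n + 2) → ℝ => (ofCoef c).1 := by
    refine continuous_matrix fun i j => ?_
    simp only [coe_ofCoef]
    fun_prop
  have hc1 : Continuous fun c : Fin (n + 2) → Fin (n + 2) → ℝ => (1 : ℝ) • (ofCoef c).1 := by
    simpa using hc
  refine Continuous.subtype_mk (Continuous.subtype_mk (Units.continuous_iff.2 ⟨?_, ?_⟩) _) _
  · exact continuous_matrix_exp.comp hc1
  · exact continuous_matrix_exp.comp hc1.neg

/-- Each `oneParam hp X` is a separate choice of lift, so continuity in `X` is not automatic. Here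
the exponential map is lifted at once from the whole coordinate space, and the lift is compared with
`oneParam` along rays. -/
theorem continuous_oneParam_ofCoef (hp : IsCoveringMap p) :
    Continuous fun c : Fin (n + 2) → Fin (n + 2) → ℝ => oneParam hp (ofCoef c) 1 := by
  obtain ⟨Γ, ⟨h0, h1⟩, -⟩ := hp.existsUnique_continuousMap_lifts
    ⟨_, continuous_expSO_ofCoef (n := n)⟩ (a₀ := 0) (e₀ := (1 : G)) (by
      rw [map_one]
      refine mat_injective ?_
      change mat 1 = mat (expSO (ofCoef 0) 1)
      rw [mat_expSO, mat_one]
      simp)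
  convert Γ.continuous using 1
  funext c
  refine ((eq_oneParam hp (γ := fun t : ℝ => Γ (t • c)) (by fun_prop) ?_ ?_ 1).symm).trans ?_
  · simpa using h0
  · intro t
    have h := congrFun h1 (t • c)
    refine h.trans (mat_injective ?_)
    simp [mat_expSO]
  · simp

end OneParam

/-! ### The Lie algebra action on vectors of class `C^∞` -/

section Core

open MeasureTheory

set_option linter.unusedSectionVars false

variable {n : ℕ} {G : Type*} [Group G] [TopologicalSpace G] {p : G →* SO0 n}
  {H : Type*} [NormedAddCommGroup H] [InnerProductSpace ℂ H] [CompleteSpace H]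

theorem UnitaryRep.op_mul (U : UnitaryRep G H) (g h : G) (v : H) :
    U.op (g * h) v = U.op g (U.op h v) := by
  simp [UnitaryRep.op]

theorem UnitaryRep.op_one (U : UnitaryRep G H) (v : H) : U.op 1 v = v := by
  simp [UnitaryRep.op]

theorem UnitaryRep.op_inv_op (U : UnitaryRep G H) (g : G) (v : H) : U.op g⁻¹ (U.op g v) = v := by
  rw [← U.op_mul, inv_mul_cancel, U.op_one]

theorem UnitaryRep.op_op_inv (U : UnitaryRep G H) (g : G) (v : H) : U.op g (U.op g⁻¹ v) = v := by
  rw [← U.op_mul, mul_inv_cancel, U.op_one]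

theorem UnitaryRep.norm_op (U : UnitaryRep G H) (g : G) (v : H) : ‖U.op g v‖ = ‖v‖ :=
  ContinuousLinearMap.norm_map_of_mem_unitary (U.toHom g).2 v

theorem UnitaryRep.inner_op_op (U : UnitaryRep G H) (g : G) (v w : H) :
    inner ℂ (U.op g v) (U.op g w) = inner ℂ v w :=
  ContinuousLinearMap.inner_map_map_of_mem_unitary (U.toHom g).2 v w

theorem UnitaryRep.inner_op_left (U : UnitaryRep G H) (g : G) (v w : H) :
    inner ℂ (U.op g v) w = inner ℂ v (U.op g⁻¹ w) := by
  conv_lhs => rw [← U.op_op_inv g w]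
  exact U.inner_op_op g v _

theorem UnitaryRep.continuous_op (U : UnitaryRep G H) (v : H) : Continuous fun g => U.op g v :=
  U.continuous_orbit v

theorem UnitaryRep.continuous_op_oneParam (hp : IsCoveringMap p) (U : UnitaryRep G H) (X : so n)
    (v : H) : Continuous fun t : ℝ => U.op (oneParam hp X t) v :=
  (U.continuous_op v).comp (oneParam hp X).continuous

variable [IsTopologicalGroup G]

theorem hasDerivAt_op_oneParam (hp : IsCoveringMap p) (U : UnitaryRep G H) {X : so n} {v w : H}
    (h : HasDerivAt (fun t : ℝ => U.op (oneParam hp X t) v) w 0) (t : ℝ) :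
    HasDerivAt (fun t : ℝ => U.op (oneParam hp X t) v) (U.op (oneParam hp X t) w) t := by
  have h1 : HasDerivAt (fun s : ℝ => U.op (oneParam hp X s) v) w (t - t) := by rwa [sub_self]
  have h2 := ((U.op (oneParam hp X t)).restrictScalars ℝ).hasFDerivAt.comp_hasDerivAt t
    (h1.comp_sub_const t t)
  refine h2.congr_of_eventuallyEq (Eventually.of_forall fun s => ?_)
  simp only [Function.comp_apply, ContinuousLinearMap.coe_restrictScalars', ← U.op_mul,
    ← oneParam_add, add_sub_cancel]

/-- The inner product of the two orbits is constant. Only differentiability at 0 is required, so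
this also applies to vectors not known to lie in `smoothCore`, such as the highest weight vector or
the values of Z_ρ. -/
theorem inner_deriv_add (hp : IsCoveringMap p) (U : UnitaryRep G H) {X : so n} {v v' w w' : H}
    (hv : HasDerivAt (fun t : ℝ => U.op (oneParam hp X t) v) v' 0)
    (hw : HasDerivAt (fun t : ℝ => U.op (oneParam hp X t) w) w' 0) :
    inner ℂ v' w + inner ℂ v w' = 0 := by
  have h := hv.inner ℂ hw
  simp only [U.inner_op_op, oneParam_zero, U.op_one] at h
  rw [add_comm]
  exact h.unique (hasDerivAt_const _ _)

/-- The vectors of class `C^m`, in the sense that the Lie algebra acts `m` times and depends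
linearly on the element of the Lie algebra. -/
def diffVectors (hp : IsCoveringMap p) (U : UnitaryRep G H) : ℕ → Submodule ℂ H
  | 0 => ⊤
  | m + 1 =>
    { carrier := {v | ∃ L : so n →ₗ[ℝ] H, ∀ X,
        HasDerivAt (fun t : ℝ => U.op (oneParam hp X t) v) (L X) 0 ∧ L X ∈ diffVectors hp U m}
      add_mem' := by
        rintro v w ⟨L, hL⟩ ⟨K, hK⟩
        refine ⟨L + K, fun X => ⟨?_, add_mem (hL X).2 (hK X).2⟩⟩
        simpa using (hL X).1.fun_add (hK X).1
      zero_mem' := ⟨0, fun X => ⟨by simpa using hasDerivAt_const _ _, zero_mem _⟩⟩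
      smul_mem' := by
        rintro c v ⟨L, hL⟩
        refine ⟨c • L, fun X => ⟨?_, Submodule.smul_mem _ c (hL X).2⟩⟩
        simpa using (hL X).1.fun_const_smul c }

/-- The vectors of class `C^∞`. -/
def smoothCore (hp : IsCoveringMap p) (U : UnitaryRep G H) : Submodule ℂ H :=
  ⨅ m, diffVectors hp U m

theorem mem_smoothCore (hp : IsCoveringMap p) (U : UnitaryRep G H) (v : H) :
    v ∈ smoothCore hp U ↔ ∀ m, v ∈ diffVectors hp U m := by
  simp [smoothCore]

theorem exists_linear_of_mem_smoothCore (hp : IsCoveringMap p) (U : UnitaryRep G H) {v : H}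
    (hv : v ∈ smoothCore hp U) : ∃ L : so n →ₗ[ℝ] H, ∀ X,
      HasDerivAt (fun t : ℝ => U.op (oneParam hp X t) v) (L X) 0 ∧ L X ∈ smoothCore hp U := by
  rw [mem_smoothCore] at hv
  obtain ⟨L, hL⟩ := hv 1
  refine ⟨L, fun X => ⟨(hL X).1, (mem_smoothCore _ _ _).2 fun m => ?_⟩⟩
  obtain ⟨K, hK⟩ := hv (m + 1)
  rw [(hL X).1.unique (hK X).1]
  exact (hK X).2

/-- The action of `X ∈ so(2,n)` on the space of vectors of class `C^∞`. -/
def lieAct (hp : IsCoveringMap p) (U : UnitaryRep G H) (X : so n) :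
    Module.End ℂ (smoothCore hp U) where
  toFun v := ⟨deriv (fun t : ℝ => U.op (oneParam hp X t) (v : H)) 0, by
    obtain ⟨L, hL⟩ := exists_linear_of_mem_smoothCore hp U v.2
    rw [(hL X).1.deriv]
    exact (hL X).2⟩
  map_add' v w := by
    obtain ⟨L, hL⟩ := exists_linear_of_mem_smoothCore hp U v.2
    obtain ⟨K, hK⟩ := exists_linear_of_mem_smoothCore hp U w.2
    apply Subtype.ext
    simp only [Submodule.coe_add, map_add]
    exact deriv_fun_add (hL X).1.differentiableAt (hK X).1.differentiableAt
  map_smul' c v := by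
    obtain ⟨L, hL⟩ := exists_linear_of_mem_smoothCore hp U v.2
    apply Subtype.ext
    simp only [Submodule.coe_smul, map_smul, RingHom.id_apply]
    exact deriv_fun_const_smul c (hL X).1.differentiableAt

theorem hasDerivAt_lieAct (hp : IsCoveringMap p) (U : UnitaryRep G H) (X : so n)
    (v : smoothCore hp U) :
    HasDerivAt (fun t : ℝ => U.op (oneParam hp X t) (v : H)) (lieAct hp U X v : H) 0 := by
  obtain ⟨L, hL⟩ := exists_linear_of_mem_smoothCore hp U v.2
  exact (hL X).1.differentiableAt.hasDerivAt

theorem lieAct_eq_of_hasDerivAt (hp : IsCoveringMap p) (U : UnitaryRep G H) {X : so n}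
    {v : smoothCore hp U} {w : H}
    (h : HasDerivAt (fun t : ℝ => U.op (oneParam hp X t) (v : H)) w 0) :
    (lieAct hp U X v : H) = w := (hasDerivAt_lieAct hp U X v).unique h

theorem lieAct_add (hp : IsCoveringMap p) (U : UnitaryRep G H) (X Y : so n) :
    lieAct hp U (X + Y) = lieAct hp U X + lieAct hp U Y := by
  ext v
  obtain ⟨L, hL⟩ := exists_linear_of_mem_smoothCore hp U v.2
  simp only [LinearMap.add_apply, Submodule.coe_add]
  rw [lieAct_eq_of_hasDerivAt hp U (hL _).1, lieAct_eq_of_hasDerivAt hp U (hL _).1,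
    lieAct_eq_of_hasDerivAt hp U (hL _).1, map_add]

theorem lieAct_smul (hp : IsCoveringMap p) (U : UnitaryRep G H) (r : ℝ) (X : so n) :
    lieAct hp U (r • X) = (r : ℂ) • lieAct hp U X := by
  ext v
  obtain ⟨L, hL⟩ := exists_linear_of_mem_smoothCore hp U v.2
  simp only [LinearMap.smul_apply, Submodule.coe_smul]
  rw [lieAct_eq_of_hasDerivAt hp U (hL _).1, lieAct_eq_of_hasDerivAt hp U (hL _).1, map_smul,
    Complex.coe_smul]

theorem inner_lieAct_left (hp : IsCoveringMap p) (U : UnitaryRep G H) (X : so n)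
    (v w : smoothCore hp U) :
    inner ℂ (lieAct hp U X v : H) (w : H) = -inner ℂ (v : H) (lieAct hp U X w : H) :=
  eq_neg_of_add_eq_zero_left
    (inner_deriv_add hp U (hasDerivAt_lieAct hp U X v) (hasDerivAt_lieAct hp U X w))

theorem hasDerivAt_op_op (hp : IsCoveringMap p) (U : UnitaryRep G H) (g : G) {X : so n} {v w : H}
    (h : HasDerivAt (fun t : ℝ => U.op (oneParam hp (Ad p g⁻¹ X) t) v) w 0) :
    HasDerivAt (fun t : ℝ => U.op (oneParam hp X t) (U.op g v)) (U.op g w) 0 := by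
  have h2 := ((U.op g).restrictScalars ℝ).hasFDerivAt.comp_hasDerivAt (0 : ℝ) h
  refine h2.congr_of_eventuallyEq (Eventually.of_forall fun s => ?_)
  simp only [Function.comp_apply, ContinuousLinearMap.coe_restrictScalars', ← U.op_mul,
    oneParam_Ad]
  congr 1
  group

theorem op_mem_diffVectors (hp : IsCoveringMap p) (U : UnitaryRep G H) (g : G) (m : ℕ) {v : H}
    (hv : v ∈ diffVectors hp U m) : U.op g v ∈ diffVectors hp U m := by
  induction m generalizing v with
  | zero => exact Submodule.mem_top
  | succ m ih =>
    obtain ⟨L, hL⟩ := hv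
    refine ⟨((U.op g).restrictScalars ℝ).toLinearMap ∘ₗ L ∘ₗ Ad p g⁻¹, fun X => ⟨?_, ih (hL _).2⟩⟩
    exact hasDerivAt_op_op hp U g (hL _).1

theorem op_mem_smoothCore (hp : IsCoveringMap p) (U : UnitaryRep G H) (g : G) {v : H}
    (hv : v ∈ smoothCore hp U) : U.op g v ∈ smoothCore hp U := by
  rw [mem_smoothCore] at hv ⊢
  exact fun m => op_mem_diffVectors hp U g m (hv m)

theorem lieAct_op (hp : IsCoveringMap p) (U : UnitaryRep G H) (g : G) (X : so n)
    (v : smoothCore hp U) :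
    (lieAct hp U X ⟨U.op g v, op_mem_smoothCore hp U g v.2⟩ : H) =
      U.op g (lieAct hp U (Ad p g⁻¹ X) v) :=
  lieAct_eq_of_hasDerivAt hp U (hasDerivAt_op_op hp U g (hasDerivAt_lieAct hp U _ v))

theorem linearMap_eq_sum_coef (L : so n →ₗ[ℝ] H) (X : so n) :
    L X = ∑ a, ∑ b, coef X a b • L (M a b) := by
  conv_lhs => rw [eq_sum_coef X]
  simp only [map_sum, map_smul]

theorem lieAct_apply_eq_sum (hp : IsCoveringMap p) (U : UnitaryRep G H) (X : so n)
    (v : smoothCore hp U) :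
    (lieAct hp U X v : H) = ∑ a, ∑ b, coef X a b • (lieAct hp U (M a b) v : H) := by
  obtain ⟨L, hL⟩ := exists_linear_of_mem_smoothCore hp U v.2
  have h : ∀ Y, (lieAct hp U Y v : H) = L Y := fun Y => lieAct_eq_of_hasDerivAt hp U (hL Y).1
  simp only [h]
  exact linearMap_eq_sum_coef L X

/-- Moving `Z` past U(g) replaces it by Ad(g⁻¹) Z, whose expansion in the `M a b` leaves scalar
functions times orbits of fixed vectors. The product rule then applies although `Z` acts by an
unbounded operator. -/
theorem hasDerivAt_lieAct_op_aux (hp : IsCoveringMap p) (U : UnitaryRep G H) (X Z : so n)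
    (v : smoothCore hp U) :
    HasDerivAt (fun t : ℝ => (lieAct hp U Z
      ⟨U.op (oneParam hp X t) v, op_mem_smoothCore hp U _ v.2⟩ : H))
      ((lieAct hp U X (lieAct hp U Z v) : H) - lieAct hp U ⁅X, Z⁆ v) 0 := by
  have hinv : ∀ t, (oneParam hp X t)⁻¹ = oneParam hp (-X) t := fun t => by
    rw [← oneParam_neg, ← neg_one_smul ℝ X, oneParam_smul, neg_one_mul]
  have h1 : ∀ a b, HasDerivAt (fun t : ℝ => coef (Ad p (oneParam hp (-X) t) Z) a b •
      U.op (oneParam hp X t) (lieAct hp U (M a b) v : H))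
      (coef Z a b • (lieAct hp U X (lieAct hp U (M a b) v) : H)
        + coef ⁅-X, Z⁆ a b • (lieAct hp U (M a b) v : H)) 0 := by
    intro a b
    have h := (hasDerivAt_coef_Ad hp (-X) Z a b).smul
      (hasDerivAt_lieAct hp U X (lieAct hp U (M a b) v))
    refine HasDerivAt.congr_deriv h ?_
    have h0 : Ad p (1 : G) Z = Z := by
      apply Subtype.ext; simp [coe_Ad, mat_one]
    rw [oneParam_zero, oneParam_zero, U.op_one, h0]
  have h2 := HasDerivAt.fun_sum (u := Finset.univ) fun a _ =>
    HasDerivAt.fun_sum (u := Finset.univ) fun b _ => h1 a b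
  refine (h2.congr_of_eventuallyEq (Eventually.of_forall fun t => ?_)).congr_deriv ?_
  · simp only
    rw [lieAct_op, hinv, lieAct_apply_eq_sum]
    simp only [map_sum]
    refine Finset.sum_congr rfl fun a _ => Finset.sum_congr rfl fun b _ => ?_
    exact ((U.op _).restrictScalars ℝ).map_smul _ _
  · simp only [Finset.sum_add_distrib]
    rw [← lieAct_apply_eq_sum, sub_eq_add_neg]
    congr 1
    · have h := congrArg (fun w : smoothCore hp U => (lieAct hp U X w : H))
        (show (lieAct hp U Z v) = ∑ a, ∑ b, ((coef Z a b : ℝ) : ℂ) • (lieAct hp U (M a b) v) by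
          apply Subtype.ext
          rw [lieAct_apply_eq_sum]
          simp)
      simp only [map_sum, map_smul, Submodule.coe_sum, Submodule.coe_smul] at h
      simp only [Complex.coe_smul] at h
      exact h.symm
    · rw [neg_lie, ← neg_one_smul ℝ ⁅X, Z⁆, lieAct_smul]
      simp

/-- The derivative of Z U(exp tX) v at 0 is computed twice: strongly, by the preceding lemma, and
weakly, by moving `Z` to the other side of the inner product. Density of the core makes the two
answers equal. -/
theorem lieAct_lie (hp : IsCoveringMap p) (U : UnitaryRep G H)
    (hD : Dense (smoothCore hp U : Set H)) (X Z : so n) :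
    lieAct hp U ⁅X, Z⁆ = lieAct hp U X * lieAct hp U Z - lieAct hp U Z * lieAct hp U X := by
  ext v
  have hk : (lieAct hp U Z (lieAct hp U X v) : H) =
      (lieAct hp U X (lieAct hp U Z v) : H) - lieAct hp U ⁅X, Z⁆ v := by
    refine hD.eq_of_inner_right (𝕜 := ℂ) fun w hw => ?_
    have h1 := (hasDerivAt_const (0 : ℝ) w).inner ℂ (hasDerivAt_lieAct_op_aux hp U X Z v)
    have h2 := ((hasDerivAt_const (0 : ℝ) (lieAct hp U Z ⟨w, hw⟩ : H)).inner ℂ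
      (hasDerivAt_lieAct hp U X v)).fun_neg
    have h3 := h1.unique (h2.congr_of_eventuallyEq (Eventually.of_forall fun t => by
      simp only
      rw [inner_lieAct_left hp U Z ⟨w, hw⟩ ⟨_, op_mem_smoothCore hp U _ v.2⟩, neg_neg]))
    simp only [inner_zero_left, add_zero] at h3
    rw [h3, inner_lieAct_left hp U Z ⟨w, hw⟩, neg_neg]
  simp only [LinearMap.sub_apply, Module.End.mul_apply, Submodule.coe_sub]
  rw [hk]
  abel

theorem hasDerivAt_lieAct_op (hp : IsCoveringMap p) (U : UnitaryRep G H)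
    (hD : Dense (smoothCore hp U : Set H)) (X Z : so n) (v : smoothCore hp U) :
    HasDerivAt (fun t : ℝ => (lieAct hp U Z
      ⟨U.op (oneParam hp X t) v, op_mem_smoothCore hp U _ v.2⟩ : H))
      (lieAct hp U Z (lieAct hp U X v) : H) 0 := by
  refine (hasDerivAt_lieAct_op_aux hp U X Z v).congr_deriv ?_
  rw [lieAct_lie hp U hD]
  simp

end Core

/-! ### Averages over a one-parameter subgroup -/

section Average

open MeasureTheory

set_option linter.unusedSectionVars false

variable {n : ℕ} {G : Type*} [Group G] [TopologicalSpace G] [IsTopologicalGroup G] {p : G →* SO0 n}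
  {H : Type*} [NormedAddCommGroup H] [InnerProductSpace ℂ H] [CompleteSpace H]

/-- The average of `t ↦ U(exp(tY)) v` over `[-π, π]` with weight `c`. -/
def orbitAverage (hp : IsCoveringMap p) (U : UnitaryRep G H) (Y : so n) (c : ℝ → ℂ) (v : H) : H :=
  ∫ t in (-Real.pi)..Real.pi, c t • U.op (oneParam hp Y t) v

theorem smul_op_linear_eq_sum (hp : IsCoveringMap p) (U : UnitaryRep G H) (Y X : so n) (c : ℝ → ℂ)
    (L : so n →ₗ[ℝ] H) (t : ℝ) :
    c t • U.op (oneParam hp Y t) (L (Ad p (oneParam hp Y t)⁻¹ X)) =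
      ∑ a, ∑ b, (c t * (coef (Ad p (oneParam hp Y t)⁻¹ X) a b : ℂ)) •
        U.op (oneParam hp Y t) (L (M a b)) := by
  rw [linearMap_eq_sum_coef L]
  simp only [map_sum, Finset.smul_sum, mul_smul]
  refine Finset.sum_congr rfl fun a _ => Finset.sum_congr rfl fun b _ => ?_
  rw [← Complex.coe_smul, map_smul]

theorem continuous_coef_Ad_oneParam_inv (hp : IsCoveringMap p) (Y X : so n) (a b : Fin (n + 2)) :
    Continuous fun t : ℝ => coef (Ad p (oneParam hp Y t)⁻¹ X) a b :=
  (continuous_coef_Ad hp X a b).comp (oneParam hp Y).continuous.inv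

theorem continuous_smul_op_linear (hp : IsCoveringMap p) (U : UnitaryRep G H) (Y X : so n)
    {c : ℝ → ℂ} (hc : Continuous c) (L : so n →ₗ[ℝ] H) :
    Continuous fun t : ℝ => c t • U.op (oneParam hp Y t) (L (Ad p (oneParam hp Y t)⁻¹ X)) := by
  simp only [smul_op_linear_eq_sum]
  refine continuous_finsetSum _ fun a _ => continuous_finsetSum _ fun b _ => ?_
  exact (hc.mul (Complex.continuous_ofReal.comp
    (continuous_coef_Ad_oneParam_inv hp Y X a b))).smul (U.continuous_op_oneParam hp Y _)

/-- Differentiation under the integral. Since U is isometric, the norm of the integrand's derivative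
does not depend on s, so its value at s = 0 serves as dominating function. -/
theorem hasDerivAt_orbitAverage (hp : IsCoveringMap p) (U : UnitaryRep G H) (Y X : so n)
    {c : ℝ → ℂ} (hc : Continuous c) {v : H} {L : so n →ₗ[ℝ] H}
    (hL : ∀ X, HasDerivAt (fun t : ℝ => U.op (oneParam hp X t) v) (L X) 0) :
    HasDerivAt (fun s : ℝ => U.op (oneParam hp X s) (orbitAverage hp U Y c v))
      (∫ t in (-Real.pi)..Real.pi,
        c t • U.op (oneParam hp Y t) (L (Ad p (oneParam hp Y t)⁻¹ X))) 0 := by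
  have hcv : Continuous fun t : ℝ => c t • U.op (oneParam hp Y t) v :=
    hc.smul (U.continuous_op_oneParam hp Y v)
  set F : ℝ → ℝ → H := fun s t => U.op (oneParam hp X s) (c t • U.op (oneParam hp Y t) v) with hF
  set F' : ℝ → ℝ → H := fun s t =>
    U.op (oneParam hp X s) (c t • U.op (oneParam hp Y t) (L (Ad p (oneParam hp Y t)⁻¹ X)))
    with hF'
  have hFc : ∀ s, Continuous (F s) := fun s => (U.op (oneParam hp X s)).continuous.comp hcv
  have hL' := continuous_smul_op_linear hp U Y X hc L
  have hF'c : ∀ s, Continuous (F' s) := fun s => (U.op (oneParam hp X s)).continuous.comp hL'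
  have hdiff : ∀ t s, HasDerivAt (fun s => F s t) (F' s t) s := by
    intro t s
    have h1 := hasDerivAt_op_op hp U (oneParam hp Y t) (hL (Ad p (oneParam hp Y t)⁻¹ X))
    have h2 := (hasDerivAt_op_oneParam hp U h1 s).fun_const_smul (c t)
    simpa only [hF, hF', map_smul] using h2
  have h := (intervalIntegral.hasDerivAt_integral_of_dominated_loc_of_deriv_le
    (μ := volume) (a := -Real.pi) (b := Real.pi) (F := F) (F' := F') (x₀ := 0) (s := Set.univ)
    (bound := fun t => ‖c t • U.op (oneParam hp Y t) (L (Ad p (oneParam hp Y t)⁻¹ X))‖)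
    univ_mem (Eventually.of_forall fun s => (hFc s).aestronglyMeasurable)
    ((hFc 0).intervalIntegrable _ _) (hF'c 0).aestronglyMeasurable
    (Eventually.of_forall fun t _ s _ => (U.norm_op _ _).le)
    (hL'.norm.intervalIntegrable _ _)
    (Eventually.of_forall fun t _ s _ => hdiff t s)).2
  refine (h.congr_of_eventuallyEq (Eventually.of_forall fun s => ?_)).congr_deriv ?_
  · exact (ContinuousLinearMap.intervalIntegral_comp_comm _ (hcv.intervalIntegrable _ _)).symm
  · simp only [hF', oneParam_zero, U.op_one]

/-- A Lie algebra element applied to an average gives a sum of averages of the vectors L(`M a b`),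
the coefficients of Ad being absorbed into the weight. Hence the induction must allow arbitrary
continuous weights. -/
theorem orbitAverage_mem_diffVectors (hp : IsCoveringMap p) (U : UnitaryRep G H) (Y : so n)
    (m : ℕ) {c : ℝ → ℂ} (hc : Continuous c) {v : H} (hv : v ∈ diffVectors hp U m) :
    orbitAverage hp U Y c v ∈ diffVectors hp U m := by
  induction m generalizing c v with
  | zero => exact Submodule.mem_top
  | succ m ih =>
    obtain ⟨L, hL⟩ := hv
    have hi : ∀ X, IntervalIntegrable
        (fun t : ℝ => c t • U.op (oneParam hp Y t) (L (Ad p (oneParam hp Y t)⁻¹ X))) volume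
        (-Real.pi) Real.pi := fun X =>
      (continuous_smul_op_linear hp U Y X hc L).intervalIntegrable _ _
    refine ⟨{ toFun := fun X => ∫ t in (-Real.pi)..Real.pi,
                c t • U.op (oneParam hp Y t) (L (Ad p (oneParam hp Y t)⁻¹ X))
              map_add' := fun X X' => ?_
              map_smul' := fun r X => ?_ }, fun X => ⟨?_, ?_⟩⟩
    · rw [← intervalIntegral.integral_add (hi X) (hi X')]
      simp only [map_add, smul_add]
    · rw [RingHom.id_apply, ← intervalIntegral.integral_smul]
      refine intervalIntegral.integral_congr fun t _ => ?_
      simp only [map_smul]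
      rw [smul_comm, ← Complex.coe_smul, map_smul, Complex.coe_smul]
    · exact hasDerivAt_orbitAverage hp U Y X hc fun X => (hL X).1
    · simp only [LinearMap.coe_mk, AddHom.coe_mk, smul_op_linear_eq_sum]
      have hcc : ∀ a b, Continuous fun t : ℝ =>
          c t * (coef (Ad p (oneParam hp Y t)⁻¹ X) a b : ℂ) := fun a b =>
        hc.mul (Complex.continuous_ofReal.comp (continuous_coef_Ad_oneParam_inv hp Y X a b))
      have hcv : ∀ a b, Continuous fun t : ℝ =>
          (c t * (coef (Ad p (oneParam hp Y t)⁻¹ X) a b : ℂ)) •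
            U.op (oneParam hp Y t) (L (M a b)) := fun a b =>
        (hcc a b).smul (U.continuous_op_oneParam hp Y _)
      rw [intervalIntegral.integral_finsetSum fun a _ =>
        (continuous_finsetSum _ fun b _ => hcv a b).intervalIntegrable _ _]
      refine sum_mem fun a _ => ?_
      rw [intervalIntegral.integral_finsetSum fun b _ => (hcv a b).intervalIntegrable _ _]
      exact sum_mem fun b _ => ih (hcc a b) (hL _).2

theorem orbitAverage_mem_smoothCore (hp : IsCoveringMap p) (U : UnitaryRep G H) (Y : so n)
    {c : ℝ → ℂ} (hc : Continuous c) {v : H} (hv : v ∈ smoothCore hp U) :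
    orbitAverage hp U Y c v ∈ smoothCore hp U := by
  rw [mem_smoothCore] at hv ⊢
  exact fun m => orbitAverage_mem_diffVectors hp U Y m hc (hv m)

/-- The normalized weights `e^{-iλt} ((1 + cos t) / 2)^k` concentrating at `t = 0`. -/
def peakWeight (l : ℝ) (k : ℕ) (t : ℝ) : ℂ :=
  ((∫ x in Set.Icc (-Real.pi) Real.pi, ((1 + Real.cos x) / 2) ^ k : ℝ) : ℂ)⁻¹ *
    (Complex.exp (-(Complex.I * l * t)) * (((1 + Real.cos t) / 2) ^ k : ℝ))

theorem continuous_peakWeight (l : ℝ) (k : ℕ) : Continuous (peakWeight l k) := by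
  unfold peakWeight
  fun_prop

/-- On [-π, π] the function (1 + cos t)/2 has its unique maximum at 0, so its normalized powers are
an approximate identity. As they are trigonometric polynomials, the averages they define are finite
sums of weight vectors. -/
theorem tendsto_integral_peakWeight (l : ℝ) {f : ℝ → H} (hf : Continuous f) :
    Tendsto (fun k => ∫ t in (-Real.pi)..Real.pi, peakWeight l k t • f t) atTop (𝓝 (f 0)) := by
  have hpi := Real.pi_pos
  have h := tendsto_setIntegral_pow_smul_of_unique_maximum_of_isCompact_of_continuousOn
    (μ := volume) (s := Set.Icc (-Real.pi) Real.pi) (x₀ := (0 : ℝ))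
    (c := fun t : ℝ => (1 + Real.cos t) / 2)
    (g := fun t : ℝ => Complex.exp (-(Complex.I * l * t)) • f t) isCompact_Icc
    (by fun_prop) ?_ ?_ ?_ ?_
    (Continuous.continuousOn (by fun_prop))
  · simp only [Complex.ofReal_zero, mul_zero, neg_zero, Complex.exp_zero, one_smul] at h
    refine h.congr fun k => ?_
    rw [intervalIntegral.integral_of_le (by linarith), ← integral_Icc_eq_integral_Ioc,
      ← integral_smul]
    refine integral_congr_ae (Eventually.of_forall fun t => ?_)
    simp only [peakWeight]
    rw [← Complex.coe_smul, ← Complex.coe_smul, smul_smul, smul_smul, Complex.ofReal_inv]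
    congr 1
    ring
  · intro y hy hy0
    have : Real.cos y < 1 := by
      refine lt_of_le_of_ne (Real.cos_le_one y) fun hcos => hy0 ?_
      exact (Real.cos_eq_one_iff_of_lt_of_lt (by linarith [hy.1]) (by linarith [hy.2])).1 hcos
    simp only [Real.cos_zero]
    linarith
  · intro x _
    linarith [Real.neg_one_le_cos x]
  · simp
  · rw [interior_Icc, closure_Ioo (by linarith)]
    constructor <;> linarith

theorem tendsto_orbitAverage_peakWeight (hp : IsCoveringMap p) (U : UnitaryRep G H) (Y : so n)
    (l : ℝ) (v : H) :
    Tendsto (fun k => orbitAverage hp U Y (peakWeight l k) v) atTop (𝓝 v) := by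
  have h := tendsto_integral_peakWeight l (U.continuous_op_oneParam hp Y v)
  rwa [oneParam_zero, U.op_one] at h

/-- The averages converge together with their images under every Lie algebra element; commutation
relations can thus be checked on weight vectors and passed to the limit. -/
theorem tendsto_lieAct_orbitAverage_peakWeight (hp : IsCoveringMap p) (U : UnitaryRep G H)
    (Y X : so n) (l : ℝ) (v : smoothCore hp U) :
    Tendsto (fun k => (lieAct hp U X ⟨orbitAverage hp U Y (peakWeight l k) v,
      orbitAverage_mem_smoothCore hp U Y (continuous_peakWeight l k) v.2⟩ : H)) atTop
      (𝓝 (lieAct hp U X v)) := by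
  obtain ⟨L, hL⟩ := exists_linear_of_mem_smoothCore hp U v.2
  have hc := continuous_smul_op_linear hp U Y X (c := fun _ => 1) continuous_const L
  simp only [one_smul] at hc
  have h := tendsto_integral_peakWeight l hc
  have h0 : Ad p (1 : G) X = X := by
    apply Subtype.ext; simp [coe_Ad, mat_one]
  rw [oneParam_zero, inv_one, U.op_one, h0] at h
  rw [lieAct_eq_of_hasDerivAt hp U (hL X).1]
  refine h.congr fun k => ?_
  exact (lieAct_eq_of_hasDerivAt hp U
    (v := ⟨_, orbitAverage_mem_smoothCore hp U Y (continuous_peakWeight l k) v.2⟩)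
    (hasDerivAt_orbitAverage hp U Y X (continuous_peakWeight l k) fun X => (hL X).1)).symm

end Average

/-! ### Smoothness of integrals depending on a parameter -/

set_option linter.unusedSectionVars false

section ParametricIntegral

open MeasureTheory

universe u v w

variable {X : Type w} [TopologicalSpace X] [MeasurableSpace X] [OpensMeasurableSpace X]
  {μ : Measure X} [IsFiniteMeasureOnCompacts μ] {C : Set X}
  {E : Type u} [NormedAddCommGroup E] [NormedSpace ℝ E] [ProperSpace E]
  {E' : Type*} [NormedAddCommGroup E'] [NormedSpace ℝ E']
  {H : Type*} [NormedAddCommGroup H] [NormedSpace ℝ H]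

/-- The partial derivative in the first variable of a family of operators. -/
def partialDeriv {F : Type*} [NormedAddCommGroup F] [NormedSpace ℝ F]
    (Ψ : E × E' → H →L[ℝ] F) (x : E × E') : H →L[ℝ] E →L[ℝ] F :=
  ((fderiv ℝ Ψ x).comp (ContinuousLinearMap.inl ℝ E E')).flip

theorem contDiff_partialDeriv {F : Type*} [NormedAddCommGroup F] [NormedSpace ℝ F]
    {Ψ : E × E' → H →L[ℝ] F} (hΨ : ContDiff ℝ ∞ Ψ) : ContDiff ℝ ∞ (partialDeriv Ψ) := by
  have h1 : ContDiff ℝ ∞ fun x => (fderiv ℝ Ψ x).comp (ContinuousLinearMap.inl ℝ E E') :=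
    (hΨ.fderiv_right (m := ∞) (by simp)).clm_comp contDiff_const
  have h2 : ContDiff ℝ ∞ fun f : E →L[ℝ] H →L[ℝ] F => f.flip := by
    let Λ : (E →L[ℝ] H →L[ℝ] F) →L[ℝ] (H →L[ℝ] E →L[ℝ] F) :=
      (ContinuousLinearMap.flipₗᵢ ℝ E H F).toContinuousLinearEquiv.toContinuousLinearMap
    exact ContinuousLinearMap.contDiff (𝕜 := ℝ) (E := E →L[ℝ] H →L[ℝ] F)
      (F := H →L[ℝ] E →L[ℝ] F) Λ
  exact h2.comp h1

/-- The derivative is an integral of the same shape, with `partialDeriv Ψ` in place of `Ψ`, so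
smoothness follows by iteration. Compactness of `C` provides the uniform bound. -/
theorem hasFDerivAt_setIntegral_apply {F : Type*} [NormedAddCommGroup F] [NormedSpace ℝ F]
    (hC : IsCompact C) (hCm : MeasurableSet C) {m : X → E'} (hm : ContinuousOn m C) {w : X → H}
    (hw : ContinuousOn w C) {Ψ : E × E' → H →L[ℝ] F} (hΨ : ContDiff ℝ ∞ Ψ) (x₀ : E) :
    HasFDerivAt (fun x => ∫ g in C, Ψ (x, m g) (w g) ∂μ)
      (∫ g in C, partialDeriv Ψ (x₀, m g) (w g) ∂μ) x₀ := by
  have hΨ' := contDiff_partialDeriv hΨ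
  have hpair : ∀ x : E, ContinuousOn (fun g => (x, m g)) C := fun x =>
    continuousOn_const.prodMk hm
  have hc1 : ∀ x, ContinuousOn (fun g => Ψ (x, m g) (w g)) C := fun x =>
    (hΨ.continuous.comp_continuousOn (hpair x)).clm_apply hw
  have hc2 : ∀ x, ContinuousOn (fun g => partialDeriv Ψ (x, m g) (w g)) C := fun x =>
    (hΨ'.continuous.comp_continuousOn (hpair x)).clm_apply hw
  have hK : IsCompact (Metric.closedBall x₀ 1 ×ˢ (m '' C)) :=
    (isCompact_closedBall x₀ 1).prod (hC.image_of_continuousOn hm)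
  obtain ⟨B, hB⟩ : ∃ B, ∀ x ∈ Metric.closedBall x₀ 1 ×ˢ (m '' C), ‖partialDeriv Ψ x‖ ≤ B :=
    hK.exists_bound_of_continuousOn (f := partialDeriv Ψ) (by exact hΨ'.continuous.continuousOn)
  obtain ⟨B', hB'⟩ := hC.exists_bound_of_continuousOn hw
  refine hasFDerivAt_integral_of_dominated_of_fderiv_le
    (s := Metric.closedBall x₀ 1) (bound := fun _ => B * B')
    (F' := fun x g => partialDeriv Ψ (x, m g) (w g)) (Metric.closedBall_mem_nhds x₀ one_pos)
    (Eventually.of_forall fun x => (hc1 x).aestronglyMeasurable_of_isCompact hC hCm)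
    ((hc1 x₀).integrableOn_compact' hC hCm)
    ((hc2 x₀).aestronglyMeasurable_of_isCompact hC hCm) ?_ ?_ ?_
  · refine (ae_restrict_mem hCm).mono fun g hg x hx => ?_
    refine (ContinuousLinearMap.le_opNorm _ _).trans ?_
    have h1 := hB (x, m g) ⟨hx, Set.mem_image_of_mem m hg⟩
    have h2 : 0 ≤ B := le_trans (norm_nonneg (partialDeriv Ψ (x, m g))) h1
    exact mul_le_mul h1 (hB' g hg) (norm_nonneg _) h2
  · exact integrableOn_const hC.measure_ne_top
  · refine Eventually.of_forall fun g x _ => ?_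
    have h1 : HasFDerivAt (fun x => Ψ (x, m g))
        ((fderiv ℝ Ψ (x, m g)).comp (ContinuousLinearMap.inl ℝ E E')) x :=
      (hΨ.differentiable (by simp) (x, m g)).hasFDerivAt.comp x (hasFDerivAt_prodMk_left x (m g))
    refine (h1.clm_apply (hasFDerivAt_const (w g) x)).congr_fderiv ?_
    simp [partialDeriv]

theorem contDiff_setIntegral_apply {E : Type} [NormedAddCommGroup E] [NormedSpace ℝ E]
    [ProperSpace E] {F : Type v} [NormedAddCommGroup F] [NormedSpace ℝ F]
    (hC : IsCompact C) (hCm : MeasurableSet C) {m : X → E'} (hm : ContinuousOn m C) {w : X → H}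
    (hw : ContinuousOn w C) {Ψ : E × E' → H →L[ℝ] F} (hΨ : ContDiff ℝ ∞ Ψ) :
    ContDiff ℝ ∞ (fun x => ∫ g in C, Ψ (x, m g) (w g) ∂μ) := by
  -- The induction varies `F`, since differentiation replaces it by `E →L[ℝ] F`; taking `E` in the
  -- lowest universe keeps this space in the universe of `F`.
  have key : ∀ k : ℕ, ∀ (F : Type v) [NormedAddCommGroup F] [NormedSpace ℝ F]
      (Ψ : E × E' → H →L[ℝ] F), ContDiff ℝ ∞ Ψ →
      ContDiff ℝ k (fun x => ∫ g in C, Ψ (x, m g) (w g) ∂μ) := by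
    intro k
    induction k with
    | zero =>
      intro F _ _ Ψ hΨ
      rw [Nat.cast_zero, contDiff_zero]
      exact continuous_iff_continuousAt.2 fun x =>
        (hasFDerivAt_setIntegral_apply hC hCm hm hw hΨ x).continuousAt
    | succ k ih =>
      intro F _ _ Ψ hΨ
      rw [Nat.cast_succ, contDiff_succ_iff_hasFDerivAt]
      exact ⟨_, ih _ _ (contDiff_partialDeriv hΨ), fun x =>
        hasFDerivAt_setIntegral_apply hC hCm hm hw hΨ x⟩
  exact contDiff_infty.2 fun k => key k F Ψ hΨ

end ParametricIntegral

/-! ### Gårding vectors -/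

section Garding

open MeasureTheory

set_option linter.unusedSectionVars false

variable {G : Type*} [Group G] [TopologicalSpace G] [IsTopologicalGroup G]
  [MeasurableSpace G] [BorelSpace G]
  {H : Type*} [NormedAddCommGroup H] [InnerProductSpace ℂ H] [CompleteSpace H]
  {𝔸 : Type} [NormedRing 𝔸] [NormedAlgebra ℝ 𝔸] [FiniteDimensional ℝ 𝔸]

/-- A compact neighbourhood `C` of `1`, on which elements near `1` can be recognized by their image
in `𝔸`. -/
structure IsSheet (m : G →* 𝔸) (C : Set G) (r : ℝ) : Prop where
  compact : IsCompact C
  measurable : MeasurableSet C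
  mem_nhds : C ∈ 𝓝 (1 : G)
  translate : ∀ᶠ h in 𝓝 (1 : G), ∀ g, ‖m (h⁻¹ * g) - 1‖ < r → (h⁻¹ * g ∈ C ↔ g ∈ C)
  small : ∀ O ∈ 𝓝 (1 : G), ∃ δ > 0, ∀ g ∈ C, ‖m g - 1‖ < δ → g ∈ O
  pos : 0 < r

/-- The mean of the vectors `U(g) v` with weight `Φ(m(g))`. -/
def gardingVector (μ : Measure G) (U : UnitaryRep G H) (m : G →* 𝔸) (C : Set G) (Φ : 𝔸 → ℝ)
    (v : H) : H :=
  ∫ g in C, Φ (m g) • U.op g v ∂μ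

/-- The action of `B ∈ 𝔸` on weight functions. -/
def weightDeriv (B : 𝔸) (Φ : 𝔸 → ℝ) (A : 𝔸) : ℝ := fderiv ℝ Φ A (B * A)

theorem contDiff_weightDeriv (B : 𝔸) {Φ : 𝔸 → ℝ} (hΦ : ContDiff ℝ ∞ Φ) :
    ContDiff ℝ ∞ (weightDeriv B Φ) :=
  (hΦ.fderiv_right (m := ∞) (by simp)).clm_apply (contDiff_const.mul contDiff_id)

theorem tsupport_weightDeriv_subset (B : 𝔸) (Φ : 𝔸 → ℝ) :
    tsupport (weightDeriv B Φ) ⊆ tsupport Φ := by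
  refine closure_minimal (fun A hA => ?_) isClosed_closure
  by_contra h
  refine hA ?_
  simp only [weightDeriv]
  rw [fderiv_of_notMem_tsupport _ h]
  simp

variable {μ : Measure G} [μ.IsHaarMeasure] {m : G →* 𝔸} {C : Set G} {r : ℝ}

/-- Left invariance of Haar measure moves the translation into the weight. The domain `C` moves as
well, but for `h` near 1 the `translate` condition makes this invisible wherever the translated
weight is nonzero. -/
theorem op_gardingVector (hC : IsSheet m C r) (U : UnitaryRep G H) :
    ∀ᶠ h in 𝓝 (1 : G), ∀ (Φ : 𝔸 → ℝ), tsupport Φ ⊆ Metric.ball 1 r → ∀ v : H,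
      Integrable (fun g => Φ (m g) • U.op g v) (μ.restrict C) →
      U.op h (gardingVector μ U m C Φ v) = ∫ g in C, Φ (m h⁻¹ * m g) • U.op g v ∂μ := by
  filter_upwards [hC.translate] with h hh Φ hΦ v hi
  have h1 : U.op h (gardingVector μ U m C Φ v) = ∫ g in C, Φ (m g) • U.op (h * g) v ∂μ := by
    rw [gardingVector, ← ContinuousLinearMap.integral_comp_comm _ hi]
    refine integral_congr_ae (Eventually.of_forall fun g => ?_)
    simp only [U.op_mul]
    exact ((U.op h).restrictScalars ℝ).map_smul _ _
  rw [h1, ← integral_indicator hC.measurable, ← integral_indicator hC.measurable,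
    ← integral_mul_left_eq_self _ h⁻¹]
  refine integral_congr_ae (Eventually.of_forall fun g => ?_)
  classical
  simp only [Set.indicator_apply, mul_inv_cancel_left, ← map_mul]
  by_cases h0 : Φ (m (h⁻¹ * g)) = 0
  · simp only [h0, zero_smul, ite_self]
  · have hb : m (h⁻¹ * g) ∈ Metric.ball 1 r := hΦ (subset_tsupport _ h0)
    rw [Metric.mem_ball, dist_eq_norm] at hb
    simp only [hh g hb]

theorem continuous_smul_op {Φ : 𝔸 → ℝ} (hΦ : Continuous Φ) (hm : Continuous m)
    (U : UnitaryRep G H) (v : H) : Continuous fun g => Φ (m g) • U.op g v :=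
  (hΦ.comp hm).smul (U.continuous_op v)

/-- The operator-valued integrand of a translated Gårding vector. -/
def translateKernel (H : Type*) [NormedAddCommGroup H] [InnerProductSpace ℂ H] (Φ : 𝔸 → ℝ)
    (x : 𝔸 × 𝔸) : H →L[ℝ] H := Φ (x.1 * x.2) • ContinuousLinearMap.id ℝ H

theorem contDiff_translateKernel {Φ : 𝔸 → ℝ} (hΦ : ContDiff ℝ ∞ Φ) :
    ContDiff ℝ ∞ (translateKernel H Φ) :=
  (hΦ.comp (contDiff_fst.mul contDiff_snd)).smul contDiff_const

theorem contDiff_translate_gardingVector (hC : IsSheet m C r) (hm : Continuous m)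
    (U : UnitaryRep G H) {Φ : 𝔸 → ℝ} (hΦ : ContDiff ℝ ∞ Φ) (v : H) :
    ContDiff ℝ ∞ (fun A : 𝔸 => ∫ g in C, Φ (A * m g) • U.op g v ∂μ) := by
  have : ProperSpace 𝔸 := FiniteDimensional.proper_real 𝔸
  exact contDiff_setIntegral_apply (μ := μ) hC.compact hC.measurable hm.continuousOn
    (U.continuous_op v).continuousOn (contDiff_translateKernel (H := H) hΦ)

/-- The derivative is again a Gårding vector, of the same `v`; this lets the Lie algebra be applied
indefinitely. -/
theorem hasFDerivAt_translate_gardingVector (hC : IsSheet m C r) (hm : Continuous m)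
    (U : UnitaryRep G H) {Φ : 𝔸 → ℝ} (hΦ : ContDiff ℝ ∞ Φ) (v : H) :
    ∃ L : 𝔸 →L[ℝ] H, HasFDerivAt (fun A : 𝔸 => ∫ g in C, Φ (A * m g) • U.op g v ∂μ) L 1 ∧
      ∀ B, L B = gardingVector μ U m C (weightDeriv B Φ) v := by
  have : ProperSpace 𝔸 := FiniteDimensional.proper_real 𝔸
  have hK := contDiff_translateKernel (H := H) hΦ
  refine ⟨_, hasFDerivAt_setIntegral_apply (μ := μ) hC.compact hC.measurable hm.continuousOn
    (U.continuous_op v).continuousOn hK 1, fun B => ?_⟩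
  have hc : Continuous fun g => partialDeriv (translateKernel H Φ) (1, m g) (U.op g v) :=
    ((contDiff_partialDeriv hK).continuous.comp (continuous_const.prodMk hm)).clm_apply
      (U.continuous_op v)
  rw [ContinuousLinearMap.integral_apply
    (hc.continuousOn.integrableOn_compact' hC.compact hC.measurable)]
  refine integral_congr_ae (Eventually.of_forall fun g => ?_)
  have h1 : HasFDerivAt (fun x : 𝔸 × 𝔸 => x.1 * x.2)
      ((1 : 𝔸) • ContinuousLinearMap.snd ℝ 𝔸 𝔸 +
        (MulOpposite.op (m g)) • ContinuousLinearMap.fst ℝ 𝔸 𝔸) ((1 : 𝔸), m g) := by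
    have h := (hasFDerivAt_fst (𝕜 := ℝ) (p := ((1 : 𝔸), m g))).mul'
      (hasFDerivAt_snd (𝕜 := ℝ) (p := ((1 : 𝔸), m g)))
    exact h
  have h2 : HasFDerivAt Φ (fderiv ℝ Φ (m g)) ((1 : 𝔸) * m g) := by
    rw [one_mul]
    exact (hΦ.differentiable (by simp) _).hasFDerivAt
  have h3 := (HasFDerivAt.comp ((1 : 𝔸), m g) h2 h1).smul_const (ContinuousLinearMap.id ℝ H)
  have h4 : fderiv ℝ (translateKernel H Φ) (1, m g) = _ := h3.fderiv
  simp [partialDeriv, h4, weightDeriv]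

theorem op_gardingVector_of_contDiff (hC : IsSheet m C r) (hm : Continuous m)
    (U : UnitaryRep G H) {Φ : 𝔸 → ℝ} (hΦ : ContDiff ℝ ∞ Φ) (hs : tsupport Φ ⊆ Metric.ball 1 r)
    (v : H) : ∀ᶠ h in 𝓝 (1 : G),
      U.op h (gardingVector μ U m C Φ v) = ∫ g in C, Φ (m h⁻¹ * m g) • U.op g v ∂μ := by
  filter_upwards [op_gardingVector (μ := μ) hC U] with h hh
  exact hh Φ hs v ((continuous_smul_op hΦ.continuous hm U v).continuousOn.integrableOn_compact'
    hC.compact hC.measurable)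

/-- The weight is a normalized bump around the identity matrix; by the `small` condition its support
inside `C` lies where U(g) v is close to v. -/
theorem exists_gardingVector_norm_sub_le (hC : IsSheet m C r) (hm : Continuous m)
    (U : UnitaryRep G H) (v : H) {ε : ℝ} (hε : 0 < ε) :
    ∃ Φ : 𝔸 → ℝ, ContDiff ℝ ∞ Φ ∧ tsupport Φ ⊆ Metric.ball 1 r ∧
      ‖gardingVector μ U m C Φ v - v‖ ≤ ε := by
  have : ProperSpace 𝔸 := FiniteDimensional.proper_real 𝔸
  have hO : {g | ‖U.op g v - v‖ < ε} ∈ 𝓝 (1 : G) := by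
    have hc : Continuous fun g => ‖U.op g v - v‖ := ((U.continuous_op v).sub continuous_const).norm
    exact (isOpen_Iio.preimage hc).mem_nhds (by simp [U.op_one, hε])
  obtain ⟨δ, hδ, hsmall⟩ := hC.small _ hO
  have hd : 0 < min δ r := lt_min hδ hC.pos
  let f : ContDiffBump (1 : 𝔸) := ⟨min δ r / 4, min δ r / 2, by linarith, by linarith⟩
  have hf0 : ∀ A, 0 ≤ f A := fun A => f.nonneg
  have hfz : ∀ A, f A ≠ 0 → ‖A - 1‖ < min δ r / 2 := fun A hA => by
    have : A ∈ Function.support f := hA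
    rw [f.support_eq, Metric.mem_ball, dist_eq_norm] at this
    exact this
  have hcf : Continuous fun g => f (m g) := f.continuous.comp hm
  have hi : IntegrableOn (fun g => f (m g)) C μ :=
    hcf.continuousOn.integrableOn_compact' hC.compact hC.measurable
  set I : ℝ := ∫ g in C, f (m g) ∂μ with hI
  have hIpos : 0 < I := by
    have hopen : IsOpen (interior C ∩ {g | f (m g) ≠ 0}) :=
      isOpen_interior.inter (isOpen_ne_fun hcf continuous_const)
    have hne : (1 : G) ∈ interior C ∩ {g | f (m g) ≠ 0} := by
      refine ⟨mem_interior_iff_mem_nhds.2 hC.mem_nhds, ?_⟩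
      simp only [Set.mem_ofPred_eq, map_one]
      rw [f.one_of_mem_closedBall (Metric.mem_closedBall_self f.rIn_pos.le)]
      exact one_ne_zero
    rw [hI, setIntegral_pos_iff_support_of_nonneg_ae (Eventually.of_forall fun g => hf0 _) hi]
    refine lt_of_lt_of_le (hopen.measure_pos μ ⟨1, hne⟩) (measure_mono ?_)
    exact fun g hg => ⟨hg.2, interior_subset hg.1⟩
  refine ⟨fun A => I⁻¹ * f A, contDiff_const.mul f.contDiff, ?_, ?_⟩
  · refine (tsupport_mul_subset_right).trans ?_
    rw [f.tsupport_eq]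
    refine Metric.closedBall_subset_ball ?_
    change min δ r / 2 < r
    linarith [min_le_right δ r, hC.pos]
  · have hi1 : IntegrableOn (fun g => f (m g) • U.op g v) C μ :=
      (continuous_smul_op f.continuous hm U v).continuousOn.integrableOn_compact'
        hC.compact hC.measurable
    have h1 : gardingVector μ U m C (fun A => I⁻¹ * f A) v - v =
        I⁻¹ • ∫ g in C, f (m g) • (U.op g v - v) ∂μ := by
      simp only [smul_sub]
      rw [integral_sub hi1 (hi.smul_const v), integral_smul_const, smul_sub, ← hI, smul_smul,
        inv_mul_cancel₀ hIpos.ne', one_smul, gardingVector, ← integral_smul]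
      simp only [smul_smul]
    rw [h1, norm_smul, norm_inv, Real.norm_of_nonneg hIpos.le, inv_mul_le_iff₀ hIpos]
    have h2 : ‖∫ g in C, f (m g) • (U.op g v - v) ∂μ‖ ≤ ∫ g in C, f (m g) * ε ∂μ := by
      refine norm_integral_le_of_norm_le (hi.mul_const ε) ?_
      refine (ae_restrict_mem hC.measurable).mono fun g hg => ?_
      rw [norm_smul, Real.norm_of_nonneg (hf0 _)]
      by_cases h0 : f (m g) = 0
      · simp [h0]
      · refine mul_le_mul_of_nonneg_left (le_of_lt ?_) (hf0 _)
        exact hsmall g hg (lt_of_lt_of_le (hfz _ h0) (by linarith [min_le_left δ r]))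
    rwa [integral_mul_const] at h2

end Garding

/-! ### Density of the smooth vectors -/

section Density

open MeasureTheory
open scoped Matrix.Norms.Operator

set_option linter.unusedSectionVars false

variable {n : ℕ} {G : Type*} [Group G] [TopologicalSpace G] [IsTopologicalGroup G] {p : G →* SO0 n}
  {H : Type*} [NormedAddCommGroup H] [InnerProductSpace ℂ H] [CompleteSpace H]

theorem isEmbedding_mat : IsEmbedding (mat (n := n)) :=
  Units.isOpenEmbedding_val.isEmbedding.comp (IsEmbedding.subtypeVal.comp IsEmbedding.subtypeVal)

theorem eta_mul_eta : eta n * eta n = 1 := by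
  rw [eta, Matrix.diagonal_mul_diagonal, ← Matrix.diagonal_one]
  congr 1
  funext a
  exact metric_mul_self a

theorem isClosedEmbedding_indefO :
    IsClosedEmbedding fun g : indefO n => (g : GL (Fin (n + 2)) ℝ).val := by
  refine ⟨Units.isOpenEmbedding_val.isEmbedding.comp IsEmbedding.subtypeVal, ?_⟩
  have h : Set.range (fun g : indefO n => (g : GL (Fin (n + 2)) ℝ).val) =
      {A : Matrix (Fin (n + 2)) (Fin (n + 2)) ℝ | Aᵀ * eta n * A = eta n} := by
    ext A
    constructor
    · rintro ⟨g, rfl⟩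
      exact g.2
    · intro hA
      have h1 : (eta n * Aᵀ * eta n) * A = 1 := by
        have hA' : Aᵀ * eta n * A = eta n := hA
        calc _ = eta n * (Aᵀ * eta n * A) := by simp only [mul_assoc]
          _ = 1 := by rw [hA', eta_mul_eta]
      exact ⟨⟨⟨A, eta n * Aᵀ * eta n, mul_eq_one_comm.1 h1, h1⟩, hA⟩, rfl⟩
  rw [h]
  exact isClosed_eq (by fun_prop) continuous_const

theorem isClosedEmbedding_mat : IsClosedEmbedding (mat (n := n)) :=
  isClosedEmbedding_indefO.comp (isClosed_connectedComponent.isClosedEmbedding_subtypeVal)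

instance : LocallyCompactSpace (SO0 n) := by
  have : LocallyCompactSpace (Matrix (Fin (n + 2)) (Fin (n + 2)) ℝ) :=
    inferInstanceAs (LocallyCompactSpace (Fin (n + 2) → Fin (n + 2) → ℝ))
  exact isClosedEmbedding_mat.locallyCompactSpace

/-- Needed for a Haar measure on the covering group: the local inverse of `p` carries a compact
neighbourhood to 1, and translations carry it everywhere. -/
theorem locallyCompactSpace_of_isCoveringMap (hp : IsCoveringMap p) : LocallyCompactSpace G := by
  obtain ⟨e, he, hpe⟩ := hp.isLocalHomeomorph (1 : G)
  have ht : e.target ∈ 𝓝 (e 1) := e.open_target.mem_nhds (e.map_source he)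
  obtain ⟨K, hK, hKt, hKc⟩ := local_compact_nhds ht
  refine IsCompact.locallyCompactSpace_of_mem_nhds_of_group (K := e.symm '' K)
    (hKc.image_of_continuousOn (e.continuousOn_symm.mono hKt)) (x := 1) ?_
  have h1 : e ⁻¹' K ∩ e.source ∈ 𝓝 (1 : G) :=
    inter_mem ((e.continuousAt he).preimage_mem_nhds hK) (e.open_source.mem_nhds he)
  refine mem_of_superset h1 fun g hg => ⟨e g, hg.1, e.left_inv hg.2⟩

/-- The covering homomorphism, as a homomorphism into the algebra of matrices. -/
def matHom (p : G →* SO0 n) : G →* Matrix (Fin (n + 2)) (Fin (n + 2)) ℝ where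
  toFun g := mat (p g)
  map_one' := by rw [map_one, mat_one]
  map_mul' g h := by rw [map_mul, mat_mul]

theorem continuous_matHom (hp : IsCoveringMap p) : Continuous (matHom p) :=
  continuous_mat.comp hp.continuous

theorem exists_eq_of_norm_matHom_sub_lt (hp : IsCoveringMap p) {O : Set G} (hO : O ∈ 𝓝 (1 : G)) :
    ∃ r > 0, ∀ x : G, ‖matHom p x - 1‖ < r → ∃ k ∈ O, p k = p x := by
  have h1 : p '' O ∈ 𝓝 (1 : SO0 n) := by
    have := hp.isOpenMap.image_mem_nhds hO
    rwa [map_one] at this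
  rw [isEmbedding_mat.nhds_eq_comap, mat_one] at h1
  obtain ⟨T, hT, hTO⟩ := mem_comap.1 h1
  obtain ⟨r, hr, hrT⟩ := Metric.mem_nhds_iff.1 hT
  refine ⟨r, hr, fun x hx => ?_⟩
  have : p x ∈ p '' O := hTO (hrT (by rw [Metric.mem_ball, dist_eq_norm]; exact hx))
  exact this

/-- Take `C` compact with `p` injective on it, and V with V·V ⊆ C. If the matrix of h⁻¹g is near 1,
some k in V has the same image as h⁻¹g. Injectivity identifies k with h⁻¹g when h⁻¹g is in `C`, and
hk with g when g is in `C`; either way both points are in `C`. -/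
theorem exists_isSheet [MeasurableSpace G] [BorelSpace G] (hp : IsCoveringMap p) :
    ∃ C r, IsSheet (matHom p) C r := by
  have := locallyCompactSpace_of_isCoveringMap hp
  obtain ⟨e, he, hpe⟩ := hp.isLocalHomeomorph (1 : G)
  obtain ⟨K, hK, hKc, hKcl⟩ := exists_mem_nhds_isCompact_isClosed (1 : G)
  obtain ⟨F, hF, hFcl, hFs⟩ := exists_mem_nhds_isClosed_subset (e.open_source.mem_nhds he)
  have hinj : Set.InjOn p (F ∩ K) := by
    intro x hx y hy hxy
    rw [hpe] at hxy
    exact e.injOn (hFs hx.1) (hFs hy.1) hxy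
  have hC : F ∩ K ∈ 𝓝 (1 : G) := inter_mem hF hK
  obtain ⟨V, hVo, hV1, hVV⟩ := exists_open_nhds_one_mul_subset hC
  have hVC : V ⊆ F ∩ K := fun x hx => by
    have := hVV (Set.mul_mem_mul hV1 hx)
    rwa [one_mul] at this
  obtain ⟨r, hr, hrV⟩ := exists_eq_of_norm_matHom_sub_lt hp (hVo.mem_nhds hV1)
  refine ⟨F ∩ K, r, hKc.inter_left hFcl, (hFcl.inter hKcl).measurableSet, hC, ?_, ?_, hr⟩
  · filter_upwards [hVo.mem_nhds hV1] with h hh g hg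
    obtain ⟨k, hk, hkg⟩ := hrV _ hg
    have hhk : h * k ∈ F ∩ K := hVV (Set.mul_mem_mul hh hk)
    constructor
    · intro hgC
      rw [hinj (hVC hk) hgC hkg, mul_inv_cancel_left] at hhk
      exact hhk
    · intro hgC
      have : h * k = g := hinj hhk hgC (by rw [map_mul, hkg, map_mul, map_inv, mul_inv_cancel_left])
      rw [← this, inv_mul_cancel_left]
      exact hVC hk
  · intro O hO
    obtain ⟨δ, hδ, hδO⟩ := exists_eq_of_norm_matHom_sub_lt hp (inter_mem hO hC)
    refine ⟨δ, hδ, fun g hg hgδ => ?_⟩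
    obtain ⟨k, hk, hkg⟩ := hδO g hgδ
    rw [← hinj hk.2 hg hkg]
    exact hk.1

theorem matHom_oneParam_inv (hp : IsCoveringMap p) (X : so n) (t : ℝ) :
    matHom p (oneParam hp X t)⁻¹ = NormedSpace.exp (t • (-X.1)) := by
  change mat (p (oneParam hp X t)⁻¹) = _
  rw [← oneParam_neg, mat_oneParam, neg_smul, smul_neg]

theorem contDiff_matrix_exp {m : ℕ} : ContDiff ℝ ∞
    (NormedSpace.exp : Matrix (Fin m) (Fin m) ℝ → Matrix (Fin m) (Fin m) ℝ) := by
  have h : ∀ x : Matrix (Fin m) (Fin m) ℝ, AnalyticAt ℝ NormedSpace.exp x := fun x =>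
    NormedSpace.exp_analytic x
  exact contDiff_iff_contDiffAt.2 fun x => (h x).contDiffAt

section Vectors

variable [MeasurableSpace G] [BorelSpace G] {μ : Measure G} [μ.IsHaarMeasure] {C : Set G} {r : ℝ}

theorem gardingVector_mem_smoothVectors (hp : IsCoveringMap p) (U : UnitaryRep G H)
    (hC : IsSheet (matHom p) C r) {Φ : Matrix (Fin (n + 2)) (Fin (n + 2)) ℝ → ℝ}
    (hΦ : ContDiff ℝ ∞ Φ) (hs : tsupport Φ ⊆ Metric.ball 1 r) (v : H) :
    gardingVector μ U (matHom p) C Φ v ∈ smoothVectors hp U := by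
  have hm := continuous_matHom hp
  have h1 := op_gardingVector_of_contDiff (μ := μ) hC hm U hΦ hs v
  have hc := (continuous_oneParam_ofCoef (n := n) hp).tendsto 0
  simp only [map_zero, oneParam_zero_left] at hc
  have h2 := hc.eventually h1
  let ℓ : (Fin (n + 2) → Fin (n + 2) → ℝ) →ₗ[ℝ] Matrix (Fin (n + 2)) (Fin (n + 2)) ℝ :=
    -((so n).toSubmodule.subtype ∘ₗ ofCoef)
  have hℓ : ContDiff ℝ ∞ ℓ := (LinearMap.toContinuousLinearMap ℓ).contDiff
  have h3 : ContDiff ℝ ∞ fun c : Fin (n + 2) → Fin (n + 2) → ℝ =>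
      ∫ g in C, Φ (NormedSpace.exp (ℓ c) * matHom p g) • U.op g v ∂μ :=
    (contDiff_translate_gardingVector (μ := μ) hC hm U hΦ v).comp (contDiff_matrix_exp.comp hℓ)
  refine h3.contDiffAt.congr_of_eventuallyEq ?_
  filter_upwards [h2] with c hc
  rw [ofCoef_apply] at hc
  rw [hc, ← ofCoef_apply, matHom_oneParam_inv, one_smul]
  rfl

theorem gardingVector_mem_diffVectors (hp : IsCoveringMap p) (U : UnitaryRep G H)
    (hC : IsSheet (matHom p) C r) {Φ : Matrix (Fin (n + 2)) (Fin (n + 2)) ℝ → ℝ}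
    (hΦ : ContDiff ℝ ∞ Φ) (hs : tsupport Φ ⊆ Metric.ball 1 r) (v : H) (k : ℕ) :
    gardingVector μ U (matHom p) C Φ v ∈ diffVectors hp U k := by
  induction k generalizing Φ with
  | zero => exact Submodule.mem_top
  | succ k ih =>
    have hm := continuous_matHom hp
    obtain ⟨L, hL, hLB⟩ := hasFDerivAt_translate_gardingVector (μ := μ) hC hm U hΦ v
    have h1 := op_gardingVector_of_contDiff (μ := μ) hC hm U hΦ hs v
    refine ⟨-(L.toLinearMap ∘ₗ (so n).toSubmodule.subtype), fun X => ⟨?_, ?_⟩⟩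
    · have hc := (oneParam hp X).continuous.tendsto 0
      rw [oneParam_zero] at hc
      have h2 := hc.eventually h1
      have h3 : HasDerivAt (fun t : ℝ => NormedSpace.exp (t • (-X.1))) (-X.1) 0 := by
        have h := hasDerivAt_exp_smul_const (𝕂 := ℝ) (-X.1) 0
        refine HasDerivAt.congr_deriv h ?_
        rw [zero_smul, NormedSpace.exp_zero, one_mul]
      have h0 : HasFDerivAt (fun A => ∫ g in C, Φ (A * matHom p g) • U.op g v ∂μ) L
          (NormedSpace.exp ((0 : ℝ) • (-X.1))) := by
        rw [zero_smul, NormedSpace.exp_zero]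
        exact hL
      have h4 := h0.comp_hasDerivAt (0 : ℝ) h3
      refine (h4.congr_of_eventuallyEq ?_).congr_deriv ?_
      · filter_upwards [h2] with t ht
        rw [ht, matHom_oneParam_inv]
        rfl
      · rw [map_neg]
        rfl
    · have h5 : (-(L.toLinearMap ∘ₗ (so n).toSubmodule.subtype)) X = L (-X.1) := by simp
      rw [h5, hLB]
      exact ih (contDiff_weightDeriv _ hΦ) ((tsupport_weightDeriv_subset _ _).trans hs)

end Vectors

/-- Stated for an arbitrary set so that it serves both notions of smooth vector without comparing
them. -/
theorem dense_of_gardingVector_mem (hp : IsCoveringMap p) (U : UnitaryRep G H) (K : Set H)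
    (hK : ∀ [MeasurableSpace G] [BorelSpace G] (μ : Measure G) [μ.IsHaarMeasure]
      (C : Set G) (r : ℝ),
      IsSheet (matHom p) C r → ∀ Φ : Matrix (Fin (n + 2)) (Fin (n + 2)) ℝ → ℝ, ContDiff ℝ ∞ Φ →
      tsupport Φ ⊆ Metric.ball 1 r → ∀ v, gardingVector μ U (matHom p) C Φ v ∈ K) : Dense K := by
  let _ : MeasurableSpace G := borel G
  have : BorelSpace G := ⟨rfl⟩
  have := locallyCompactSpace_of_isCoveringMap hp
  obtain ⟨C, r, hC⟩ := exists_isSheet hp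
  refine Metric.dense_iff.2 fun v ε hε => ?_
  obtain ⟨Φ, hΦ, hs, hv⟩ := exists_gardingVector_norm_sub_le (μ := Measure.haar) hC
    (continuous_matHom hp) U v (half_pos hε)
  refine ⟨_, ?_, hK Measure.haar C r hC Φ hΦ hs v⟩
  rw [Metric.mem_ball, dist_eq_norm]
  linarith

theorem dense_smoothVectors (hp : IsCoveringMap p) (U : UnitaryRep G H) :
    Dense (smoothVectors hp U : Set H) :=
  dense_of_gardingVector_mem hp U _ fun _ _ _ _ hC _ hΦ hs v =>
    gardingVector_mem_smoothVectors hp U hC hΦ hs v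

theorem dense_smoothCore (hp : IsCoveringMap p) (U : UnitaryRep G H) :
    Dense (smoothCore hp U : Set H) :=
  dense_of_gardingVector_mem hp U _ fun _ _ _ _ hC _ hΦ hs v =>
    (mem_smoothCore hp U _).2 fun k => gardingVector_mem_diffVectors hp U hC hΦ hs v k

end Density

/-! ### Vectors smooth in exponential coordinates -/

section SmoothVectors

set_option linter.unusedSectionVars false

variable {n : ℕ} {G : Type*} [Group G] [TopologicalSpace G] [IsTopologicalGroup G] {p : G →* SO0 n}
  {H : Type*} [NormedAddCommGroup H] [InnerProductSpace ℂ H] [CompleteSpace H]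

theorem op_mem_smoothVectors (hp : IsCoveringMap p) (U : UnitaryRep G H) (g : G) {v : H}
    (hv : v ∈ smoothVectors hp U) : U.op g v ∈ smoothVectors hp U := by
  let ℓ : (Fin (n + 2) → Fin (n + 2) → ℝ) →ₗ[ℝ] (Fin (n + 2) → Fin (n + 2) → ℝ) :=
    coef ∘ₗ Ad p g⁻¹ ∘ₗ ofCoef
  have hℓ : ContDiff ℝ ∞ ℓ := (LinearMap.toContinuousLinearMap ℓ).contDiff
  have hv' : ContDiffAt ℝ ∞ (fun c => U.op (oneParam hp (ofCoef c) 1) v) (ℓ 0) := by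
    rw [map_zero]; exact hv
  have h1 : ContDiffAt ℝ ∞ (fun c => U.op g (U.op (oneParam hp (ofCoef (ℓ c)) 1) v)) 0 :=
    ((U.op g).restrictScalars ℝ).contDiff.contDiffAt.comp 0 (hv'.comp 0 hℓ.contDiffAt)
  refine h1.congr_of_eventuallyEq (Eventually.of_forall fun c => ?_)
  simp only [ℓ, LinearMap.comp_apply, ofCoef_coef, oneParam_Ad, ← U.op_mul, ← ofCoef_apply]
  congr 1
  group

theorem hasDerivAt_of_mem_smoothVectors (hp : IsCoveringMap p) (U : UnitaryRep G H) {v : H}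
    (hv : v ∈ smoothVectors hp U) (X : so n) :
    HasDerivAt (fun t : ℝ => U.op (oneParam hp X t) v)
      (deriv (fun t : ℝ => U.op (oneParam hp X t) v) 0) 0 := by
  have hv' : ContDiffAt ℝ ∞ (fun c => U.op (oneParam hp (ofCoef c) 1) v) ((0 : ℝ) • coef X) := by
    rw [zero_smul]; exact hv
  have h1 := hv'.differentiableAt (by simp)
  have h2 : DifferentiableAt ℝ (fun t : ℝ => t • coef X) 0 := by fun_prop
  have h3 : DifferentiableAt ℝ
    (fun t : ℝ => U.op (oneParam hp (ofCoef (t • coef X)) 1) v) 0 :=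
    DifferentiableAt.comp (g := fun c => U.op (oneParam hp (ofCoef c) 1) v) (0 : ℝ) h1 h2
  simp only [map_smul, ofCoef_coef, oneParam_smul, mul_one] at h3
  exact h3.hasDerivAt

end SmoothVectors

/-! ### Schur's lemma -/

section Schur

set_option linter.unusedSectionVars false

variable {G : Type*} [Group G] [TopologicalSpace G]
  {H : Type*} [NormedAddCommGroup H] [InnerProductSpace ℂ H] [CompleteSpace H]

/-- If the spectrum contained x < y, functions supported on either side of the midpoint would give
nonzero operators f(A), g(A) with product zero, and ker f(A) would be a proper nonzero closed
invariant subspace. So the spectrum is a single point. -/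
theorem schur_of_isSelfAdjoint (U : UnitaryRep G H) {T : Subgroup G} (hU : U.IsIrreducibleOn T)
    {A : H →L[ℂ] H} (hA : IsSelfAdjoint A) (hc : ∀ g ∈ T, Commute A (U.op g)) :
    ∃ c : ℝ, A = algebraMap ℝ (H →L[ℂ] H) c := by
  have := hU.1
  have hne : ∀ (f : ℝ → ℝ), Continuous f → ∀ x ∈ spectrum ℝ A, f x ≠ 0 → cfc f A ≠ 0 := by
    intro f hf x hx hfx h0
    have h1 : f x ∈ spectrum ℝ (cfc f A) := by
      rw [cfc_map_spectrum f A hA hf.continuousOn]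
      exact ⟨x, hx, rfl⟩
    rw [h0, spectrum.zero_eq] at h1
    exact hfx h1
  have hsub : ∀ x ∈ spectrum ℝ A, ∀ y ∈ spectrum ℝ A, ¬ x < y := by
    intro x hx y hy hxy
    set f : ℝ → ℝ := fun t => max 0 (t - (x + y) / 2) with hf
    set g : ℝ → ℝ := fun t => max 0 ((x + y) / 2 - t) with hg
    have hfc : Continuous f := by fun_prop
    have hgc : Continuous g := by fun_prop
    have hf0 : cfc f A ≠ 0 := hne f hfc y hy (by
      have : 0 < y - (x + y) / 2 := by linarith
      exact (lt_max_of_lt_right this).ne')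
    have hg0 : cfc g A ≠ 0 := hne g hgc x hx (by
      have : 0 < (x + y) / 2 - x := by linarith
      exact (lt_max_of_lt_right this).ne')
    have hfg : cfc f A * cfc g A = 0 := by
      rw [← cfc_mul f g A hfc.continuousOn hgc.continuousOn]
      have : (fun t => f t * g t) = fun _ => (0 : ℝ) := by
        funext t
        simp only [hf, hg]
        rcases le_total t ((x + y) / 2) with h | h
        · rw [max_eq_left (by linarith), zero_mul]
        · rw [max_eq_left (a := (0 : ℝ)) (b := (x + y) / 2 - t) (by linarith), mul_zero]
      rw [this, cfc_const_zero]
    rcases hU.2 (LinearMap.ker (cfc f A).toLinearMap) (cfc f A).isClosed_ker (fun u hu v hv => by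
      have h1 : Commute (cfc f A) (U.op u) := hA.commute_cfc (hc u hu) f
      have h2 := congrArg (fun B : H →L[ℂ] H => B v) h1.eq
      simp only [mul_apply_eq_comp] at h2
      simp only [LinearMap.mem_ker, ContinuousLinearMap.coe_coe] at hv ⊢
      rw [h2, hv, map_zero]) with h | h
    · refine hg0 (ContinuousLinearMap.ext fun v => ?_)
      have : (cfc g A) v ∈ LinearMap.ker (cfc f A).toLinearMap := by
        have := congrArg (fun B : H →L[ℂ] H => B v) hfg
        simpa using this
      rw [h] at this
      simpa using this
    · refine hf0 (ContinuousLinearMap.ext fun v => ?_)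
      have : v ∈ LinearMap.ker (cfc f A).toLinearMap := by rw [h]; trivial
      simpa using this
  obtain ⟨c, hcA⟩ := ContinuousFunctionalCalculus.spectrum_nonempty (R := ℝ) A hA
  refine ⟨c, ?_⟩
  rw [← cfc_const c A hA]
  conv_lhs => rw [← cfc_id ℝ A hA]
  refine cfc_congr fun x hx => ?_
  exact le_antisymm (not_lt.1 (hsub c hcA x hx)) (not_lt.1 (hsub x hx c hcA))

theorem schur (U : UnitaryRep G H) {T : Subgroup G} (hU : U.IsIrreducibleOn T)
    {B : H →L[ℂ] H} (hc : ∀ g ∈ T, ∀ v, B (U.op g v) = U.op g (B v)) :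
    ∃ c : ℂ, ∀ v, B v = c • v := by
  have h1 : ∀ g ∈ T, Commute B (U.op g) := fun g hg => ContinuousLinearMap.ext fun v => hc g hg v
  have hstar : ∀ g, star (U.op g) = U.op g⁻¹ := fun g => by
    rw [UnitaryRep.op, UnitaryRep.op, map_inv]
    rfl
  have h2 : ∀ g ∈ T, Commute (star B) (U.op g) := fun g hg => by
    have := (h1 g⁻¹ (inv_mem hg)).star_star
    rwa [hstar, inv_inv] at this
  obtain ⟨a, ha⟩ := schur_of_isSelfAdjoint U hU (realPart B).2 fun g hg => by
    rw [realPart_apply_coe]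
    exact ((h1 g hg).add_left (h2 g hg)).smul_left _
  obtain ⟨b, hb⟩ := schur_of_isSelfAdjoint U hU (imaginaryPart B).2 fun g hg => by
    rw [imaginaryPart_apply_coe]
    exact (((h1 g hg).sub_left (h2 g hg)).smul_left _).smul_left _
  refine ⟨a + Complex.I * b, fun v => ?_⟩
  have h3 := congrArg (fun B : H →L[ℂ] H => B v) (realPart_add_I_smul_imaginaryPart B)
  rw [← h3, ha, hb]
  simp only [add_apply, smul_apply,
    Algebra.algebraMap_eq_smul_one, one_apply_eq_self]
  rw [add_smul, mul_smul, Complex.coe_smul, Complex.coe_smul]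

/-- Von Neumann's graph method: the orthogonal projection P onto the closed graph of `O` in H ⊕ H
commutes with the diagonal action, so both components of P(h, 0) are bounded commuting operators of
h, hence scalars β and γ by the bounded case. These determine `O`. -/
theorem schur_symmetric (U : UnitaryRep G H) {T : Subgroup G} (hU : U.IsIrreducibleOn T)
    {D : Submodule ℂ H} (hD : Dense (D : Set H)) {O : Module.End ℂ D}
    (hsymm : ∀ v w : D, inner ℂ (O v : H) (w : H) = inner ℂ (v : H) (O w : H))
    (hinv : ∀ g ∈ T, ∀ v : D, ∃ h : U.op g v ∈ D, (O ⟨_, h⟩ : H) = U.op g (O v)) :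
    ∃ c : ℂ, ∀ v, O v = c • v := by
  have := hU.1
  let Γ₀ : Submodule ℂ (WithLp 2 (H × H)) :=
    { carrier := {x | ∃ v : D, x = WithLp.toLp 2 ((v : H), (O v : H))}
      add_mem' := by
        rintro _ _ ⟨v, rfl⟩ ⟨w, rfl⟩
        exact ⟨v + w, by rw [← WithLp.toLp_add, map_add]; rfl⟩
      zero_mem' := ⟨0, by rw [map_zero]; rfl⟩
      smul_mem' := by
        rintro c _ ⟨v, rfl⟩
        exact ⟨c • v, by rw [← WithLp.toLp_smul, map_smul]; rfl⟩ }
  let Γ : Submodule ℂ (WithLp 2 (H × H)) := Γ₀.topologicalClosure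
  have hΓc : IsClosed (Γ : Set (WithLp 2 (H × H))) := Γ₀.isClosed_topologicalClosure
  have : CompleteSpace Γ := hΓc.completeSpace_coe
  let V : G → (WithLp 2 (H × H)) →L[ℂ] (WithLp 2 (H × H)) := fun g =>
    (WithLp.prodContinuousLinearEquiv 2 ℂ H H).symm.toContinuousLinearMap ∘L
      ((U.op g).prodMap (U.op g)) ∘L
        (WithLp.prodContinuousLinearEquiv 2 ℂ H H).toContinuousLinearMap
  have hV1 : ∀ g (x : WithLp 2 (H × H)), (V g x).fst = U.op g x.fst := fun g x => rfl
  have hV2 : ∀ g (x : WithLp 2 (H × H)), (V g x).snd = U.op g x.snd := fun g x => rfl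
  have hVinv : ∀ g ∈ T, ∀ x ∈ Γ, V g x ∈ Γ := by
    intro g hg x hx
    refine map_mem_closure (V g).continuous hx ?_
    rintro _ ⟨v, rfl⟩
    obtain ⟨h, hO⟩ := hinv g hg v
    refine ⟨⟨_, h⟩, ?_⟩
    rw [hO]
    rfl
  have hVinner : ∀ g (x y : WithLp 2 (H × H)), inner ℂ (V g x) y = inner ℂ x (V g⁻¹ y) := by
    intro g x y
    rw [WithLp.prod_inner_apply, WithLp.prod_inner_apply]
    exact congrArg₂ _ (U.inner_op_left _ _ _) (U.inner_op_left _ _ _)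
  have hPV : ∀ g ∈ T, ∀ x, Γ.starProjection (V g x) = V g (Γ.starProjection x) := by
    intro g hg x
    refine Submodule.eq_starProjection_of_mem_of_inner_eq_zero
      (hVinv g hg _ (Submodule.starProjection_apply_mem _ _)) fun w hw => ?_
    rw [← map_sub, hVinner]
    exact Submodule.starProjection_inner_eq_zero x _ (hVinv _ (inv_mem hg) w hw)
  let J : H →L[ℂ] (WithLp 2 (H × H)) :=
    (WithLp.prodContinuousLinearEquiv 2 ℂ H H).symm.toContinuousLinearMap ∘L
    ContinuousLinearMap.inl ℂ H H
  have hJV : ∀ g h, J (U.op g h) = V g (J h) := fun g h => by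
    change WithLp.toLp 2 (U.op g h, (0 : H)) = WithLp.toLp 2 (U.op g h, U.op g 0)
    rw [map_zero]
  let π₁ : (WithLp 2 (H × H)) →L[ℂ] H := ContinuousLinearMap.fst ℂ H H ∘L
    (WithLp.prodContinuousLinearEquiv 2 ℂ H H).toContinuousLinearMap
  let π₂ : (WithLp 2 (H × H)) →L[ℂ] H := ContinuousLinearMap.snd ℂ H H ∘L
    (WithLp.prodContinuousLinearEquiv 2 ℂ H H).toContinuousLinearMap
  obtain ⟨β, hβ⟩ := schur U hU (B := π₁ ∘L Γ.starProjection ∘L J) fun g hg h => by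
    change π₁ (Γ.starProjection (J (U.op g h))) = _
    rw [hJV, hPV g hg]
    rfl
  obtain ⟨γ, hγ⟩ := schur U hU (B := π₂ ∘L Γ.starProjection ∘L J) fun g hg h => by
    change π₂ (Γ.starProjection (J (U.op g h))) = _
    rw [hJV, hPV g hg]
    rfl
  have hP : ∀ h, Γ.starProjection (J h) = WithLp.toLp 2 (β • h, γ • h) := fun h => by
    rw [← hβ h, ← hγ h]
    rfl
  have hΓsymm : ∀ x ∈ Γ, ∀ w : D, inner ℂ x.snd (w : H) = inner ℂ x.fst (O w : H) := by
    intro x hx w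
    have hcl : IsClosed {x : WithLp 2 (H × H) | inner ℂ x.snd (w : H) = inner ℂ x.fst (O w : H)} :=
      isClosed_eq (π₂.continuous.inner continuous_const) (π₁.continuous.inner continuous_const)
    refine closure_minimal ?_ hcl hx
    rintro _ ⟨v, rfl⟩
    exact hsymm v w
  -- This says that (h, 0) - P(h, 0) is orthogonal to the graph.
  have hkey : ∀ (v : D) (h : H), (1 - β) * inner ℂ (v : H) h = γ * inner ℂ (O v : H) h := by
    intro v h
    have hmem : WithLp.toLp 2 ((v : H), (O v : H)) ∈ Γ :=
      Γ₀.le_topologicalClosure ⟨v, rfl⟩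
    have h1 := Submodule.starProjection_inner_eq_zero (K := Γ) (J h) _ hmem
    rw [← inner_conj_symm, map_eq_zero, hP, WithLp.prod_inner_apply] at h1
    change inner ℂ (v : H) (h - β • h) + inner ℂ (O v : H) (0 - γ • h) = 0 at h1
    rw [inner_sub_right, inner_sub_right, inner_smul_right, inner_smul_right,
      inner_zero_right] at h1
    linear_combination h1
  -- If γ = 0 then β = 1, so H ⊕ 0 lies in the closed graph; symmetry, extended to the closure and
  -- applied to (O v, 0), gives ‖O v‖² = 0. Otherwise `hkey` can be solved for O v.
  by_cases hγ0 : γ = 0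
  · refine ⟨0, fun v => ?_⟩
    rw [zero_smul]
    obtain ⟨w, hwD, hw0⟩ : ∃ w ∈ D, w ≠ 0 := by
      by_contra hcon
      push Not at hcon
      obtain ⟨y, hy⟩ := exists_ne (0 : H)
      refine hy (hD.eq_zero_of_inner_left (𝕜 := ℂ) fun w hw => ?_)
      rw [hcon w hw, inner_zero_right]
    have hβ1 : β = 1 := by
      have h1 := hkey ⟨w, hwD⟩ w
      rw [hγ0, zero_mul] at h1
      have h2 : inner ℂ w w ≠ 0 := inner_self_ne_zero.2 hw0
      have h3 := (mul_eq_zero.1 h1).resolve_right h2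
      linear_combination -h3
    apply Subtype.ext
    have h4 : WithLp.toLp 2 ((O v : H), (0 : H)) ∈ Γ := by
      have := hP (O v : H)
      rw [hβ1, hγ0, one_smul, zero_smul] at this
      rw [← this]
      exact Submodule.starProjection_apply_mem _ _
    have h5 := hΓsymm _ h4 v
    change inner ℂ (0 : H) (v : H) = inner ℂ (O v : H) (O v : H) at h5
    rw [inner_zero_left] at h5
    exact inner_self_eq_zero.1 h5.symm
  · refine ⟨(starRingEnd ℂ) ((1 - β) / γ), fun v => Subtype.ext ?_⟩
    refine ext_inner_right ℂ fun h => ?_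
    rw [Submodule.coe_smul, inner_smul_left, Complex.conj_conj]
    have h1 := hkey v h
    field_simp
    linear_combination -h1

end Schur

/-! ### Commutants -/

section Commutant

set_option linter.unusedSectionVars false

variable {n : ℕ} {G : Type*} [Group G] [TopologicalSpace G] [IsTopologicalGroup G] {p : G →* SO0 n}
  {H : Type*} [NormedAddCommGroup H] [InnerProductSpace ℂ H] [CompleteSpace H]

/-- The elements of the Lie algebra with which the bounded operator `B` commutes, in the sense of
sesquilinear forms on the vectors of class `C^∞`. -/
def commutant (hp : IsCoveringMap p) (U : UnitaryRep G H) (B : H →L[ℂ] H) :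
    Submodule ℝ (so n) where
  carrier := {X | ∀ v w : smoothCore hp U,
    inner ℂ (B (lieAct hp U X v)) (w : H) + inner ℂ (B v) (lieAct hp U X w : H) = 0}
  add_mem' := by
    intro X Y hX hY v w
    simp only [lieAct_add, LinearMap.add_apply, Submodule.coe_add, map_add, inner_add_left,
      inner_add_right]
    linear_combination hX v w + hY v w
  zero_mem' := by
    intro v w
    rw [← zero_smul ℝ (0 : so n), lieAct_smul]
    simp
  smul_mem' := by
    intro r X hX v w
    simp only [lieAct_smul, LinearMap.smul_apply, Submodule.coe_smul, map_smul, inner_smul_left,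
      inner_smul_right, Complex.conj_ofReal]
    linear_combination (r : ℂ) * hX v w

theorem lie_mem_commutant (hp : IsCoveringMap p) (U : UnitaryRep G H) {B : H →L[ℂ] H} {X Y : so n}
    (hX : X ∈ commutant hp U B) (hY : Y ∈ commutant hp U B) : ⁅X, Y⁆ ∈ commutant hp U B := by
  intro v w
  simp only [lieAct_lie hp U (dense_smoothCore hp U), LinearMap.sub_apply, Module.End.mul_apply,
    Submodule.coe_sub, map_sub, inner_sub_left, inner_sub_right]
  linear_combination hX (lieAct hp U Y v) w - hY v (lieAct hp U X w)
    - hY (lieAct hp U X v) w + hX v (lieAct hp U Y w)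

theorem eq_of_hasDerivAt_zero_shift {E : Type*} [NormedAddCommGroup E] [NormedSpace ℝ E]
    {f : ℝ → E} (h : ∀ t, HasDerivAt (fun s => f (s + t)) 0 0) (t : ℝ) : f t = f 0 := by
  have h1 : ∀ t, HasDerivAt f 0 t := fun t => by
    have h2 : HasDerivAt (fun s => f (s + t)) 0 (t - t) := by rw [sub_self]; exact h t
    simpa using h2.comp_sub_const t t
  exact is_const_of_deriv_eq_zero (fun t => (h1 t).differentiableAt) (fun t => (h1 t).deriv) t 0

/-- The function t ↦ ⟨B U(t) v, U(t) w⟩ is constant on the core: its derivative is the commutation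
form evaluated at transported vectors, which remain in the core. Density does the rest. -/
theorem apply_op_oneParam_of_mem_commutant (hp : IsCoveringMap p) (U : UnitaryRep G H)
    {B : H →L[ℂ] H} {X : so n} (hX : X ∈ commutant hp U B) (t : ℝ) (v : H) :
    B (U.op (oneParam hp X t) v) = U.op (oneParam hp X t) (B v) := by
  have hD := dense_smoothCore hp U
  have hconst : ∀ (v w : smoothCore hp U) (t : ℝ),
      inner ℂ (B (U.op (oneParam hp X t) v)) (U.op (oneParam hp X t) (w : H)) =
        inner ℂ (B v) (w : H) := by
    intro v w t
    have h := eq_of_hasDerivAt_zero_shift (f := fun t =>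
      inner ℂ (B (U.op (oneParam hp X t) v)) (U.op (oneParam hp X t) (w : H))) (fun t => ?_) t
    · simpa [oneParam_zero, U.op_one] using h
    · set v' : smoothCore hp U := ⟨U.op (oneParam hp X t) v, op_mem_smoothCore hp U _ v.2⟩ with hv'
      set w' : smoothCore hp U := ⟨U.op (oneParam hp X t) w, op_mem_smoothCore hp U _ w.2⟩ with hw'
      have h1 := ((B.restrictScalars ℝ).hasFDerivAt.comp_hasDerivAt (0 : ℝ)
        (hasDerivAt_lieAct hp U X v')).inner ℂ (hasDerivAt_lieAct hp U X w')
      refine (h1.congr_of_eventuallyEq (Eventually.of_forall fun s => ?_)).congr_deriv ?_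
      · simp [oneParam_add, U.op_mul, hv', hw']
      · simp only [Function.comp_apply, oneParam_zero, U.op_one,
          ContinuousLinearMap.coe_restrictScalars']
        linear_combination hX v' w'
  have h1 : ∀ v : smoothCore hp U,
      B (U.op (oneParam hp X t) v) = U.op (oneParam hp X t) (B v) := by
    intro v
    refine hD.eq_of_inner_left (𝕜 := ℂ) fun w hw => ?_
    have h := hconst v ⟨_, op_mem_smoothCore hp U (oneParam hp X t)⁻¹ hw⟩ t
    rw [U.op_op_inv] at h
    rw [h, U.inner_op_left]
  refine congrFun (Continuous.ext_on hD (B.continuous.comp (U.op _).continuous)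
    ((U.op _).continuous.comp B.continuous) fun v hv => ?_) v
  exact h1 ⟨v, hv⟩

theorem apply_op_of_mem_analyticSubgroup (hp : IsCoveringMap p) (U : UnitaryRep G H)
    {B : H →L[ℂ] H} {𝔥 : Submodule ℝ (so n)} (h𝔥 : 𝔥 ≤ commutant hp U B) {g : G}
    (hg : g ∈ analyticSubgroup hp 𝔥) (v : H) : B (U.op g v) = U.op g (B v) := by
  induction hg using Subgroup.closure_induction generalizing v with
  | mem g hg =>
    obtain ⟨X, hX, t, rfl⟩ := hg
    exact apply_op_oneParam_of_mem_commutant hp U (h𝔥 hX) t v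
  | one => rw [U.op_one, U.op_one]
  | mul g h _ _ ihg ihh => rw [U.op_mul, U.op_mul, ihg, ihh]
  | inv g _ ih =>
    have h := ih (U.op g⁻¹ v)
    rw [U.op_op_inv] at h
    rw [h, U.op_inv_op]

/-- A bounded operator commuting with a subalgebra on whose group `U` is irreducible is scalar. -/
theorem exists_smul_of_le_commutant (hp : IsCoveringMap p) (U : UnitaryRep G H)
    {𝔥 : Submodule ℝ (so n)} (hU : U.IsIrreducibleOn (analyticSubgroup hp 𝔥)) {B : H →L[ℂ] H}
    (h𝔥 : 𝔥 ≤ commutant hp U B) : ∃ c : ℂ, ∀ v, B v = c • v :=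
  schur U hU fun _ hg v => apply_op_of_mem_analyticSubgroup hp U h𝔥 hg v

/-- The operators on the vectors of class `C^∞` spanned by products of two elements of the Lie
algebra. -/
def quadraticOps (hp : IsCoveringMap p) (U : UnitaryRep G H) :
    Submodule ℂ (Module.End ℂ (smoothCore hp U)) :=
  Submodule.span ℂ {O | ∃ X Y : so n, O = lieAct hp U X * lieAct hp U Y}

theorem lieAct_mul_mem_quadraticOps (hp : IsCoveringMap p) (U : UnitaryRep G H) (X Y : so n) :
    lieAct hp U X * lieAct hp U Y ∈ quadraticOps hp U := Submodule.subset_span ⟨X, Y, rfl⟩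

/-- With one of the two factors moved to the other side of the inner product, each side carries a
single generator, and `hasDerivAt_lieAct_op` differentiates both. -/
theorem hasDerivAt_inner_quadraticOps (hp : IsCoveringMap p) (U : UnitaryRep G H)
    {O : Module.End ℂ (smoothCore hp U)} (hO : O ∈ quadraticOps hp U) (X : so n)
    (v w : smoothCore hp U) :
    HasDerivAt (fun t : ℝ => inner ℂ
      (O ⟨U.op (oneParam hp X t) v, op_mem_smoothCore hp U _ v.2⟩ : H)
      (U.op (oneParam hp X t) (w : H)))
      (inner ℂ (O (lieAct hp U X v) : H) (w : H) + inner ℂ (O v : H) (lieAct hp U X w : H)) 0 := by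
  have hD := dense_smoothCore hp U
  induction hO using Submodule.span_induction with
  | mem O hO =>
    obtain ⟨Y, Z, rfl⟩ := hO
    have h := ((hasDerivAt_lieAct_op hp U hD X Z v).inner ℂ
      (hasDerivAt_lieAct_op hp U hD X Y w)).fun_neg
    refine (h.congr_of_eventuallyEq (Eventually.of_forall fun t => ?_)).congr_deriv ?_
    · simp only [Module.End.mul_apply]
      exact inner_lieAct_left hp U Y _ ⟨_, op_mem_smoothCore hp U _ w.2⟩
    · simp only [oneParam_zero, U.op_one, Module.End.mul_apply, inner_lieAct_left hp U Y]
      ring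
  | zero => simpa using hasDerivAt_const _ _
  | add O P _ _ hO hP =>
    refine (hO.fun_add hP).congr_deriv ?_ |>.congr_of_eventuallyEq
      (Eventually.of_forall fun t => ?_)
    · simp only [LinearMap.add_apply, Submodule.coe_add, inner_add_left]
      ring
    · simp only [LinearMap.add_apply, Submodule.coe_add, inner_add_left]
  | smul c O _ hO =>
    refine (hO.const_mul ((starRingEnd ℂ) c)).congr_deriv ?_ |>.congr_of_eventuallyEq
      (Eventually.of_forall fun t => ?_)
    · simp only [LinearMap.smul_apply, Submodule.coe_smul, inner_smul_left]
      ring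
    · simp only [LinearMap.smul_apply, Submodule.coe_smul, inner_smul_left]

theorem quadraticOps_op_oneParam (hp : IsCoveringMap p) (U : UnitaryRep G H)
    {O : Module.End ℂ (smoothCore hp U)} (hO : O ∈ quadraticOps hp U) {X : so n}
    (hX : Commute O (lieAct hp U X)) (t : ℝ) (v : smoothCore hp U) :
    (O ⟨U.op (oneParam hp X t) v, op_mem_smoothCore hp U _ v.2⟩ : H) =
      U.op (oneParam hp X t) (O v) := by
  have hD := dense_smoothCore hp U
  have hconst : ∀ (v w : smoothCore hp U) (t : ℝ), inner ℂ
      (O ⟨U.op (oneParam hp X t) v, op_mem_smoothCore hp U _ v.2⟩ : H)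
      (U.op (oneParam hp X t) (w : H)) = inner ℂ (O v : H) (w : H) := by
    intro v w t
    have h := eq_of_hasDerivAt_zero_shift (f := fun t => inner ℂ
      (O ⟨U.op (oneParam hp X t) v, op_mem_smoothCore hp U _ v.2⟩ : H)
      (U.op (oneParam hp X t) (w : H))) (fun t => ?_) t
    · simpa [oneParam_zero, U.op_one] using h
    · set v' : smoothCore hp U := ⟨U.op (oneParam hp X t) v, op_mem_smoothCore hp U _ v.2⟩ with hv'
      set w' : smoothCore hp U := ⟨U.op (oneParam hp X t) w, op_mem_smoothCore hp U _ w.2⟩ with hw'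
      refine ((hasDerivAt_inner_quadraticOps hp U hO X v' w').congr_of_eventuallyEq
        (Eventually.of_forall fun s => ?_)).congr_deriv ?_
      · simp only [oneParam_add, U.op_mul, hv', hw']
      · rw [← Module.End.mul_apply, hX.eq, Module.End.mul_apply, inner_lieAct_left]
        ring
  refine hD.eq_of_inner_left (𝕜 := ℂ) fun w hw => ?_
  have h := hconst v ⟨_, op_mem_smoothCore hp U (oneParam hp X t)⁻¹ hw⟩ t
  rw [U.op_op_inv] at h
  rw [h, U.inner_op_left]

theorem quadraticOps_op (hp : IsCoveringMap p) (U : UnitaryRep G H)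
    {O : Module.End ℂ (smoothCore hp U)} (hO : O ∈ quadraticOps hp U) {𝔥 : Submodule ℝ (so n)}
    (h𝔥 : ∀ X ∈ 𝔥, Commute O (lieAct hp U X)) {g : G} (hg : g ∈ analyticSubgroup hp 𝔥)
    (v : smoothCore hp U) :
    (O ⟨U.op g v, op_mem_smoothCore hp U _ v.2⟩ : H) = U.op g (O v) := by
  induction hg using Subgroup.closure_induction generalizing v with
  | mem g hg =>
    obtain ⟨X, hX, t, rfl⟩ := hg
    exact quadraticOps_op_oneParam hp U hO (h𝔥 X hX) t v
  | one => simp only [U.op_one]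
  | mul g h _ _ ihg ihh =>
    have h1 := ihg ⟨U.op h v, op_mem_smoothCore hp U _ v.2⟩
    simp only [U.op_mul] at h1 ⊢
    rw [h1, ihh]
  | inv g _ ih =>
    have h := ih ⟨U.op g⁻¹ v, op_mem_smoothCore hp U _ v.2⟩
    simp only [U.op_op_inv] at h
    rw [h, U.op_inv_op]

/-- A symmetric quadratic operator commuting with a subalgebra on whose group `U` is irreducible
is scalar. -/
theorem exists_eq_smul_one_of_commute (hp : IsCoveringMap p) (U : UnitaryRep G H)
    {𝔥 : Submodule ℝ (so n)} (hU : U.IsIrreducibleOn (analyticSubgroup hp 𝔥))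
    {O : Module.End ℂ (smoothCore hp U)} (hO : O ∈ quadraticOps hp U)
    (hsymm : ∀ v w : smoothCore hp U, inner ℂ (O v : H) (w : H) = inner ℂ (v : H) (O w : H))
    (h𝔥 : ∀ X ∈ 𝔥, Commute O (lieAct hp U X)) : ∃ c : ℂ, O = c • 1 := by
  obtain ⟨c, hc⟩ := schur_symmetric U hU (dense_smoothCore hp U) hsymm fun g hg v =>
    ⟨op_mem_smoothCore hp U g v.2, quadraticOps_op hp U hO h𝔥 hg v⟩
  exact ⟨c, LinearMap.ext fun v => by simpa using hc v⟩

end Commutant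

/-! ### Quadratic relations -/

section Casimir

variable {ι A : Type*} [Fintype ι] [Ring A] [Algebra ℂ A]

/-- The tensor `T_{ac} = ∑_b ε_b m_{ab} m_{bc}`. -/
def casimirTensor (ε : ι → ℂ) (m : ι → ι → A) (a c : ι) : A := ∑ b, ε b • (m a b * m b c)

/-- T transforms as a tensor of rank two in its free indices: the four terms in which the summed
index is moved cancel in pairs by skew symmetry. -/
theorem lie_casimirTensor {ε : ι → ℂ} {m : ι → ι → A} {h : ι → ι → ℂ}
    (hh : ∀ (d : ι) (x : ι → A), ∑ b, (ε b * h d b) • x b = x d)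
    (hskew : ∀ a b, m b a = -m a b)
    (hcomm : ∀ a b c d, ⁅m a b, m c d⁆ =
      h a d • m b c + h b c • m a d - h a c • m b d - h b d • m a c) (d e a c : ι) :
    ⁅m d e, casimirTensor ε m a c⁆ =
      h e a • casimirTensor ε m d c - h d a • casimirTensor ε m e c
        + h e c • casimirTensor ε m a d - h d c • casimirTensor ε m a e := by
  have h0 : ⁅m d e, casimirTensor ε m a c⁆ =
      ∑ b, ε b • (⁅m d e, m a b⁆ * m b c + m a b * ⁅m d e, m b c⁆) := by
    simp only [casimirTensor, Ring.lie_def, Finset.mul_sum, Finset.sum_mul,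
      ← Finset.sum_sub_distrib]
    refine Finset.sum_congr rfl fun b _ => ?_
    rw [mul_smul_comm, smul_mul_assoc, ← smul_sub]
    congr 1
    noncomm_ring
  have h1 : ∀ b, ε b • (⁅m d e, m a b⁆ * m b c + m a b * ⁅m d e, m b c⁆) =
      (ε b * h d b) • (m e a * m b c) + h e a • (ε b • (m d b * m b c))
        - h d a • (ε b • (m e b * m b c)) - (ε b * h e b) • (m d a * m b c)
        - h d c • (ε b • (m a b * m b e)) + (ε b * h e b) • (m a b * m d c)
        - (ε b * h d b) • (m a b * m e c) + h e c • (ε b • (m a b * m b d)) := by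
    intro b
    rw [hcomm, hcomm, hskew e b, hskew b d]
    simp only [add_mul, sub_mul, mul_add, mul_sub, smul_mul_assoc, mul_smul_comm, mul_neg]
    module
  rw [h0, Finset.sum_congr rfl fun b _ => h1 b]
  simp only [Finset.sum_add_distrib, Finset.sum_sub_distrib, ← Finset.smul_sum, hh]
  rw [hskew a e, hskew a d]
  simp only [casimirTensor]
  noncomm_ring

end Casimir

/-! ### Quadratic relations forced by irreducibility on the Poincaré group -/

section Relations

variable {n : ℕ} {G : Type*} [Group G] [TopologicalSpace G] [IsTopologicalGroup G] {p : G →* SO0 n}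
  {H : Type*} [NormedAddCommGroup H] [InnerProductSpace ℂ H] [CompleteSpace H]

theorem lieAct_neg (hp : IsCoveringMap p) (U : UnitaryRep G H) (X : so n) :
    lieAct hp U (-X) = -lieAct hp U X := by
  rw [← neg_one_smul ℝ X, lieAct_smul, Complex.ofReal_neg, Complex.ofReal_one]
  exact neg_one_smul ℂ (lieAct hp U X)

theorem lieAct_M_swap (hp : IsCoveringMap p) (U : UnitaryRep G H) (a b : Fin (n + 2)) :
    lieAct hp U (M b a) = -lieAct hp U (M a b) := by
  rw [M_swap, lieAct_neg]

theorem lie_lieAct (hp : IsCoveringMap p) (U : UnitaryRep G H) (X Y : so n) :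
    ⁅lieAct hp U X, lieAct hp U Y⁆ = lieAct hp U ⁅X, Y⁆ := by
  rw [lieAct_lie hp U (dense_smoothCore hp U), Ring.lie_def]

theorem lie_lieAct_M (hp : IsCoveringMap p) (U : UnitaryRep G H) (a b c d : Fin (n + 2)) :
    ⁅lieAct hp U (M a b), lieAct hp U (M c d)⁆ =
      (eta n a d : ℂ) • lieAct hp U (M b c) + (eta n b c : ℂ) • lieAct hp U (M a d)
        - (eta n a c : ℂ) • lieAct hp U (M b d) - (eta n b d : ℂ) • lieAct hp U (M a c) := by
  rw [lie_lieAct, M_bracket]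
  simp only [sub_eq_add_neg, lieAct_add, lieAct_neg, lieAct_smul]

/-- The tensor `T_{ac} = ∑_b η_{bb} U(M_{ab}) U(M_{bc})`. -/
def quadTensor (hp : IsCoveringMap p) (U : UnitaryRep G H) (a c : Fin (n + 2)) :
    Module.End ℂ (smoothCore hp U) :=
  casimirTensor (fun b => (metric n b : ℂ)) (fun a b => lieAct hp U (M a b)) a c

theorem quadTensor_mem_quadraticOps (hp : IsCoveringMap p) (U : UnitaryRep G H)
    (a c : Fin (n + 2)) : quadTensor hp U a c ∈ quadraticOps hp U := by
  unfold quadTensor casimirTensor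
  exact Submodule.sum_mem _ fun _ _ => Submodule.smul_mem _ _ (lieAct_mul_mem_quadraticOps hp U _ _)

theorem inner_quadTensor (hp : IsCoveringMap p) (U : UnitaryRep G H) (a c : Fin (n + 2))
    (v w : smoothCore hp U) :
    inner ℂ (quadTensor hp U a c v : H) (w : H) = inner ℂ (v : H) (quadTensor hp U c a w : H) := by
  simp only [quadTensor, casimirTensor, LinearMap.sum_apply, LinearMap.smul_apply,
    Module.End.mul_apply, Submodule.coe_sum, Submodule.coe_smul, sum_inner, inner_sum,
    inner_smul_left, inner_smul_right, Complex.conj_ofReal, inner_lieAct_left, neg_neg]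
  refine Finset.sum_congr rfl fun b _ => ?_
  rw [lieAct_M_swap hp U a b, lieAct_M_swap hp U b c]
  simp

theorem lie_quadTensor (hp : IsCoveringMap p) (U : UnitaryRep G H) (d e a c : Fin (n + 2)) :
    ⁅lieAct hp U (M d e), quadTensor hp U a c⁆ =
      (eta n e a : ℂ) • quadTensor hp U d c - (eta n d a : ℂ) • quadTensor hp U e c
        + (eta n e c : ℂ) • quadTensor hp U a d - (eta n d c : ℂ) • quadTensor hp U a e := by
  refine lie_casimirTensor (h := fun a b => (eta n a b : ℂ)) (fun d x => ?_)
    (fun a b => lieAct_M_swap hp U a b) (fun a b c d => lie_lieAct_M hp U a b c d) d e a c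
  rw [Finset.sum_eq_single d]
  · rw [eta_self, ← Complex.ofReal_mul, metric_mul_self, Complex.ofReal_one, one_smul]
  · intro b _ hb
    rw [eta_ne (Ne.symm hb)]
    simp
  · simp

theorem commute_of_mem_poincareAlg (hp : IsCoveringMap p) (U : UnitaryRep G H)
    {O : Module.End ℂ (smoothCore hp U)}
    (h1 : ∀ a, a ≠ 0 → a ≠ Fin.last (n + 1) →
      ⁅lieAct hp U (M 0 a) + lieAct hp U (M a (Fin.last (n + 1))), O⁆ = 0)
    (h2 : ∀ a b, a ≠ 0 → a ≠ Fin.last (n + 1) → b ≠ 0 → b ≠ Fin.last (n + 1) →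
      ⁅lieAct hp U (M a b), O⁆ = 0) {X : so n} (hX : X ∈ poincareAlg n) :
    Commute O (lieAct hp U X) := by
  have hα : ∀ α : Fin n, α.succ.castSucc ≠ 0 ∧ α.succ.castSucc ≠ Fin.last (n + 1) := fun α =>
    ⟨by simp [Fin.ext_iff], Fin.castSucc_ne_last _⟩
  refine Commute.symm ?_
  induction hX using Submodule.span_induction with
  | mem X hX =>
    rw [commute_iff_lie_eq]
    rcases hX with ⟨α, rfl⟩ | ⟨α, β, rfl⟩
    · rw [lieAct_add]
      exact h1 _ (hα α).1 (hα α).2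
    · exact h2 _ _ (hα α).1 (hα α).2 (hα β).1 (hα β).2
  | zero =>
    rw [← zero_smul ℝ (0 : so n), lieAct_smul, Complex.ofReal_zero, zero_smul]
    exact Commute.zero_left _
  | add X Y _ _ hX hY =>
    rw [lieAct_add]
    exact hX.add_left hY
  | smul r X _ hX =>
    rw [lieAct_smul]
    exact hX.smul_left _

-- `K` is T contracted twice with the null vector e_L - e_0 (in the numbering from 0), which the
-- Poincaré algebra annihilates. So `K` is a scalar; but ad `M 0 L` multiplies it by 2, whence `K` =
-- 0. Brackets with `M 0 1` split this single equation into the required ones.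
set_option linter.unusedSimpArgs false in
theorem quadTensor_relations (hn : 2 ≤ n) (hp : IsCoveringMap p) (U : UnitaryRep G H)
    (hU : U.IsIrreducibleOn (analyticSubgroup hp (poincareAlg n))) :
    quadTensor hp U 0 1 + quadTensor hp U 1 0 = 0 ∧ quadTensor hp U 0 0 = quadTensor hp U 1 1 := by
  set L := Fin.last (n + 1) with hL
  have h01 : (0 : Fin (n + 2)) ≠ 1 := by simp
  have h0L : (0 : Fin (n + 2)) ≠ L := by simp [hL, Fin.ext_iff]
  have h1L : (1 : Fin (n + 2)) ≠ L := by
    simp only [hL, ne_eq, Fin.ext_iff, Fin.val_one, Fin.val_last]; omega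
  have hLm : metric n L = -1 := metric_of_two_le (by simp [hL]; omega)
  set T := quadTensor hp U with hT
  set K := T L L + T 0 0 - (T L 0 + T 0 L) with hK
  have hKmem : K ∈ quadraticOps hp U := by
    refine Submodule.sub_mem _ (Submodule.add_mem _ ?_ ?_) (Submodule.add_mem _ ?_ ?_) <;>
      exact quadTensor_mem_quadraticOps hp U _ _
  have hKsymm : ∀ v w : smoothCore hp U,
      inner ℂ (K v : H) (w : H) = inner ℂ (v : H) (K w : H) := by
    intro v w
    simp only [hK, LinearMap.sub_apply, LinearMap.add_apply, Submodule.coe_sub, Submodule.coe_add,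
      inner_sub_left, inner_add_left, inner_sub_right, inner_add_right, hT, inner_quadTensor]
    ring
  obtain ⟨c, hc⟩ := exists_eq_smul_one_of_commute hp U hU hKmem hKsymm fun X hX => by
    refine commute_of_mem_poincareAlg hp U (fun a ha0 haL => ?_) (fun a b ha0 haL hb0 hbL => ?_) hX
    · rw [← hL] at haL
      simp only [hK, hT, lie_add, lie_sub, add_lie, lie_quadTensor, eta_ne ha0, eta_ne haL,
        eta_ne h0L, eta_ne h0L.symm, eta_ne ha0.symm, eta_ne haL.symm, eta_self, metric_zero, ← hL,
        hLm, Complex.ofReal_zero, Complex.ofReal_one, Complex.ofReal_neg, zero_smul, one_smul]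
      module
    · rw [← hL] at haL hbL
      simp only [hK, hT, lie_add, lie_sub, lie_quadTensor, eta_ne ha0, eta_ne haL, eta_ne hb0,
        eta_ne hbL, Complex.ofReal_zero, zero_smul, sub_zero, add_zero]
  have hK2 : ⁅lieAct hp U (M 0 L), K⁆ = (2 : ℂ) • K := by
    simp only [hK, hT, lie_add, lie_sub, lie_quadTensor, eta_ne h0L, eta_ne h0L.symm, eta_self,
      metric_zero, hLm, Complex.ofReal_zero, Complex.ofReal_one, Complex.ofReal_neg, zero_smul,
      one_smul]
    module
  have hK0 : K = 0 := by
    rw [show ⁅lieAct hp U (M 0 L), K⁆ = 0 by rw [hc, Ring.lie_def]; simp] at hK2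
    exact (smul_eq_zero.1 hK2.symm).resolve_left two_ne_zero
  set N := lieAct hp U (M 0 1) with hN
  have e : ∀ a c, ⁅N, T a c⁆ = (eta n 1 a : ℂ) • T 0 c - (eta n 0 a : ℂ) • T 1 c
        + (eta n 1 c : ℂ) • T a 0 - (eta n 0 c : ℂ) • T a 1 := fun a c =>
    lie_quadTensor hp U 0 1 a c
  -- ad N rotates the indices 0 and 1 and leaves L alone: symmetrized components with one index L
  -- have frequency 1, the traceless part of those within the plane has frequency 2. Two further
  -- brackets on `E1` multiply its sides by 4 and 1 up to a common sign, which leaves only zero.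
  have E1 : T 0 1 + T 1 0 = T L 1 + T 1 L := by
    have h := congrArg (fun O => ⁅N, O⁆) hK0
    simp only [hK, lie_add, lie_sub, e, eta_ne h0L, eta_ne h1L, eta_ne h01, eta_ne h01.symm,
      eta_self, metric_zero, metric_one, Complex.ofReal_zero, Complex.ofReal_one, zero_smul,
      one_smul, lie_zero] at h
    rw [← sub_eq_zero, ← neg_eq_zero, ← h]
    module
  have E2 : T L 0 + T 0 L = (T 0 0 - T 1 1) + (T 0 0 - T 1 1) := by
    have h := congrArg (fun O => ⁅N, O⁆) E1
    simp only [lie_add, e, eta_ne h0L, eta_ne h1L, eta_ne h01, eta_ne h01.symm,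
      eta_self, metric_zero, metric_one, Complex.ofReal_zero, Complex.ofReal_one, zero_smul,
      one_smul] at h
    rw [← sub_eq_zero] at h ⊢
    rw [← neg_eq_zero, ← h]
    module
  have E3 : T L 1 + T 1 L = (4 : ℂ) • (T 0 1 + T 1 0) := by
    have h := congrArg (fun O => ⁅N, O⁆) E2
    simp only [lie_add, lie_sub, e, eta_ne h0L, eta_ne h1L, eta_ne h01, eta_ne h01.symm,
      eta_self, metric_zero, metric_one, Complex.ofReal_zero, Complex.ofReal_one, zero_smul,
      one_smul] at h
    rw [← sub_eq_zero] at h ⊢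
    rw [← neg_eq_zero, ← h]
    module
  have E4 : T 0 1 + T 1 0 = 0 := by
    rw [E1] at E3
    have h : (3 : ℂ) • (T L 1 + T 1 L) = 0 := by
      rw [← sub_eq_zero] at E3
      rw [← neg_eq_zero, ← E3]
      module
    rw [E1]
    exact (smul_eq_zero.1 h).resolve_left three_ne_zero
  refine ⟨E4, ?_⟩
  have h := congrArg (fun O => ⁅N, O⁆) E4
  simp only [lie_add, e, eta_ne h01, eta_ne h01.symm, eta_self, metric_zero, metric_one,
    Complex.ofReal_zero, Complex.ofReal_one, zero_smul, one_smul, lie_zero] at h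
  have h2 : (2 : ℂ) • (T 0 0 - T 1 1) = 0 := by
    rw [← h]
    module
  exact sub_eq_zero.1 ((smul_eq_zero.1 h2).resolve_left two_ne_zero)

/-- In a massless representation the operators `T_{00}` and `T_{11}` are the same scalar. -/
theorem exists_quadTensor_eq_smul_one (hn : 2 ≤ n) (hp : IsCoveringMap p) (U : UnitaryRep G H)
    (hU : U.IsIrreducibleOn (analyticSubgroup hp (poincareAlg n))) :
    ∃ c : ℂ, quadTensor hp U 0 0 = c • 1 ∧ quadTensor hp U 1 1 = c • 1 := by
  obtain ⟨h01, h11⟩ := quadTensor_relations hn hp U hU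
  -- The bracket with `M a 1` carries the relation from index 1 to every other index. These
  -- symmetrized components are exactly the obstruction to T_{00} commuting with `M 0 a`.
  have hS : ∀ a, a ≠ 0 → quadTensor hp U a 0 + quadTensor hp U 0 a = 0 := by
    intro a ha
    by_cases ha1 : a = 1
    · rw [ha1, add_comm, h01]
    · have h := congrArg (fun O => ⁅lieAct hp U (M a 1), O⁆) h01
      simp only [lie_add, lie_quadTensor, eta_ne ha, eta_ne ha1, eta_self, metric_one,
        eta_ne (show (1 : Fin (n + 2)) ≠ 0 by simp), Complex.ofReal_zero, Complex.ofReal_one,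
        zero_smul, one_smul, lie_zero] at h
      rw [← h]
      abel
  obtain ⟨c, hc⟩ := exists_eq_smul_one_of_commute hp U hU (quadTensor_mem_quadraticOps hp U 0 0)
    (fun v w => inner_quadTensor hp U 0 0 v w) fun X hX => by
    refine commute_of_mem_poincareAlg hp U (fun a ha0 haL => ?_) (fun a b ha0 haL hb0 hbL => ?_) hX
    · rw [← neg_eq_zero, ← hS a ha0]
      simp only [add_lie, lie_quadTensor, eta_ne ha0, eta_self, metric_zero,
        eta_ne (show Fin.last (n + 1) ≠ 0 by simp [Fin.ext_iff]), Complex.ofReal_zero,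
        Complex.ofReal_one, zero_smul, one_smul]
      abel
    · simp only [lie_quadTensor, eta_ne ha0, eta_ne hb0, Complex.ofReal_zero, zero_smul, sub_zero,
        add_zero]
  exact ⟨c, hc, h11 ▸ hc⟩

end Relations

/-! ### Ladder operators -/

section Ladder

set_option linter.unusedSectionVars false

variable {n : ℕ} {G : Type*} [Group G] [TopologicalSpace G] [IsTopologicalGroup G] {p : G →* SO0 n}
  {H : Type*} [NormedAddCommGroup H] [InnerProductSpace ℂ H] [CompleteSpace H]

theorem sum_sq_lieAct_zero (hp : IsCoveringMap p) (U : UnitaryRep G H) {c : ℂ}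
    (hc : quadTensor hp U 0 0 = c • 1) :
    ∑ i : Fin n, lieAct hp U (M 0 i.succ.succ) * lieAct hp U (M 0 i.succ.succ) =
      c • 1 + lieAct hp U (M 0 1) * lieAct hp U (M 0 1) := by
  have h0 : lieAct hp U (M (0 : Fin (n + 2)) 0) = 0 := by
    rw [M_self, ← zero_smul ℝ (0 : so n), lieAct_smul, Complex.ofReal_zero, zero_smul]
  have hm : ∀ i : Fin n, metric n i.succ.succ = -1 := fun i => metric_of_two_le (by simp)
  have hs : ∀ b : Fin (n + 2), lieAct hp U (M 0 b) * lieAct hp U (M b 0) =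
      -(lieAct hp U (M 0 b) * lieAct hp U (M 0 b)) := fun b => by
    rw [lieAct_M_swap hp U 0 b]
    exact mul_neg (lieAct hp U (M 0 b)) (lieAct hp U (M 0 b))
  rw [← hc, quadTensor, casimirTensor, Fin.sum_univ_succ, Fin.sum_univ_succ]
  simp only [h0, mul_zero, smul_zero, Fin.succ_zero_eq_one, metric_one, hm, hs,
    Complex.ofReal_one, Complex.ofReal_neg, zero_add]
  simp

/-- All squares on the left are of Lorentz generators, so this expresses the square of the compact
generator inside the enveloping algebra of `so(1,n)`. -/
theorem sum_sq_lieAct_one (hp : IsCoveringMap p) (U : UnitaryRep G H) {c : ℂ}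
    (hc : quadTensor hp U 1 1 = c • 1) :
    ∑ i : Fin n, lieAct hp U (M 1 i.succ.succ) * lieAct hp U (M 1 i.succ.succ) =
      c • 1 + lieAct hp U (M 0 1) * lieAct hp U (M 0 1) := by
  have h0 : lieAct hp U (M (1 : Fin (n + 2)) 1) = 0 := by
    rw [M_self, ← zero_smul ℝ (0 : so n), lieAct_smul, Complex.ofReal_zero, zero_smul]
  have hm : ∀ i : Fin n, metric n i.succ.succ = -1 := fun i => metric_of_two_le (by simp)
  have hs : ∀ b : Fin n, lieAct hp U (M 1 b.succ.succ) * lieAct hp U (M b.succ.succ 1) =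
      -(lieAct hp U (M 1 b.succ.succ) * lieAct hp U (M 1 b.succ.succ)) := fun b => by
    rw [lieAct_M_swap hp U 1 b.succ.succ]
    exact mul_neg (lieAct hp U (M 1 b.succ.succ)) (lieAct hp U (M 1 b.succ.succ))
  have hs' : lieAct hp U (M (1 : Fin (n + 2)) 0) * lieAct hp U (M 0 1) =
      -(lieAct hp U (M 0 1) * lieAct hp U (M 0 1)) := by
    rw [lieAct_M_swap hp U 0 1]
    exact neg_mul (lieAct hp U (M 0 1)) (lieAct hp U (M 0 1))
  rw [← hc, quadTensor, casimirTensor, Fin.sum_univ_succ, Fin.sum_univ_succ]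
  simp only [h0, mul_zero, smul_zero, Fin.succ_zero_eq_one, metric_zero, hm, hs, hs',
    Complex.ofReal_one, Complex.ofReal_neg, zero_add]
  simp

/-- The ladder operators `U(M_{-1,i}) + σ i U(M_{0,i})`, `σ = ±1`. -/
def ladder (hp : IsCoveringMap p) (U : UnitaryRep G H) (σ : ℝ) (i : Fin n) :
    Module.End ℂ (smoothCore hp U) :=
  lieAct hp U (M 0 i.succ.succ) + (σ * Complex.I) • lieAct hp U (M 1 i.succ.succ)

theorem inner_ladder_left (hp : IsCoveringMap p) (U : UnitaryRep G H) (σ : ℝ) (i : Fin n)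
    (v w : smoothCore hp U) :
    inner ℂ (ladder hp U σ i v : H) (w : H) = -inner ℂ (v : H) (ladder hp U (-σ) i w : H) := by
  simp only [ladder, LinearMap.add_apply, LinearMap.smul_apply, Submodule.coe_add,
    Submodule.coe_smul, inner_add_left, inner_add_right, inner_smul_left, inner_smul_right,
    inner_lieAct_left, map_mul, Complex.conj_ofReal, Complex.conj_I, Complex.ofReal_neg]
  ring

theorem lieAct_zero_eq_ladder (hp : IsCoveringMap p) (U : UnitaryRep G H) (i : Fin n) :
    lieAct hp U (M 0 i.succ.succ) = (1 / 2 : ℂ) • (ladder hp U 1 i + ladder hp U (-1) i) := by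
  simp only [ladder, Complex.ofReal_one, Complex.ofReal_neg]
  module

theorem mul_ladder (hp : IsCoveringMap p) (U : UnitaryRep G H) {σ : ℝ} (hσ : σ * σ = 1)
    (i : Fin n) :
    lieAct hp U (M 0 1) * ladder hp U σ i =
      ladder hp U σ i * lieAct hp U (M 0 1) + (σ * Complex.I) • ladder hp U σ i := by
  have h0 : (0 : Fin (n + 2)) ≠ i.succ.succ := by simp [Fin.ext_iff]
  have h1 : (1 : Fin (n + 2)) ≠ i.succ.succ := by simp [Fin.ext_iff]
  have h01 : (0 : Fin (n + 2)) ≠ 1 := by simp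
  have e0 := lie_lieAct_M hp U 0 1 0 i.succ.succ
  have e1 := lie_lieAct_M hp U 0 1 1 i.succ.succ
  simp only [eta_ne h0, eta_ne h1, eta_ne h01, eta_ne h01.symm, eta_self, metric_zero, metric_one,
    Complex.ofReal_zero, Complex.ofReal_one, zero_smul, one_smul, Ring.lie_def] at e0 e1
  have hσ' : (σ * Complex.I) * (σ * Complex.I) = -1 := by
    rw [mul_mul_mul_comm, Complex.I_mul_I, ← Complex.ofReal_mul, hσ]
    simp
  simp only [ladder, mul_add, add_mul, mul_smul_comm, smul_mul_assoc, smul_add, smul_smul, hσ']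
  rw [sub_eq_iff_eq_add] at e0 e1
  rw [e0, e1]
  module

/-- The squares add up by the two quadratic relations; the cross terms are commutators, each of the
`n` indices contributing one multiple of `M 0 1`. -/
theorem sum_ladder_mul_ladder (hp : IsCoveringMap p) (U : UnitaryRep G H) {c : ℂ}
    (hc0 : quadTensor hp U 0 0 = c • 1) (hc1 : quadTensor hp U 1 1 = c • 1) {σ : ℝ}
    (hσ : σ * σ = 1) :
    ∑ i, ladder hp U (-σ) i * ladder hp U σ i =
      (2 * c) • 1 + (2 : ℂ) • (lieAct hp U (M 0 1) * lieAct hp U (M 0 1)) +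
        (σ * n * Complex.I) • lieAct hp U (M 0 1) := by
  have hσ' : (σ * Complex.I) * (σ * Complex.I) = -1 := by
    rw [mul_mul_mul_comm, Complex.I_mul_I, ← Complex.ofReal_mul, hσ]
    simp
  have h : ∀ i : Fin n, ladder hp U (-σ) i * ladder hp U σ i =
      lieAct hp U (M 0 i.succ.succ) * lieAct hp U (M 0 i.succ.succ) +
      lieAct hp U (M 1 i.succ.succ) * lieAct hp U (M 1 i.succ.succ) +
      (σ * Complex.I) • lieAct hp U (M 0 1) := by
    intro i
    have h0 : (0 : Fin (n + 2)) ≠ i.succ.succ := by simp [Fin.ext_iff]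
    have h1 : (1 : Fin (n + 2)) ≠ i.succ.succ := by simp [Fin.ext_iff]
    have hm : metric n i.succ.succ = -1 := metric_of_two_le (by simp)
    have e := lie_lieAct_M hp U 0 i.succ.succ 1 i.succ.succ
    simp only [eta_ne h0, eta_ne h1.symm, eta_ne (show (0 : Fin (n + 2)) ≠ 1 by simp), eta_self,
      hm, Complex.ofReal_zero, Complex.ofReal_one, Complex.ofReal_neg, zero_smul,
      Ring.lie_def, sub_eq_iff_eq_add] at e
    simp only [ladder, mul_add, add_mul, mul_smul_comm, smul_mul_assoc,
      Complex.ofReal_neg, neg_mul, e]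
    match_scalars <;> first | ring1 | linear_combination -hσ'
  rw [Finset.sum_congr rfl fun i _ => h i, Finset.sum_add_distrib, Finset.sum_add_distrib,
    sum_sq_lieAct_zero hp U hc0, sum_sq_lieAct_one hp U hc1, Finset.sum_const, Finset.card_univ,
    Fintype.card_fin, ← Nat.cast_smul_eq_nsmul ℂ]
  module

theorem ladder_mem_eigenspace (hp : IsCoveringMap p) (U : UnitaryRep G H) {σ : ℝ}
    (hσ : σ * σ = 1) (i : Fin n) {μ : ℝ} {v : smoothCore hp U}
    (hv : v ∈ Module.End.eigenspace (lieAct hp U (M 0 1)) (Complex.I * μ)) :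
    ladder hp U σ i v ∈ Module.End.eigenspace (lieAct hp U (M 0 1))
      (Complex.I * (μ + σ : ℝ)) := by
  rw [Module.End.mem_eigenspace_iff] at hv ⊢
  rw [← Module.End.mul_apply, mul_ladder hp U hσ, LinearMap.add_apply, Module.End.mul_apply, hv,
    map_smul, LinearMap.smul_apply, ← add_smul]
  congr 1
  push_cast
  ring

theorem sum_ladder_ladder_apply (hp : IsCoveringMap p) (U : UnitaryRep G H) {c : ℂ}
    (hc0 : quadTensor hp U 0 0 = c • 1) (hc1 : quadTensor hp U 1 1 = c • 1) {σ : ℝ}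
    (hσ : σ * σ = 1) {μ : ℝ} {v : smoothCore hp U}
    (hv : v ∈ Module.End.eigenspace (lieAct hp U (M 0 1)) (Complex.I * μ)) :
    ∑ i, ladder hp U (-σ) i (ladder hp U σ i v) = (2 * c - 2 * μ ^ 2 - σ * n * μ) • v := by
  rw [Module.End.mem_eigenspace_iff] at hv
  have h := congrArg (fun O => O v) (sum_ladder_mul_ladder hp U hc0 hc1 hσ)
  simp only [LinearMap.sum_apply, LinearMap.add_apply, LinearMap.smul_apply, Module.End.mul_apply,
    hv, map_smul, smul_smul, Module.End.one_apply, ← add_smul] at h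
  rw [h]
  congr 1
  linear_combination (2 * μ ^ 2 + σ * n * μ : ℂ) * Complex.I_mul_I

/-- By adjointness the sum is -⟨v, ∑ L(-σ) L(σ) v⟩, a scalar multiple of ‖v‖². Both the sign of the
highest weight and the vanishing of the raising operators on its weight space are read off from this
identity. -/
theorem sum_norm_ladder_sq (hp : IsCoveringMap p) (U : UnitaryRep G H) {c : ℂ}
    (hc0 : quadTensor hp U 0 0 = c • 1) (hc1 : quadTensor hp U 1 1 = c • 1) {σ : ℝ}
    (hσ : σ * σ = 1) {μ : ℝ} {v : smoothCore hp U}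
    (hv : v ∈ Module.End.eigenspace (lieAct hp U (M 0 1)) (Complex.I * μ)) :
    ((∑ i, ‖(ladder hp U σ i v : H)‖ ^ 2 : ℝ) : ℂ) =
      (2 * μ ^ 2 + σ * n * μ - 2 * c) * (‖(v : H)‖ ^ 2 : ℝ) := by
  have h1 : ∀ i, ((‖(ladder hp U σ i v : H)‖ ^ 2 : ℝ) : ℂ) =
      -inner ℂ (v : H) (ladder hp U (-σ) i (ladder hp U σ i v) : H) := fun i => by
    rw [← inner_ladder_left, inner_self_eq_norm_sq_to_K]
    simp
  rw [Complex.ofReal_sum, Finset.sum_congr rfl fun i _ => h1 i, Finset.sum_neg_distrib,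
    ← inner_sum, ← Submodule.coe_sum, sum_ladder_ladder_apply hp U hc0 hc1 hσ hv,
    Submodule.coe_smul, inner_smul_right, inner_self_eq_norm_sq_to_K]
  simp only [Complex.coe_algebraMap, Complex.ofReal_pow]
  ring

theorem inner_eq_zero_of_eigenspace_ne (hp : IsCoveringMap p) (U : UnitaryRep G H) {X : so n}
    {μ ν : ℝ} (h : μ ≠ ν) {v w : smoothCore hp U}
    (hv : v ∈ Module.End.eigenspace (lieAct hp U X) (Complex.I * μ))
    (hw : w ∈ Module.End.eigenspace (lieAct hp U X) (Complex.I * ν)) :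
    inner ℂ (v : H) (w : H) = 0 := by
  rw [Module.End.mem_eigenspace_iff] at hv hw
  have h1 := inner_lieAct_left hp U X v w
  rw [hv, hw, Submodule.coe_smul, Submodule.coe_smul, inner_smul_left, inner_smul_right, map_mul,
    Complex.conj_I, Complex.conj_ofReal] at h1
  have h2 : Complex.I * ((ν : ℂ) - μ) * inner ℂ (v : H) (w : H) = 0 := by linear_combination h1
  refine (mul_eq_zero.1 h2).resolve_left (mul_ne_zero Complex.I_ne_zero (sub_ne_zero.2 ?_))
  exact fun h3 => h (Complex.ofReal_injective h3).symm

/-- The `M 0 a` generate the algebra, since [`M 0 b`, `M 0 a`] is ±`M a b`. -/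
theorem commutant_eq_top (hp : IsCoveringMap p) (U : UnitaryRep G H) {B : H →L[ℂ] H}
    (h : ∀ a : Fin (n + 2), M 0 a ∈ commutant hp U B) : commutant hp U B = ⊤ := by
  rw [eq_top_iff]
  intro X _
  rw [eq_sum_coef X]
  refine Submodule.sum_mem _ fun a _ => Submodule.sum_mem _ fun b _ => Submodule.smul_mem _ _ ?_
  by_cases ha : a = 0
  · rw [ha]; exact h b
  by_cases hb : b = 0
  · rw [hb, M_swap]; exact Submodule.neg_mem _ (h a)
  have h1 := lie_mem_commutant hp U (h b) (h a)
  rw [M_bracket, eta_ne (Ne.symm ha), eta_ne hb, eta_self, metric_zero, M_self] at h1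
  simpa [← M_swap] using h1

end Ladder

/-! ### Decomposition under the compact generator `M_{-1,0}` -/

section Fourier

open MeasureTheory

set_option linter.unusedSectionVars false

variable {n : ℕ} {G : Type*} [Group G] [TopologicalSpace G] [IsTopologicalGroup G] {p : G →* SO0 n}
  {H : Type*} [NormedAddCommGroup H] [InnerProductSpace ℂ H] [CompleteSpace H]

theorem op_oneParam_of_eigenvector (hp : IsCoveringMap p) (U : UnitaryRep G H) {X : so n} {v : H}
    {l : ℂ} (h : HasDerivAt (fun t : ℝ => U.op (oneParam hp X t) v) (l • v) 0) (t : ℝ) :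
    U.op (oneParam hp X t) v = Complex.exp (l * t) • v := by
  have h1 : ∀ t : ℝ, HasDerivAt
      (fun t : ℝ => Complex.exp (-(l * t)) • U.op (oneParam hp X t) v) 0 t := by
    intro t
    have he : HasDerivAt (fun t : ℝ => Complex.exp (-(l * t))) (Complex.exp (-(l * t)) * -l) t := by
      have := (((hasDerivAt_id t).ofReal_comp).const_mul l).fun_neg.cexp
      simpa using this
    refine (he.smul (hasDerivAt_op_oneParam hp U h t)).congr_deriv ?_
    rw [map_smul, smul_smul, ← add_smul]
    simp
  have h2 := is_const_of_deriv_eq_zero (fun t => (h1 t).differentiableAt)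
    (fun t => (h1 t).deriv) t 0
  simp only [Complex.ofReal_zero, mul_zero, neg_zero, Complex.exp_zero, one_smul, oneParam_zero,
    U.op_one] at h2
  conv_rhs => rw [← h2]
  rw [smul_smul, ← Complex.exp_add]
  simp

/-- The span of the weight spaces of `M_{-1,0}` with weights in `l + ℤ`. -/
def weightSum (hp : IsCoveringMap p) (U : UnitaryRep G H) (l : ℝ) :
    Submodule ℂ (smoothCore hp U) :=
  ⨆ k : ℤ, Module.End.eigenspace (lieAct hp U (M 0 1)) (Complex.I * (l + k : ℝ))

/-- The scalar action of the full turn makes the integrand 2π-periodic, so shifting the orbit does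
not change the integral and only a phase comes out. -/
theorem orbitAverage_exp_mem_eigenspace (hp : IsCoveringMap p) (U : UnitaryRep G H) {l : ℝ}
    (hl : ∀ v, U.op (oneParam hp (M 0 1) (2 * Real.pi)) v =
      Complex.exp (Complex.I * l * (2 * Real.pi : ℝ)) • v) (k : ℤ) (v : smoothCore hp U) :
    (⟨orbitAverage hp U (M 0 1) (fun t => Complex.exp (-(Complex.I * (l + k : ℝ) * t))) v,
      orbitAverage_mem_smoothCore hp U (M 0 1) (by fun_prop) v.2⟩ : smoothCore hp U) ∈
      Module.End.eigenspace (lieAct hp U (M 0 1)) (Complex.I * (l + k : ℝ)) := by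
  set μ : ℝ := l + k with hμ
  set f : ℝ → H := fun t =>
    Complex.exp (-(Complex.I * μ * t)) • U.op (oneParam hp (M 0 1) t) (v : H) with hf
  have hper : Function.Periodic f (2 * Real.pi) := by
    intro t
    simp only [hf]
    rw [oneParam_add, U.op_mul, hl, map_smul, smul_smul, ← Complex.exp_add]
    congr 1
    have : -(Complex.I * (μ : ℂ) * ((t + 2 * Real.pi : ℝ) : ℂ)) +
        Complex.I * l * ((2 * Real.pi : ℝ) : ℂ) = -(Complex.I * μ * t) +
          ((-k : ℤ) : ℂ) * (2 * Real.pi * Complex.I) := by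
      rw [hμ]
      push_cast
      ring
    rw [this, Complex.exp_add, Complex.exp_int_mul_two_pi_mul_I, mul_one]
  have hshift : ∀ s : ℝ, U.op (oneParam hp (M 0 1) s)
      (orbitAverage hp U (M 0 1) (fun t => Complex.exp (-(Complex.I * μ * t))) v) =
      Complex.exp (Complex.I * μ * s) •
        orbitAverage hp U (M 0 1) (fun t => Complex.exp (-(Complex.I * μ * t))) v := by
    intro s
    have hfc : Continuous f :=
      Continuous.smul (by fun_prop) (U.continuous_op_oneParam hp (M 0 1) (v : H))
    have h1 : U.op (oneParam hp (M 0 1) s) (∫ t in (-Real.pi)..Real.pi, f t) =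
        ∫ t in (-Real.pi)..Real.pi, Complex.exp (Complex.I * μ * s) • f (t + s) := by
      rw [← ContinuousLinearMap.intervalIntegral_comp_comm _ (hfc.intervalIntegrable _ _)]
      refine intervalIntegral.integral_congr fun t _ => ?_
      simp only [hf]
      rw [map_smul, ← U.op_mul, ← oneParam_add, smul_smul, ← Complex.exp_add, add_comm s t]
      congr 2
      push_cast
      ring
    have h2 : ∫ t in (-Real.pi)..Real.pi, f (t + s) = ∫ t in (-Real.pi)..Real.pi, f t := by
      rw [intervalIntegral.integral_comp_add_right]
      have := hper.intervalIntegral_add_eq (-Real.pi + s) (-Real.pi)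
      rwa [show -Real.pi + s + 2 * Real.pi = Real.pi + s by ring,
        show -Real.pi + 2 * Real.pi = Real.pi by ring] at this
    change U.op _ (∫ t in (-Real.pi)..Real.pi, f t) = _ • ∫ t in (-Real.pi)..Real.pi, f t
    rw [h1, intervalIntegral.integral_smul, h2]
  rw [Module.End.mem_eigenspace_iff]
  apply Subtype.ext
  refine lieAct_eq_of_hasDerivAt hp U ?_
  have he : HasDerivAt (fun s : ℝ => Complex.exp (Complex.I * μ * s)) (Complex.I * μ) 0 := by
    have := (((hasDerivAt_id (0 : ℝ)).ofReal_comp).const_mul (Complex.I * μ)).cexp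
    simpa using this
  exact (he.smul_const _).congr_of_eventuallyEq (Eventually.of_forall fun s => hshift s)

/-- Multiplication by (1 + cos t)/2 shifts frequencies by 0 and ±1. -/
theorem mem_span_peakWeight (l : ℝ) (k : ℕ) :
    peakWeight l k ∈ Submodule.span ℂ
      {c : ℝ → ℂ | ∃ j : ℤ, c = fun t : ℝ => Complex.exp (-(Complex.I * (l + j : ℝ) * t))} := by
  set V := Submodule.span ℂ
      {c : ℝ → ℂ | ∃ j : ℤ, c = fun t : ℝ => Complex.exp (-(Complex.I * (l + j : ℝ) * t))} with hV
  have hcos : ∀ c ∈ V, (fun t : ℝ => c t * (((1 + Real.cos t) / 2 : ℝ) : ℂ)) ∈ V := by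
    intro c hc
    induction hc using Submodule.span_induction with
    | mem c hc =>
      obtain ⟨j, rfl⟩ := hc
      have : (fun t : ℝ => Complex.exp (-(Complex.I * (l + j : ℝ) * t)) *
          (((1 + Real.cos t) / 2 : ℝ) : ℂ)) =
          (1 / 2 : ℂ) • (fun t : ℝ => Complex.exp (-(Complex.I * (l + j : ℝ) * t))) +
          (1 / 4 : ℂ) • (fun t : ℝ => Complex.exp (-(Complex.I * (l + (j + 1 : ℤ) : ℝ) * t))) +
          (1 / 4 : ℂ) • (fun t : ℝ => Complex.exp (-(Complex.I * (l + (j - 1 : ℤ) : ℝ) * t))) := by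
        funext t
        simp only [Pi.add_apply, Pi.smul_apply, smul_eq_mul]
        rw [show -(Complex.I * ((l + (j + 1 : ℤ) : ℝ) : ℂ) * t) =
            -(Complex.I * ((l + j : ℝ) : ℂ) * t) + -t * Complex.I by push_cast; ring,
          show -(Complex.I * ((l + (j - 1 : ℤ) : ℝ) : ℂ) * t) =
            -(Complex.I * ((l + j : ℝ) : ℂ) * t) + t * Complex.I by push_cast; ring,
          Complex.exp_add, Complex.exp_add]
        push_cast
        rw [Complex.cos]
        ring
      rw [this]
      exact add_mem (add_mem (V.smul_mem _ (Submodule.subset_span ⟨_, rfl⟩))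
        (V.smul_mem _ (Submodule.subset_span ⟨_, rfl⟩)))
        (V.smul_mem _ (Submodule.subset_span ⟨_, rfl⟩))
    | zero =>
      convert! V.zero_mem using 1
      funext t
      simp
    | add c d _ _ hc hd =>
      convert! add_mem hc hd using 1
      funext t
      simp [add_mul]
    | smul r c _ hc =>
      convert! V.smul_mem r hc using 1
      funext t
      simp [mul_assoc]
  have hpow : ∀ k : ℕ, (fun t : ℝ => Complex.exp (-(Complex.I * l * t)) *
      ((((1 + Real.cos t) / 2) ^ k : ℝ) : ℂ)) ∈ V := by
    intro k
    induction k with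
    | zero => exact Submodule.subset_span ⟨0, by funext t; simp⟩
    | succ k ih =>
      convert! hcos _ ih using 1
      funext t
      rw [pow_succ]
      push_cast
      ring
  exact V.smul_mem _ (hpow k)

theorem orbitAverage_peakWeight_mem_weightSum (hp : IsCoveringMap p) (U : UnitaryRep G H) {l : ℝ}
    (hl : ∀ v, U.op (oneParam hp (M 0 1) (2 * Real.pi)) v =
      Complex.exp (Complex.I * l * (2 * Real.pi : ℝ)) • v) (k : ℕ) (v : smoothCore hp U) :
    (⟨orbitAverage hp U (M 0 1) (peakWeight l k) v,
      orbitAverage_mem_smoothCore hp U (M 0 1) (continuous_peakWeight l k) v.2⟩ :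
        smoothCore hp U) ∈ weightSum hp U l := by
  have h : ∀ c ∈ Submodule.span ℂ
      {c : ℝ → ℂ | ∃ j : ℤ, c = fun t : ℝ => Complex.exp (-(Complex.I * (l + j : ℝ) * t))},
      Continuous c ∧
        ∃ w ∈ weightSum hp U l, (w : H) = orbitAverage hp U (M 0 1) c v := by
    intro c hc
    have hint : ∀ {c : ℝ → ℂ}, Continuous c → IntervalIntegrable
        (fun t => c t • U.op (oneParam hp (M 0 1) t) (v : H)) volume (-Real.pi) Real.pi :=
      fun hc => (hc.smul (U.continuous_op_oneParam hp (M 0 1) (v : H))).intervalIntegrable _ _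
    induction hc using Submodule.span_induction with
    | mem c hc =>
      obtain ⟨j, rfl⟩ := hc
      exact ⟨by fun_prop, _, Submodule.mem_iSup_of_mem j
        (orbitAverage_exp_mem_eigenspace hp U hl j v), rfl⟩
    | zero =>
      refine ⟨continuous_const, 0, Submodule.zero_mem _, ?_⟩
      simp [orbitAverage]
    | add c d _ _ hc hd =>
      obtain ⟨hc1, w, hw, hcw⟩ := hc
      obtain ⟨hd1, u, hu, hdu⟩ := hd
      refine ⟨hc1.add hd1, w + u, add_mem hw hu, ?_⟩
      rw [Submodule.coe_add, hcw, hdu, orbitAverage, orbitAverage, orbitAverage,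
        ← intervalIntegral.integral_add (hint hc1) (hint hd1)]
      simp only [Pi.add_apply, add_smul]
    | smul r c _ hc =>
      obtain ⟨hc1, w, hw, hcw⟩ := hc
      refine ⟨hc1.const_smul r, r • w, Submodule.smul_mem _ r hw, ?_⟩
      rw [Submodule.coe_smul, hcw, orbitAverage, orbitAverage, ← intervalIntegral.integral_smul]
      simp only [Pi.smul_apply, smul_smul, smul_eq_mul]
  obtain ⟨-, w, hw, h2⟩ := h _ (mem_span_peakWeight l k)
  rwa [← show w = ⟨orbitAverage hp U (M 0 1) (peakWeight l k) v, _⟩ from Subtype.ext h2]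

theorem exists_tendsto_weightSum (hp : IsCoveringMap p) (U : UnitaryRep G H) {l : ℝ}
    (hl : ∀ v, U.op (oneParam hp (M 0 1) (2 * Real.pi)) v =
      Complex.exp (Complex.I * l * (2 * Real.pi : ℝ)) • v) (v : smoothCore hp U) :
    ∃ u : ℕ → smoothCore hp U, (∀ k, u k ∈ weightSum hp U l) ∧
      Tendsto (fun k => (u k : H)) atTop (𝓝 v) ∧
      ∀ X, Tendsto (fun k => (lieAct hp U X (u k) : H)) atTop (𝓝 (lieAct hp U X v)) :=
  ⟨_, fun k => orbitAverage_peakWeight_mem_weightSum hp U hl k v,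
    tendsto_orbitAverage_peakWeight hp U (M 0 1) l v,
    fun X => tendsto_lieAct_orbitAverage_peakWeight hp U (M 0 1) X l v⟩

theorem mem_commutant_of_eigenspace (hp : IsCoveringMap p) (U : UnitaryRep G H) {l : ℝ}
    (hl : ∀ v, U.op (oneParam hp (M 0 1) (2 * Real.pi)) v =
      Complex.exp (Complex.I * l * (2 * Real.pi : ℝ)) • v) {B : H →L[ℂ] H} {X : so n}
    (h : ∀ j k : ℤ,
      ∀ v ∈ Module.End.eigenspace (lieAct hp U (M 0 1)) (Complex.I * (l + j : ℝ)),
      ∀ w ∈ Module.End.eigenspace (lieAct hp U (M 0 1)) (Complex.I * (l + k : ℝ)),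
      inner ℂ (B (lieAct hp U X v)) (w : H) + inner ℂ (B v) (lieAct hp U X w : H) = 0) :
    X ∈ commutant hp U B := by
  have h1 : ∀ v ∈ weightSum hp U l, ∀ w ∈ weightSum hp U l,
      inner ℂ (B (lieAct hp U X v)) (w : H) + inner ℂ (B v) (lieAct hp U X w : H) = 0 := by
    intro v hv w hw
    refine Submodule.iSup_induction _ (motive := fun v : smoothCore hp U =>
      inner ℂ (B (lieAct hp U X v)) (w : H) + inner ℂ (B v) (lieAct hp U X w : H) = 0) hv
      (fun j v hv => ?_) ?_ ?_
    · refine Submodule.iSup_induction _ (motive := fun w : smoothCore hp U =>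
        inner ℂ (B (lieAct hp U X v)) (w : H) + inner ℂ (B v) (lieAct hp U X w : H) = 0) hw
        (fun k w hw => h j k v hv w hw) ?_ ?_
      · simp
      · intro w u hw hu
        simp only [map_add, Submodule.coe_add, inner_add_right]
        linear_combination hw + hu
    · simp
    · intro v u hv hu
      simp only [map_add, Submodule.coe_add, inner_add_left]
      linear_combination hv + hu
  intro v w
  obtain ⟨a, ha, ha1, ha2⟩ := exists_tendsto_weightSum hp U hl v
  obtain ⟨b, hb, hb1, hb2⟩ := exists_tendsto_weightSum hp U hl w
  have hlim := (((B.continuous.tendsto _).comp (ha2 X)).inner (𝕜 := ℂ) hb1).add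
    (((B.continuous.tendsto _).comp ha1).inner (𝕜 := ℂ) (hb2 X))
  refine tendsto_nhds_unique hlim ((tendsto_const_nhds (x := (0 : ℂ))).congr fun k => ?_)
  exact (h1 _ (ha k) _ (hb k)).symm

end Fourier

/-! ### The spectrum of the compact generator -/

section Spectrum

set_option linter.unusedSectionVars false

variable {n : ℕ} {G : Type*} [Group G] [TopologicalSpace G] [IsTopologicalGroup G] {p : G →* SO0 n}
  {H : Type*} [NormedAddCommGroup H] [InnerProductSpace ℂ H] [CompleteSpace H]

/-- The vector v is killed by f_0^+ ∧ f_k^σ for both signs σ; the sum and the difference of the two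
equations isolate f_0^+ ∧ e_b for a single basis vector e_b. -/
theorem IsHighestWeightVector.raise_eq_zero {hp : IsCoveringMap p} {U : UnitaryRep G H} {v : H}
    (hv : IsHighestWeightVector hp U v) (i : Fin n) :
    deriv (fun t : ℝ => U.op (oneParam hp (M 0 i.succ.succ) t) v) 0 +
      Complex.I • deriv (fun t : ℝ => U.op (oneParam hp (M 1 i.succ.succ) t) v) 0 = 0 := by
  set x : Fin (n + 2) → H := fun b => deriv (fun t : ℝ => U.op (oneParam hp (M 0 b) t) v) 0 +
      Complex.I • deriv (fun t : ℝ => U.op (oneParam hp (M 1 b) t) v) 0 with hx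
  change x i.succ.succ = 0
  set b : Fin (n + 2) := i.succ.succ with hb
  have hb2 : 2 ≤ (b : ℕ) := by simp [hb]
  have hsum : ∀ k : ℕ, 0 < k → 2 * k < n + 2 → ∀ σ : ℂ, σ = 1 ∨ σ = -1 →
      ∑ a, isoVec n k σ a • x a = 0 := by
    intro k hk hk2 σ hσ
    have hw := hv.annihilated 0 k hk hk2 σ hσ
    rw [wedgeAct, Fin.sum_univ_succ (n := n + 1), Fin.sum_univ_succ (n := n)] at hw
    have h0 : isoVec n 0 1 0 = 1 := by simp [isoVec]
    have h1 : isoVec n 0 1 1 = Complex.I := by simp [isoVec]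
    have h2 : ∀ c : Fin n, isoVec n 0 1 c.succ.succ = 0 := fun c => by simp [isoVec]
    simp only [h0, h1, h2, zero_mul, zero_smul, Finset.sum_const_zero, add_zero, one_mul,
      ← Finset.sum_add_distrib, Fin.succ_zero_eq_one] at hw
    rw [← hw]
    refine Finset.sum_congr rfl fun a _ => ?_
    simp only [hx, smul_add, smul_smul, mul_comm Complex.I]
  -- The index b belongs to the pair k = b / 2; its parity decides between sum and difference. When
  -- `n` is odd, the last index is even and unpaired, and the sum still works.
  have hk : 0 < (b : ℕ) / 2 := by omega
  have hk2 : 2 * ((b : ℕ) / 2) < n + 2 := by have := b.2; omega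
  have hp1 := hsum _ hk hk2 1 (Or.inl rfl)
  have hm1 := hsum _ hk hk2 (-1) (Or.inr rfl)
  rcases Nat.mod_two_eq_zero_or_one b with h | h
  · have h3 : ∑ a, (isoVec n ((b : ℕ) / 2) 1 a • x a + isoVec n ((b : ℕ) / 2) (-1) a • x a) =
        (2 : ℂ) • x b := by
      rw [Finset.sum_eq_single b]
      · rw [isoVec, isoVec, if_pos (by omega), if_pos (by omega), ← add_smul]
        norm_num
      · intro a _ hab
        have hab' : (a : ℕ) ≠ 2 * ((b : ℕ) / 2) := fun h' => hab (Fin.ext (by omega))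
        rw [isoVec, isoVec, if_neg hab', if_neg hab', ← add_smul]
        split_ifs <;> simp
      · simp
    rw [Finset.sum_add_distrib, hp1, hm1, add_zero] at h3
    exact (smul_eq_zero.1 h3.symm).resolve_left two_ne_zero
  · have h3 : ∑ a, (isoVec n ((b : ℕ) / 2) 1 a • x a - isoVec n ((b : ℕ) / 2) (-1) a • x a) =
        (2 * Complex.I : ℂ) • x b := by
      rw [Finset.sum_eq_single b]
      · have hne : ¬ (b : ℕ) = 2 * ((b : ℕ) / 2) := by omega
        have he : (b : ℕ) = 2 * ((b : ℕ) / 2) + 1 := by omega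
        rw [isoVec, isoVec, if_neg hne, if_neg hne, if_pos he, if_pos he, ← sub_smul]
        congr 1
        ring
      · intro a _ hab
        have hab' : (a : ℕ) ≠ 2 * ((b : ℕ) / 2) + 1 := fun h' => hab (Fin.ext (by omega))
        rw [isoVec, isoVec, if_neg hab', if_neg hab', ← sub_smul, sub_self, zero_smul]
      · simp
    rw [Finset.sum_sub_distrib, hp1, hm1, sub_zero] at h3
    exact (smul_eq_zero.1 h3.symm).resolve_left (mul_ne_zero two_ne_zero Complex.I_ne_zero)

/-- The weak form of annihilation by the raising operators: v is not known to be in `smoothCore`, so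
they are moved to the core vector, where they become lowering operators. -/
theorem IsHighestWeightVector.inner_ladder {hp : IsCoveringMap p} {U : UnitaryRep G H} {v : H}
    (hv : IsHighestWeightVector hp U v) (i : Fin n) (u : smoothCore hp U) :
    inner ℂ v (ladder hp U (-1) i u : H) = 0 := by
  have h0 := inner_deriv_add hp U (hasDerivAt_of_mem_smoothVectors hp U hv.smooth
    (M 0 i.succ.succ)) (hasDerivAt_lieAct hp U _ u)
  have h1 := inner_deriv_add hp U (hasDerivAt_of_mem_smoothVectors hp U hv.smooth
    (M 1 i.succ.succ)) (hasDerivAt_lieAct hp U _ u)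
  have h2 := congrArg (fun x => inner ℂ x (u : H)) (hv.raise_eq_zero i)
  simp only [inner_add_left, inner_smul_left, Complex.conj_I, inner_zero_left] at h2
  simp only [ladder, LinearMap.add_apply, LinearMap.smul_apply, Submodule.coe_add,
    Submodule.coe_smul, inner_add_right, inner_smul_right, Complex.ofReal_neg, Complex.ofReal_one]
  linear_combination h0 - Complex.I * h1 - h2

theorem IsHighestWeightVector.exists_weight {hp : IsCoveringMap p} {U : UnitaryRep G H} {v : H}
    (hv : IsHighestWeightVector hp U v) :
    ∃ l : ℝ, HasDerivAt (fun t : ℝ => U.op (oneParam hp (M 0 1) t) v) ((Complex.I * l) • v) 0 := by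
  obtain ⟨c, hc⟩ := hv.weight 0 (by omega)
  have h := hasDerivAt_of_mem_smoothVectors hp U hv.smooth (M 0 1)
  have hc' : deriv (fun t : ℝ => U.op (oneParam hp (M 0 1) t) v) 0 = c • v := hc
  rw [hc'] at h
  have h1 := inner_deriv_add hp U h h
  rw [inner_smul_left, inner_smul_right, ← add_mul] at h1
  have h2 := (mul_eq_zero.1 h1).resolve_right (inner_self_ne_zero.2 hv.ne_zero)
  refine ⟨c.im, ?_⟩
  have h3 : c = Complex.I * c.im := by
    have := congrArg Complex.re h2
    simp at this
    apply Complex.ext <;> simp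
    linarith
  rwa [← h3]

variable (hp : IsCoveringMap p) (U : UnitaryRep G H)

/-- The data of a massless representation: a weight `l` of `M_{-1,0}` to which all weights are
congruent, together with the value of the quadratic relations. -/
structure WeightData (l : ℝ) (c : ℂ) : Prop where
  op_two_pi : ∀ v, U.op (oneParam hp (M 0 1) (2 * Real.pi)) v =
    Complex.exp (Complex.I * l * (2 * Real.pi : ℝ)) • v
  tensor_zero : quadTensor hp U 0 0 = c • 1
  tensor_one : quadTensor hp U 1 1 = c • 1
  two_mul_eq : 2 * c = 2 * l ^ 2 + n * l
  nonpos : l ≤ 0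
  exists_ne_zero : ∃ w ∈ Module.End.eigenspace (lieAct hp U (M 0 1)) (Complex.I * l), w ≠ 0

theorem exists_weightData (hn : 2 ≤ n) (hU : IsCnMassless hp U) : ∃ l c, WeightData hp U l c := by
  obtain ⟨c, hc0, hc1⟩ := exists_quadTensor_eq_smul_one hn hp U hU.irreducible_poincare
  obtain ⟨v, hv, -⟩ := hU.highestWeight
  obtain ⟨l, hl⟩ := hv.exists_weight
  have hD := dense_smoothCore hp U
  have hz : ∀ v, U.op (oneParam hp (M 0 1) (2 * Real.pi)) v =
      Complex.exp (Complex.I * l * (2 * Real.pi : ℝ)) • v := by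
    -- The full turn commutes with all one-parameter subgroups, so it acts by a scalar, whose value
    -- is read off on v.
    obtain ⟨z, hz⟩ := schur U hU.irreducible_poincare
      (B := U.op (oneParam hp (M 0 1) (2 * Real.pi))) fun g hg => by
        induction hg using Subgroup.closure_induction with
        | mem g hg =>
          obtain ⟨X, hX, t, rfl⟩ := hg
          intro v
          rw [← U.op_mul, ← U.op_mul, (commute_oneParam_two_pi hp X t).eq]
        | one => intro v; rw [U.op_one, U.op_one]
        | mul g h _ _ ihg ihh => intro v; rw [U.op_mul, U.op_mul, ihg, ihh]
        | inv g _ ih =>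
          intro v
          have h := ih (U.op g⁻¹ v)
          rw [U.op_op_inv] at h
          rw [h, U.op_inv_op]
    have h1 := hz v
    rw [op_oneParam_of_eigenvector hp U hl] at h1
    rw [smul_left_injective ℂ hv.ne_zero h1]
    exact hz
  -- A substitute for v inside the core. Weight vectors of weight different from l are orthogonal to
  -- v; if those of weight l were too, v would be orthogonal to the dense core.
  obtain ⟨w, hw, hvw⟩ : ∃ w ∈ Module.End.eigenspace (lieAct hp U (M 0 1)) (Complex.I * l),
      inner ℂ v (w : H) ≠ 0 := by
    by_contra hcon
    push Not at hcon
    refine hv.ne_zero (hD.eq_zero_of_inner_left (𝕜 := ℂ) fun u hu => ?_)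
    obtain ⟨a, ha, ha1, -⟩ := exists_tendsto_weightSum hp U hz ⟨u, hu⟩
    refine tendsto_nhds_unique ((tendsto_const_nhds (x := v)).inner (𝕜 := ℂ) ha1)
      ((tendsto_const_nhds (x := (0 : ℂ))).congr fun k => Eq.symm ?_)
    refine Submodule.iSup_induction _ (motive := fun w : smoothCore hp U =>
      inner ℂ v (w : H) = 0) (ha k) (fun j w hw => ?_) ?_ ?_
    · by_cases hj : j = 0
      · rw [hj] at hw
        exact hcon w (by simpa using hw)
      · have h1 := inner_deriv_add hp U hl (hasDerivAt_lieAct hp U _ w)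
        rw [Module.End.mem_eigenspace_iff.1 hw, Submodule.coe_smul, inner_smul_left,
          inner_smul_right, map_mul, Complex.conj_I, Complex.conj_ofReal] at h1
        have h2 : Complex.I * (j : ℂ) * inner ℂ v (w : H) = 0 := by
          push_cast at h1
          linear_combination h1
        exact (mul_eq_zero.1 h2).resolve_left
          (mul_ne_zero Complex.I_ne_zero (Int.cast_ne_zero.2 hj))
    · simp
    · intro w u hw hu
      simp [hw, hu]
  have hw0 : w ≠ 0 := fun h => hvw (by simp [h])
  -- Pair ∑ L(-1) L(1) w with v: images of L(-1) are orthogonal to v, but ⟨v, w⟩ ≠ 0, so the scalar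
  -- in `sum_ladder_ladder_apply` is zero.
  have hc : 2 * c = 2 * l ^ 2 + n * l := by
    have h1 := congrArg (fun x : smoothCore hp U => inner ℂ v (x : H))
      (sum_ladder_ladder_apply hp U hc0 hc1 (one_mul (1 : ℝ)) hw)
    simp only [Submodule.coe_sum, inner_sum, hv.inner_ladder, Finset.sum_const_zero,
      Submodule.coe_smul, inner_smul_right] at h1
    have h2 := (mul_eq_zero.1 h1.symm).resolve_right hvw
    push_cast at h2
    linear_combination h2
  refine ⟨l, c, hz, hc0, hc1, hc, ?_, w, hw, hw0⟩
  -- For σ = -1 the norm identity at weight l has coefficient -2nl, which must be nonnegative.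
  have h1 := sum_norm_ladder_sq hp U hc0 hc1 (σ := -1) (by norm_num) hw
  rw [hc] at h1
  have h2 : ∑ i, ‖(ladder hp U (-1) i w : H)‖ ^ 2 = (-(2 * n * l)) * ‖(w : H)‖ ^ 2 := by
    apply Complex.ofReal_injective
    rw [h1]
    push_cast
    ring
  have h3 : 0 ≤ (-(2 * n * l)) * ‖(w : H)‖ ^ 2 := h2 ▸ Finset.sum_nonneg fun i _ => sq_nonneg _
  have h4 : 0 < ‖(w : H)‖ ^ 2 := by
    have : (w : H) ≠ 0 := fun h => hw0 (Subtype.ext h)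
    positivity
  have h5 : 0 ≤ -(2 * n * l) := nonneg_of_mul_nonneg_left h3 h4
  have h6 : (0 : ℝ) < n := by exact_mod_cast (by omega : 0 < n)
  by_contra h7
  push Not at h7
  nlinarith [mul_pos h6 h7]

variable {hp U}

/-- The value of c makes the norm identity vanish on the entire weight space of l, whatever the
relation of `v` to the highest weight vector. -/
theorem WeightData.ladder_eq_zero {l : ℝ} {c : ℂ} (h : WeightData hp U l c) (i : Fin n)
    {v : smoothCore hp U}
    (hv : v ∈ Module.End.eigenspace (lieAct hp U (M 0 1)) (Complex.I * l)) :
    ladder hp U 1 i v = 0 := by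
  have h1 := sum_norm_ladder_sq hp U h.tensor_zero h.tensor_one (one_mul (1 : ℝ)) hv
  rw [h.two_mul_eq] at h1
  have h2 : ∑ i, ‖(ladder hp U 1 i v : H)‖ ^ 2 = 0 := by
    apply Complex.ofReal_injective
    rw [h1]
    push_cast
    ring
  have h3 := (Finset.sum_eq_zero_iff_of_nonneg fun i _ => sq_nonneg _).1 h2 i (Finset.mem_univ i)
  exact Subtype.ext (norm_eq_zero.1 (pow_eq_zero_iff two_ne_zero |>.1 h3))

/-- The lowered vector has weight l, so raising kills it, and its squared norm is zero by
adjointness. -/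
theorem WeightData.ladder_neg_eq_zero {l : ℝ} {c : ℂ} (h : WeightData hp U l c) (i : Fin n)
    {v : smoothCore hp U}
    (hv : v ∈ Module.End.eigenspace (lieAct hp U (M 0 1)) (Complex.I * (l + 1 : ℝ))) :
    ladder hp U (-1) i v = 0 := by
  have h1 := ladder_mem_eigenspace hp U (σ := -1) (by norm_num) i hv
  rw [add_neg_cancel_right] at h1
  have h2 := inner_ladder_left hp U (-1) i v (ladder hp U (-1) i v)
  rw [neg_neg, h.ladder_eq_zero i h1, Submodule.coe_zero, inner_zero_right, neg_zero] at h2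
  exact Subtype.ext (inner_self_eq_zero.1 h2)

/-- All weights of `M_{-1,0}` are at most the highest weight. -/
theorem WeightData.eq_zero_of_pos {l : ℝ} {c : ℂ} (h : WeightData hp U l c)
    (hU : U.IsIrreducibleOn (analyticSubgroup hp (poincareAlg n))) {k : ℤ} (hk : 0 < k)
    {v : smoothCore hp U}
    (hv : v ∈ Module.End.eigenspace (lieAct hp U (M 0 1)) (Complex.I * (l + k : ℝ))) : v = 0 := by
  set E : ℤ → Submodule ℂ (smoothCore hp U) := fun k =>
    Module.End.eigenspace (lieAct hp U (M 0 1)) (Complex.I * (l + k : ℝ)) with hE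
  -- `Q` will project onto the closed span of the weights l + k with k ≤ 0. The ladder operators do
  -- not cross the boundary between l and l + 1 in either direction, so `Q` commutes with all of
  -- `so(2,n)`.
  set K₀ : Submodule ℂ H := ⨆ k : {k : ℤ // k ≤ 0}, (E k).map (smoothCore hp U).subtype with hK₀
  set K : Submodule ℂ H := K₀.topologicalClosure with hK
  have : CompleteSpace K := K₀.isClosed_topologicalClosure.completeSpace_coe
  set Q := K.starProjection with hQ
  have hQ1 : ∀ k ≤ 0, ∀ v ∈ E k, Q (v : H) = v := fun k hk v hv =>
    Submodule.starProjection_eq_self_iff.2 (K₀.le_topologicalClosure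
      (Submodule.mem_iSup_of_mem (⟨k, hk⟩ : {k : ℤ // k ≤ 0}) ⟨v, hv, rfl⟩))
  have hQ0 : ∀ k, 0 < k → ∀ v ∈ E k, Q (v : H) = 0 := fun k hk v hv => by
    rw [hQ, Submodule.starProjection_apply_eq_zero_iff, Submodule.mem_orthogonal]
    intro u hu
    have hcl : IsClosed {u : H | inner ℂ u (v : H) = 0} :=
      isClosed_eq (continuous_id.inner continuous_const) continuous_const
    refine closure_minimal (fun u hu => ?_) hcl hu
    refine Submodule.iSup_induction _ (motive := fun u => inner ℂ u (v : H) = 0) hu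
      (fun j u hu => ?_) (inner_zero_left _)
      (fun u w hu hw => by rw [inner_add_left, hu, hw, add_zero])
    obtain ⟨u, hu, rfl⟩ := hu
    refine inner_eq_zero_of_eigenspace_ne hp U (fun hjk => ?_) hu hv
    have h1 : (j : ℤ) = k := by exact_mod_cast add_left_cancel hjk
    have := j.2
    omega
  have hcomm : ∀ X : so n, (∀ k ≤ 0, ∀ v ∈ E k, Q (lieAct hp U X v) = lieAct hp U X v) →
      (∀ k, 0 < k → ∀ v ∈ E k, Q (lieAct hp U X v) = 0) → X ∈ commutant hp U Q := by
    intro X h1 h0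
    refine mem_commutant_of_eigenspace hp U h.op_two_pi fun j k v hv w hw => ?_
    by_cases hj : j ≤ 0
    · rw [h1 j hj v hv, hQ1 j hj v hv, inner_lieAct_left, neg_add_cancel]
    · rw [h0 j (not_le.1 hj) v hv, hQ0 j (not_le.1 hj) v hv, inner_zero_left, inner_zero_left,
        add_zero]
  have hN : M 0 1 ∈ commutant hp U Q := by
    refine hcomm _ (fun k hk v hv => ?_) (fun k hk v hv => ?_)
    · rw [Module.End.mem_eigenspace_iff.1 hv, Submodule.coe_smul, map_smul, hQ1 k hk v hv]
    · rw [Module.End.mem_eigenspace_iff.1 hv, Submodule.coe_smul, map_smul, hQ0 k hk v hv,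
        smul_zero]
  have hup : ∀ k (i : Fin n), ∀ v ∈ E k, ladder hp U 1 i v ∈ E (k + 1) := fun k i v hv => by
    have := ladder_mem_eigenspace hp U (one_mul (1 : ℝ)) i hv
    simp only [hE]
    rwa [show l + ((k + 1 : ℤ) : ℝ) = l + k + 1 by push_cast; ring]
  have hdown : ∀ k (i : Fin n), ∀ v ∈ E k, ladder hp U (-1) i v ∈ E (k - 1) := fun k i v hv => by
    have := ladder_mem_eigenspace hp U (σ := -1) (by norm_num) i hv
    simp only [hE]
    rwa [show l + ((k - 1 : ℤ) : ℝ) = l + k + -1 by push_cast; ring]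
  have hM : ∀ i : Fin n, M 0 i.succ.succ ∈ commutant hp U Q := by
    intro i
    have hexp : ∀ v : smoothCore hp U, (lieAct hp U (M 0 i.succ.succ) v : H) =
        (1 / 2 : ℂ) • ((ladder hp U 1 i v : H) + ladder hp U (-1) i v) := fun v => by
      rw [lieAct_zero_eq_ladder]
      rfl
    refine hcomm _ (fun k hk v hv => ?_) (fun k hk v hv => ?_)
    · have h1 : Q (ladder hp U 1 i v) = ladder hp U 1 i v := by
        by_cases hk0 : k = 0
        · rw [h.ladder_eq_zero i (by simpa [hE, hk0] using hv), Submodule.coe_zero, map_zero]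
        · exact hQ1 (k + 1) (by omega) _ (hup k i v hv)
      rw [hexp, map_smul, map_add, h1, hQ1 (k - 1) (by omega) _ (hdown k i v hv)]
    · have h1 : Q (ladder hp U (-1) i v) = 0 := by
        by_cases hk1 : k = 1
        · rw [h.ladder_neg_eq_zero i (by simpa [hE, hk1] using hv), Submodule.coe_zero, map_zero]
        · exact hQ0 (k - 1) (by omega) _ (hdown k i v hv)
      rw [hexp, map_smul, map_add, h1, hQ0 (k + 1) (by omega) _ (hup k i v hv), add_zero, smul_zero]
  have htop : commutant hp U Q = ⊤ := commutant_eq_top hp U fun a => by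
    refine Fin.cases ?_ (fun b => Fin.cases ?_ (fun i => hM i) b) a
    · rw [M_self]; exact Submodule.zero_mem _
    · exact hN
  -- `Q` is a scalar and fixes a nonzero vector of weight l, so it is 1; but it kills every weight
  -- vector above l.
  obtain ⟨z, hz⟩ := exists_smul_of_le_commutant hp U hU (B := Q) (htop ▸ le_top)
  obtain ⟨w, hw, hw0⟩ := h.exists_ne_zero
  have h1 := hQ1 0 le_rfl w (by simpa [hE] using hw)
  have hw0' : (w : H) ≠ 0 := fun h => hw0 (Subtype.ext h)
  rw [hz] at h1
  have hz1 : z = 1 := smul_left_injective ℂ hw0' (by simpa using h1)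
  have h2 := hQ0 k hk v hv
  rw [hz, hz1, one_smul] at h2
  exact Subtype.ext h2

/-- A bounded operator commuting with the Lorentz group is scalar. -/
theorem exists_smul_of_lorentzAlg_le_commutant (hn : 2 ≤ n) (hU : IsCnMassless hp U)
    {B : H →L[ℂ] H} (hB : lorentzAlg n ≤ commutant hp U B) : ∃ z : ℂ, ∀ v, B v = z • v := by
  obtain ⟨l, c, h⟩ := exists_weightData hp U hn hU
  have hirr := hU.irreducible_poincare
  have hLor : ∀ α β : Fin (n + 1), M α.succ β.succ ∈ commutant hp U B := fun α β =>
    hB (Submodule.subset_span ⟨α, β, rfl⟩)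
  have hcreal : (starRingEnd ℂ) c = c := by
    have h1 : c = ((l ^ 2 + n * l / 2 : ℝ) : ℂ) := by
      push_cast
      linear_combination h.two_mul_eq / 2
    rw [h1, Complex.conj_ofReal]
  set N := lieAct hp U (M 0 1) with hNdef
  -- Commutation of `B` with N², through N² = ∑ `M 1 i`² - c with Lorentz generators on the right.
  have hsq : ∀ v w : smoothCore hp U,
      inner ℂ (B (N (N v))) (w : H) = inner ℂ (B v) (N (N w) : H) := by
    intro v w
    have hN : ∀ v, N (N v) = ∑ i : Fin n, lieAct hp U (M 1 i.succ.succ)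
        (lieAct hp U (M 1 i.succ.succ) v) - c • v := fun v => by
      have := congrArg (fun O => O v) (sum_sq_lieAct_one hp U h.tensor_one)
      simp only [LinearMap.sum_apply, Module.End.mul_apply, LinearMap.add_apply,
        LinearMap.smul_apply, Module.End.one_apply] at this
      rw [this, add_sub_cancel_left]
    have h1 : ∀ i : Fin n, ∀ v w : smoothCore hp U,
        inner ℂ (B (lieAct hp U (M 1 i.succ.succ) (lieAct hp U (M 1 i.succ.succ) v))) (w : H) =
        inner ℂ (B v) (lieAct hp U (M 1 i.succ.succ) (lieAct hp U (M 1 i.succ.succ) w) : H) := by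
      intro i v w
      have hm := hLor 0 i.succ
      rw [Fin.succ_zero_eq_one] at hm
      linear_combination hm (lieAct hp U (M 1 i.succ.succ) v) w -
        hm v (lieAct hp U (M 1 i.succ.succ) w)
    rw [hN, hN]
    simp only [Submodule.coe_sub, Submodule.coe_sum, Submodule.coe_smul, map_sub, map_sum, map_smul,
      inner_sub_left, inner_sub_right, sum_inner, inner_sum, inner_smul_left, inner_smul_right,
      hcreal, h1]
  -- Between weight vectors of weights μ and ν, `hsq` gives (ν² - μ²) ⟨B v, w⟩ = 0. Both weights are
  -- ≤ 0, so μ + ν = 0 only if both vanish, and N² separates weights as well as N does.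
  have hNmem : M 0 1 ∈ commutant hp U B := by
    refine mem_commutant_of_eigenspace hp U h.op_two_pi fun j k v hv w hw => ?_
    by_cases hv0 : v = 0
    · simp [hv0]
    by_cases hw0 : w = 0
    · simp [hw0]
    have hj : j ≤ 0 := not_lt.1 fun hj => hv0 (h.eq_zero_of_pos hirr hj hv)
    have hk : k ≤ 0 := not_lt.1 fun hk => hw0 (h.eq_zero_of_pos hirr hk hw)
    rw [Module.End.mem_eigenspace_iff] at hv hw
    have h1 := hsq v w
    simp only [hNdef, hv, hw, map_smul, Submodule.coe_smul, inner_smul_left, inner_smul_right,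
      map_mul, Complex.conj_I, Complex.conj_ofReal] at h1 ⊢
    set μ : ℝ := l + j
    set ν : ℝ := l + k
    have h2 : ((ν - μ : ℝ) : ℂ) * (((μ + ν : ℝ) : ℂ) * inner ℂ (B v) (w : H)) = 0 := by
      push_cast
      linear_combination h1 + (ν ^ 2 - μ ^ 2 : ℂ) * inner ℂ (B v) (w : H) * Complex.I_mul_I
    rcases mul_eq_zero.1 h2 with h3 | h3
    · have h4 : (ν : ℂ) - μ = 0 := by exact_mod_cast h3
      linear_combination Complex.I * inner ℂ (B v) (w : H) * h4
    rcases mul_eq_zero.1 h3 with h4 | h4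
    · have h5 : μ + ν = 0 := Complex.ofReal_eq_zero.1 h4
      have hj' : (j : ℝ) ≤ 0 := by exact_mod_cast hj
      have hk' : (k : ℝ) ≤ 0 := by exact_mod_cast hk
      have hμ : μ ≤ 0 := add_nonpos h.nonpos hj'
      have hν : ν ≤ 0 := add_nonpos h.nonpos hk'
      have hμ0 : μ = 0 := by linarith
      have hν0 : ν = 0 := by linarith
      rw [hμ0, hν0]
      simp
    · rw [h4]
      simp
  have htop : commutant hp U B = ⊤ := commutant_eq_top hp U fun a => by
    refine Fin.cases ?_ (fun b => Fin.cases ?_ (fun i => ?_) b) a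
    · rw [M_self]; exact Submodule.zero_mem _
    · exact hNmem
    -- The remaining generators arise as [`M 0 1`, `M 1 i`] = `M 0 i`.
    · have hm := lie_mem_commutant hp U hNmem (hLor 0 i.succ)
      rw [Fin.succ_zero_eq_one, M_bracket, eta_ne (show (0 : Fin (n + 2)) ≠ i.succ.succ by
        simp [Fin.ext_iff]), eta_ne (show (1 : Fin (n + 2)) ≠ i.succ.succ by simp [Fin.ext_iff]),
        eta_ne (show (0 : Fin (n + 2)) ≠ 1 by simp), eta_self, metric_one] at hm
      simpa using hm
  exact exists_smul_of_le_commutant hp U hirr (htop ▸ le_top)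

end Spectrum

/-! ### The contraction -/

section Contraction

set_option linter.unusedSectionVars false

variable {n : ℕ} {G : Type*} [Group G] [TopologicalSpace G] [IsTopologicalGroup G] {p : G →* SO0 n}
  {H : Type*} [NormedAddCommGroup H] [InnerProductSpace ℂ H] [CompleteSpace H]

theorem mem_graph_dU_iff (hp : IsCoveringMap p) (U : UnitaryRep G H) (X : so n) (v w : H) :
    (v, w) ∈ (dU hp U X).graph ↔ HasDerivAt (fun t : ℝ => U.op (oneParam hp X t) v) w 0 := by
  rw [LinearPMap.mem_graph_iff]
  constructor
  · rintro ⟨x, rfl, hx⟩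
    have h : DifferentiableAt ℝ (fun t : ℝ => U.op (oneParam hp X t) (x : H)) 0 := x.2
    rw [show w = deriv (fun t : ℝ => U.op (oneParam hp X t) (x : H)) 0 from hx.symm]
    exact h.hasDerivAt
  · intro h
    exact ⟨⟨v, h.differentiableAt⟩, rfl, h.deriv⟩

/-- The members of a contraction family are nonzero multiples of the identity. -/
theorem IsContractionFamily.exists_smul (hn : 2 ≤ n) {hp : IsCoveringMap p} {U : UnitaryRep G H}
    (hU : IsCnMassless hp U) {Z : ℝ → H →ₗ.[ℂ] H} (hZ : IsContractionFamily hp U Z) {ρ : ℝ}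
    (hρ : ρ ∈ Set.Ioc (0 : ℝ) 1) :
    ∃ z : ℂ, z ≠ 0 ∧ ∀ v w, (v, w) ∈ (Z ρ).graph ↔ w = z • v := by
  -- `M` with equal indices is 0, so its operator is defined on all of H; equality of graphs then
  -- forces the domain of Z_ρ to be everything, and the closed graph theorem will make Z_ρ bounded.
  have hdom : ∀ v : H, v ∈ (Z ρ).domain := by
    intro v
    have h : (v, (0 : H)) ∈ ((dU hp U (M (0 : Fin (n + 1)).succ (0 : Fin (n + 1)).succ)).graph :
        Set (H × H)) := by
      rw [SetLike.mem_coe, mem_graph_dU_iff, M_self]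
      simp only [oneParam_zero_left]
      exact hasDerivAt_const _ _
    rw [← hZ.commutes ρ hρ 0 0] at h
    obtain ⟨x, y, h1, -, -⟩ := h
    exact LinearPMap.mem_domain_of_mem_graph h1
  let f : H →ₗ[ℂ] H := (Z ρ).toFun ∘ₗ LinearMap.codRestrict (Z ρ).domain LinearMap.id hdom
  have hf : ∀ v w, (v, w) ∈ (Z ρ).graph ↔ w = f v := by
    intro v w
    rw [LinearPMap.mem_graph_iff]
    constructor
    · rintro ⟨x, rfl, hx⟩
      exact hx.symm
    · intro h
      exact ⟨⟨v, hdom v⟩, rfl, h.symm⟩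
  have hcont : Continuous f := by
    refine LinearMap.continuous_of_isClosed_graph f ?_
    have h1 : ((Z ρ).graph : Set (H × H)) = (f.graph : Set (H × H)) := by
      ext ⟨v, w⟩
      rw [SetLike.mem_coe, SetLike.mem_coe, hf, LinearMap.mem_graph_iff]
    rw [← h1]
    exact hZ.closed ρ hρ
  let B : H →L[ℂ] H := ⟨f, hcont⟩
  have hB : ∀ α β : Fin (n + 1), M α.succ β.succ ∈ commutant hp U B := by
    intro α β v w
    have h : ((v : H), (lieAct hp U (M α.succ β.succ) v : H)) ∈
        ((dU hp U (M α.succ β.succ)).graph : Set (H × H)) := by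
      rw [SetLike.mem_coe, mem_graph_dU_iff]
      exact hasDerivAt_lieAct hp U _ v
    rw [← hZ.commutes ρ hρ α β] at h
    obtain ⟨x, y, h1, h2, h3⟩ := h
    rw [hf] at h1 h3
    rw [mem_graph_dU_iff] at h2
    change inner ℂ (f _) _ + inner ℂ (f _) _ = 0
    rw [← h1, ← h3]
    exact inner_deriv_add hp U h2 (hasDerivAt_lieAct hp U _ w)
  obtain ⟨z, hz⟩ := exists_smul_of_lorentzAlg_le_commutant hn hU (B := B) (by
    refine Submodule.span_le.2 ?_
    rintro _ ⟨α, β, rfl⟩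
    exact hB α β)
  refine ⟨z, ?_, fun v w => by rw [hf, ← hz v]; rfl⟩
  rintro rfl
  have := hU.irreducible.1
  obtain ⟨v, hv⟩ := exists_ne (0 : H)
  have h0 : Z ρ ⟨v, hdom v⟩ = Z ρ 0 := by
    rw [LinearPMap.map_zero]
    exact (hz v).trans (zero_smul ℂ v)
  exact hv (congrArg Subtype.val (hZ.injective ρ hρ h0))

theorem IsContractionFamily.mem_Uρ_iff (hn : 2 ≤ n) {hp : IsCoveringMap p} {U : UnitaryRep G H}
    (hU : IsCnMassless hp U) {Z : ℝ → H →ₗ.[ℂ] H} (hZ : IsContractionFamily hp U Z) {ρ : ℝ}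
    (hρ : ρ ∈ Set.Ioc (0 : ℝ) 1) (X : so n) (v w : H) :
    (v, w) ∈ Uρ hp U Z ρ X ↔
      HasDerivAt (fun t : ℝ => U.op (oneParam hp (S ρ X) t) v) w 0 := by
  obtain ⟨z, hz0, hz⟩ := hZ.exists_smul hn hU hρ
  rw [← mem_graph_dU_iff, Uρ, conjGraph, Set.mem_ofPred_eq]
  constructor
  · rintro ⟨x, y, h1, h2, h3⟩
    rw [hz] at h1 h3
    rw [h1, h3] at h2
    have h4 := Submodule.smul_mem _ z⁻¹ h2
    rwa [Prod.smul_mk, smul_smul, smul_smul, inv_mul_cancel₀ hz0, one_smul, one_smul] at h4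
  · intro h
    exact ⟨z • v, z • w, (hz _ _).2 rfl, Submodule.smul_mem _ z h, (hz _ _).2 rfl⟩

theorem IsContractionFamily.tendsToAt_lorentz_iff (hn : 2 ≤ n) {hp : IsCoveringMap p}
    {U : UnitaryRep G H} (hU : IsCnMassless hp U) {Z : ℝ → H →ₗ.[ℂ] H}
    (hZ : IsContractionFamily hp U Z) {X : so n} (hX : X ∈ lorentzAlg n) (v w : H) :
    TendsToAt hp U Z X v w ↔ HasDerivAt (fun t : ℝ => U.op (oneParam hp X t) v) w 0 := by
  have h : ∀ ρ ∈ Set.Ioc (0 : ℝ) 1, ∀ u, (v, u) ∈ Uρ hp U Z ρ X ↔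
      HasDerivAt (fun t : ℝ => U.op (oneParam hp X t) v) u 0 := fun ρ hρ u => by
    rw [hZ.mem_Uρ_iff hn hU hρ, S_of_mem_lorentzAlg ρ hX]
  constructor
  · rintro ⟨u, hu, hlim⟩
    have h1 := (h 1 ⟨one_pos, le_rfl⟩ _).1 (hu 1 ⟨one_pos, le_rfl⟩)
    have h2 : Tendsto u (𝓝[>] 0) (𝓝 (u 1)) := by
      refine tendsto_const_nhds.congr' ?_
      filter_upwards [Ioc_mem_nhdsGT (one_pos (α := ℝ))] with ρ hρ
      exact h1.unique ((h ρ hρ _).1 (hu ρ hρ))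
    rwa [tendsto_nhds_unique hlim h2]
  · intro hw
    exact ⟨fun _ => w, fun ρ hρ => (h ρ hρ w).2 hw, tendsto_const_nhds⟩

/-- U_ρ multiplies one fixed vector, the derivative of the orbit of v along `translGen a`, by √ρ. -/
theorem IsContractionFamily.tendsToAt_translGen_iff (hn : 2 ≤ n) {hp : IsCoveringMap p}
    {U : UnitaryRep G H} (hU : IsCnMassless hp U) {Z : ℝ → H →ₗ.[ℂ] H}
    (hZ : IsContractionFamily hp U Z) {v : H} (hv : v ∈ smoothVectors hp U)
    (a : Fin (n + 1) → ℝ) (w : H) : TendsToAt hp U Z (translGen a) v w ↔ w = 0 := by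
  set d := deriv (fun t : ℝ => U.op (oneParam hp (translGen a) t) v) 0 with hd
  have h : ∀ ρ ∈ Set.Ioc (0 : ℝ) 1, ∀ u, (v, u) ∈ Uρ hp U Z ρ (translGen a) ↔
      u = Real.sqrt ρ • d := fun ρ hρ u => by
    have h1 : HasDerivAt (fun t : ℝ => U.op (oneParam hp (S ρ (translGen a)) t) v)
        (Real.sqrt ρ • d) 0 := by
      simp only [S_translGen, oneParam_smul]
      have h2 : HasDerivAt (fun t : ℝ => U.op (oneParam hp (translGen a) t) v) d
          (Real.sqrt ρ * 0) := by
        rw [mul_zero]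
        exact hasDerivAt_of_mem_smoothVectors hp U hv (translGen a)
      have h3 : HasDerivAt (fun t : ℝ => Real.sqrt ρ * t) (Real.sqrt ρ) 0 := by
        simpa using (hasDerivAt_id (0 : ℝ)).const_mul (Real.sqrt ρ)
      exact h2.scomp (0 : ℝ) h3
    rw [hZ.mem_Uρ_iff hn hU hρ]
    exact ⟨fun h2 => h2.unique h1, fun h2 => h2 ▸ h1⟩
  have hlim : Tendsto (fun ρ : ℝ => Real.sqrt ρ • d) (𝓝[>] 0) (𝓝 0) := by
    have h1 : Continuous fun ρ : ℝ => Real.sqrt ρ • d := by fun_prop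
    have h2 := h1.tendsto 0
    rw [Real.sqrt_zero, zero_smul] at h2
    exact h2.mono_left nhdsWithin_le_nhds
  constructor
  · rintro ⟨u, hu, hlim'⟩
    refine tendsto_nhds_unique hlim' (hlim.congr' ?_)
    filter_upwards [Ioc_mem_nhdsGT (one_pos (α := ℝ))] with ρ hρ
    exact ((h ρ hρ _).1 (hu ρ hρ)).symm
  · rintro rfl
    exact ⟨_, fun ρ hρ => (h ρ hρ _).2 rfl, hlim⟩

theorem UnitaryRep.ext_op {K : Type*} [Group K] [TopologicalSpace K] {V W : UnitaryRep K H}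
    (h : ∀ g v, V.op g v = W.op g v) : V = W := by
  obtain ⟨f, hf⟩ := V
  obtain ⟨g, hg⟩ := W
  congr 1
  ext k : 2
  exact ContinuousLinearMap.ext fun v => h k v

/-- The representation `(a, g) ↦ U(g)` of the covering of the Poincaré group, trivial on the
translations. -/
def trivialExtension (hp : IsCoveringMap p) (U : UnitaryRep G H) :
    UnitaryRep (PoincareCover hp) H where
  toHom := U.toHom.comp ((LorentzCover hp).subtype.comp SemidirectProduct.rightHom)
  continuous_orbit v := by
    have h1 : Continuous fun x : PoincareCover hp => x.right :=
      continuous_snd.comp (continuous_induced_dom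
        (f := fun x : PoincareCover hp => (Multiplicative.toAdd x.left, x.right)))
    exact (U.continuous_op v).comp (continuous_subtype_val.comp h1)

theorem trivialExtension_op (hp : IsCoveringMap p) (U : UnitaryRep G H) (x : PoincareCover hp) :
    (trivialExtension hp U).op x = U.op x.right := rfl

theorem isContraction_trivialExtension (hn : 2 ≤ n) {hp : IsCoveringMap p} {U : UnitaryRep G H}
    (hU : IsCnMassless hp U) {Z : ℝ → H →ₗ.[ℂ] H} (hZ : IsContractionFamily hp U Z) :
    IsContraction hp U Z (trivialExtension hp U) where
  lorentz v hv X hX := by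
    have h := hasDerivAt_of_mem_smoothVectors hp U hv X
    exact ⟨_, (hZ.tendsToAt_lorentz_iff hn hU hX v _).2 h, h⟩
  translation v hv a := by
    refine ⟨0, (hZ.tendsToAt_translGen_iff hn hU hv a 0).2 rfl, ?_⟩
    simp only [trivialExtension_op, transl, SemidirectProduct.right_inl, OneMemClass.coe_one,
      U.op_one]
    exact hasDerivAt_const _ _

theorem IsContraction.op_transl (hn : 2 ≤ n) {hp : IsCoveringMap p} {U : UnitaryRep G H}
    (hU : IsCnMassless hp U) {Z : ℝ → H →ₗ.[ℂ] H} (hZ : IsContractionFamily hp U Z)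
    {W : UnitaryRep (PoincareCover hp) H} (hW : IsContraction hp U Z W) (a : Fin (n + 1) → ℝ) :
    W.op (transl hp a) = 1 := by
  have hadd : ∀ s t : ℝ, transl hp ((s + t) • a) = transl hp (t • a) * transl hp (s • a) := by
    intro s t
    rw [add_smul, add_comm, transl, transl, transl, ← map_mul, ofAdd_add]
  have h1 : ∀ v ∈ smoothVectors hp U, W.op (transl hp a) v = v := by
    intro v hv
    obtain ⟨w, hw, hd⟩ := hW.translation v hv a
    rw [(hZ.tendsToAt_translGen_iff hn hU hv a w).1 hw] at hd
    have h := eq_of_hasDerivAt_zero_shift (f := fun t => W.op (transl hp (t • a)) v)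
      (fun t => ?_) 1
    · simpa [transl, W.op_one] using h
    -- The operator of the finite translation stands on the left, so the derivative is always taken
    -- at `v` itself; `W` is not known to preserve the smooth vectors of `U`.
    · have h2 := ((W.op (transl hp (t • a))).restrictScalars ℝ).hasFDerivAt.comp_hasDerivAt
        (0 : ℝ) hd
      rw [map_zero] at h2
      refine h2.congr_of_eventuallyEq (Eventually.of_forall fun s => ?_)
      simp only [hadd, W.op_mul, Function.comp_apply, ContinuousLinearMap.coe_restrictScalars']
  refine ContinuousLinearMap.ext fun v => ?_
  exact congrFun (Continuous.ext_on (dense_smoothVectors hp U) (W.op _).continuous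
    continuous_id fun v hv => h1 v hv) v

theorem IsContraction.op_lorentzIncl_oneParam (hn : 2 ≤ n) {hp : IsCoveringMap p}
    {U : UnitaryRep G H} (hU : IsCnMassless hp U) {Z : ℝ → H →ₗ.[ℂ] H}
    (hZ : IsContractionFamily hp U Z) {W : UnitaryRep (PoincareCover hp) H}
    (hW : IsContraction hp U Z W) {X : so n} (hX : X ∈ lorentzAlg n) (t : ℝ) (v : H) :
    W.op (lorentzIncl hp ⟨oneParam hp X t, oneParam_mem hp hX t⟩) v =
      U.op (oneParam hp X t) v := by
  set δ : ℝ → PoincareCover hp := fun t =>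
    lorentzIncl hp ⟨oneParam hp X t, oneParam_mem hp hX t⟩ with hδ
  have hadd : ∀ s t, δ (s + t) = δ s * δ t := fun s t => by
    simp only [hδ, lorentzIncl, ← map_mul]
    congr 1
    exact Subtype.ext (oneParam_add hp X s t)
  have h0 : δ 0 = 1 := by
    simp only [hδ, lorentzIncl, ← map_one SemidirectProduct.inr]
    congr 1
    exact Subtype.ext (oneParam_zero hp X)
  have h1 : ∀ v ∈ smoothVectors hp U, W.op (δ t) v = U.op (oneParam hp X t) v := by
    intro v hv
    -- W(δ t)⁻¹ U(exp tX) v is constant. Here a shift in t does replace `v`, by U(exp tX) v, which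
    -- is again smooth because `U` preserves its smooth vectors.
    have h := eq_of_hasDerivAt_zero_shift
      (f := fun t => W.op (δ t)⁻¹ (U.op (oneParam hp X t) v)) (fun t => ?_) t
    · simp only [h0, inv_one, oneParam_zero, U.op_one, W.op_one] at h
      rw [← W.op_op_inv (δ t) (U.op (oneParam hp X t) v), h]
    · set u := U.op (oneParam hp X t) v with hu
      have hus : u ∈ smoothVectors hp U := op_mem_smoothVectors hp U _ hv
      obtain ⟨w, hw, hd⟩ := hW.lorentz u hus X hX
      rw [hZ.tendsToAt_lorentz_iff hn hU hX] at hw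
      have h2 : HasDerivAt (fun s => U.op (oneParam hp X s) u - W.op (δ s) u) 0 0 := by
        have := hw.fun_sub hd
        rwa [sub_self] at this
      -- W(δ s)⁻¹ varies with s but is isometric, so the o(s) bound on U(exp sX) u - W(δ s) u
      -- survives its application.
      have h3 : HasDerivAt (fun s => W.op (δ s)⁻¹ (U.op (oneParam hp X s) u)) 0 0 := by
        rw [hasDerivAt_iff_isLittleO] at h2 ⊢
        refine Asymptotics.IsLittleO.congr_left (f₁ := fun s =>
          W.op (δ s)⁻¹ (U.op (oneParam hp X s) u - W.op (δ s) u)) ?_ fun s => ?_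
        rotate_left
        · simp only [map_sub, W.op_inv_op, h0, oneParam_zero, inv_one, U.op_one, W.op_one,
            smul_zero, sub_zero]
        · refine Asymptotics.IsLittleO.of_norm_left ?_
          simp only [W.norm_op]
          refine Asymptotics.IsLittleO.norm_left ?_
          simpa [h0, oneParam_zero, U.op_one, W.op_one] using h2
      have h4 := ((W.op (δ t)⁻¹).restrictScalars ℝ).hasFDerivAt.comp_hasDerivAt (0 : ℝ) h3
      rw [map_zero] at h4
      refine h4.congr_of_eventuallyEq (Eventually.of_forall fun s => ?_)
      simp only [hadd, oneParam_add, W.op_mul, U.op_mul, mul_inv_rev, Function.comp_apply,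
        ContinuousLinearMap.coe_restrictScalars', hu]
  exact congrFun (Continuous.ext_on (dense_smoothVectors hp U) (W.op _).continuous
    (U.op _).continuous fun v hv => h1 v hv) v

theorem IsContraction.op_lorentzIncl (hn : 2 ≤ n) {hp : IsCoveringMap p}
    {U : UnitaryRep G H} (hU : IsCnMassless hp U) {Z : ℝ → H →ₗ.[ℂ] H}
    (hZ : IsContractionFamily hp U Z) {W : UnitaryRep (PoincareCover hp) H}
    (hW : IsContraction hp U Z W) {g : G} (hg : g ∈ LorentzCover hp) :
    ∀ v, W.op (lorentzIncl hp ⟨g, hg⟩) v = U.op g v := by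
  induction hg using Subgroup.closure_induction with
  | mem g hg =>
    obtain ⟨X, hX, t, rfl⟩ := hg
    exact fun v => hW.op_lorentzIncl_oneParam hn hU hZ hX t v
  | one =>
    intro v
    rw [U.op_one, show lorentzIncl hp ⟨1, _⟩ = 1 from map_one SemidirectProduct.inr, W.op_one]
  | mul g h hg hh ihg ihh =>
    intro v
    rw [U.op_mul, ← ihg, ← ihh, ← W.op_mul]
    congr 2
    exact map_mul SemidirectProduct.inr (⟨g, hg⟩ : LorentzCover hp) ⟨h, hh⟩
  | inv g hg ih =>
    intro v
    have h := ih (U.op g⁻¹ v)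
    rw [U.op_op_inv] at h
    rw [← W.op_inv_op (lorentzIncl hp ⟨g, hg⟩) (U.op g⁻¹ v), h]
    congr 2
    exact map_inv SemidirectProduct.inr (⟨g, hg⟩ : LorentzCover hp)

theorem IsContraction.eq_trivialExtension (hn : 2 ≤ n) {hp : IsCoveringMap p}
    {U : UnitaryRep G H} (hU : IsCnMassless hp U) {Z : ℝ → H →ₗ.[ℂ] H}
    (hZ : IsContractionFamily hp U Z) {W : UnitaryRep (PoincareCover hp) H}
    (hW : IsContraction hp U Z W) : W = trivialExtension hp U := by
  refine UnitaryRep.ext_op fun x v => ?_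
  have hx : x = transl hp (Multiplicative.toAdd x.left) * lorentzIncl hp x.right :=
    (SemidirectProduct.inl_left_mul_inr_right x).symm
  rw [trivialExtension_op, ← hW.op_lorentzIncl hn hU hZ x.right.2]
  conv_lhs => rw [hx]
  rw [W.op_mul, hW.op_transl hn hU hZ]
  rfl

end Contraction

end ConfMassless

end

/-! ### The contraction theorem -/

theorem mainTheorem4 (n : ℕ) (hn : 2 ≤ n)
    {G : Type*} [Group G] [TopologicalSpace G] [IsTopologicalGroup G] [SimplyConnectedSpace G]
    (p : G →* SO0 n) (hp : IsCoveringMap p)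
    {H : Type*} [NormedAddCommGroup H] [InnerProductSpace ℂ H] [CompleteSpace H]
    (U : UnitaryRep G H) (hU : IsCnMassless hp U)
    (Z : ℝ → H →ₗ.[ℂ] H) (hZ : IsContractionFamily hp U Z) :
    -- `ρ` is the curvature of the homogeneous space `S_{n+1} / L_{n+1}` of `𝒢_n^ρ`
    (∀ ρ : ℝ, 0 < ρ → ∀ a b c : Fin (n + 1) → ℝ,
      -bracketρ ρ (bracketρ ρ (translGen a) (translGen b)) (translGen c) =
        (ρ • translGen (minkowski b c • a - minkowski a c • b) : so n)) ∧
    -- as `ρ → 0` the bracket of `𝒢_n^ρ` tends to that of the Poincaré algebra `𝒫_{n+1}`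
    (∀ X Y : so n,
      Tendsto (fun ρ : ℝ => linPart (bracketρ ρ X Y)) (𝓝[>] 0)
        (𝓝 (linPart X * linPart Y - linPart Y * linPart X)) ∧
      Tendsto (fun ρ : ℝ => transPart (bracketρ ρ X Y)) (𝓝[>] 0)
        (𝓝 (linPart X *ᵥ transPart Y - linPart Y *ᵥ transPart X))) ∧
    -- as `ρ → 0` the operators `U_ρ(∑ a_α M_{-1,α})` tend to zero on a dense subspace
    Dense (smoothVectors hp U : Set H) ∧
    (∀ v ∈ smoothVectors hp U, ∀ a : Fin (n + 1) → ℝ, TendsToAt hp U Z (translGen a) v 0) ∧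
    -- the contracted representation exists, is unique, and is trivial on the translations
    (∃! W : UnitaryRep (PoincareCover hp) H, IsContraction hp U Z W) ∧
    (∀ W : UnitaryRep (PoincareCover hp) H, IsContraction hp U Z W →
      ∀ a : Fin (n + 1) → ℝ, W.op (transl hp a) = 1) := by
  refine ⟨fun ρ hρ a b c => curvature_bracketρ hρ a b c,
    fun X Y => ⟨tendsto_linPart_bracketρ X Y, tendsto_transPart_bracketρ X Y⟩,
    dense_smoothVectors hp U,
    fun v hv a => (hZ.tendsToAt_translGen_iff hn hU hv a 0).2 rfl,
    ⟨trivialExtension hp U, isContraction_trivialExtension hn hU hZ,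
      fun W hW => hW.eq_trivialExtension hn hU hZ⟩,
    fun W hW a => hW.op_transl hn hU hZ a⟩
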